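/- Let $d\ge 1$. Let $\mathcal X_d\subset \mathbb P(S^2\mathbb R^d)$ be the set of classes $[Q]$ of positive definite symmetric $d\times d$ matrices, on which $g\in \mathrm{SL}(d,\mathbb R)$ acts by $g\cdot[Q]=[gQg^{T}]$, and let $\overline{\mathcal X_d}$ be its closure in $\mathbb P(S^2\mathbb R^d)$. For $o,x\in\mathcal X_d$ and $h\in\overline{\mathcal X_d}$, with positive definite representatives $O,Q$ of $o,x$ such that $\det(O^{-1}Q)=1$ and a positive semidefinite representative $S$ of $h$, put $$\mathfrak s_o(x,h)=\log\left(\tfrac1d\operatorname{Tr}(Q^{-1}S)\right)-\log\left(\tfrac1d\operatorname{Tr}(O^{-1}S)\right).$$ For a subgroup $\Gamma<\mathrm{SL}(d,\mathbb R)$ and $o\in\mathcal X_d$, the Dirichlet–Selberg domain is $$\mathcal{DS}_\Gamma(o)=\{h\in\overline{\mathcal X_d} \mid \mathfrak s_o(o,h)\le \mathfrak s_o(\gamma\cdot o,h)\ \text{ for all }\gamma\in\Gamma\}.$$ A side of a convex set $C\subset\mathcal X_d$ is a nonempty maximal convex subset of the boundary of $C$ in $\mathcal X_d$. A finitely generated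 subgroup $\Gamma<\mathrm{SL}(d,\mathbb R)$ is $k$-Anosov ($1\le k\le d-1$) if for some word metric $|\cdot|$ of a finite generating set of $\Gamma$ there are $A,B>0$ with $\log(\sigma_k(\gamma)/\sigma_{k+1}(\gamma))\ge A|\gamma|-B$ for all $\gamma\in\Gamma$, where $\sigma_1\ge\dots\ge\sigma_d$ are the singular values. It is projective Anosov if it is $1$-Anosov, and Borel Anosov if it is $k$-Anosov for all $1\le k\le d-1$. Let $n\ge 2$, let $q(v,w)=v_0w_0-\sum_{i=1}^n v_iw_i$ on $\mathbb R^{n+1}$, and let $\mathrm{SO}(1,n)<\mathrm{SL}(n+1,\mathbb R)$ be the subgroup that preserves $q$. Let $\mathcal H\subset\mathcal X_{n+1}$ be the totally geodesic copy of $\mathbb H^n$ consisting of the points $x_\ell=[q_\ell^{-1}]$, where $\ell$ is a line on which $q$ is positive and $q_\ell$ is the symmetric bilinear form for which $\ell$ and its $q$-orthogonal $\ell^\perp$ are orthogonal, $q_\ell=q$ on $\ell$ and $q_\ell=-q$ on $\ell^\perp$. A lattice in $\mathrm{SO}(1,n)$ is a discrete subgroup of finite Haar covolume; it is uniform if the quotient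 is compact. **Theorem.** 1. For every lattice $\Gamma$ in $\mathrm{SO}(1,n)$ and every $o\in\mathcal H$, the set $\mathcal{DS}_\Gamma(o)\cap\mathcal X_{n+1}$ has infinitely many sides. 2. Every uniform lattice in $\mathrm{SO}(1,n)$ is a projective Anosov subgroup of $\mathrm{SL}(n+1,\mathbb R)$, and if $n=2$ it is a Borel Anosov subgroup of $\mathrm{SL}(3,\mathbb R)$. 3. In particular, there are projective (and, for $n=2$, Borel) Anosov subgroups of $\mathrm{SL}(n+1,\mathbb R)$ with infinitely-sided Dirichlet–Selberg domains: there is a uniform lattice $\Gamma$ in $\mathrm{SO}(1,n)$, it is projective Anosov (and Borel Anosov if $n=2$), and $\mathcal{DS}_\Gamma(o)\cap\mathcal X_{n+1}$ has infinitely many sides for every $o\in\mathcal H$. -/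

import Mathlib

open Matrix MeasureTheory
open scoped LinearAlgebra.Projectivization

noncomputable section

namespace DirichletSelberg

/-! ### The projective model of the symmetric space of `SL(d, ℝ)` -/

/-- The space `S²V` of symmetric 2-tensors for `V = ℝ^d`, as symmetric `d × d` matrices. -/
def symTensors (d : ℕ) : Submodule ℝ (Matrix (Fin d) (Fin d) ℝ) where
  carrier := {Q | Q.IsSymm}
  add_mem' hA hB := Matrix.IsSymm.add hA hB
  zero_mem' := Matrix.isSymm_zero
  smul_mem' c _ hA := Matrix.IsSymm.smul hA c

/-- The linear action `g • Q = g Q gᵀ` of `SL(d, ℝ)` on symmetric 2-tensors. -/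
instance symTensorsAction (d : ℕ) :
    DistribMulAction (SpecialLinearGroup (Fin d) ℝ) (symTensors d) where
  smul g Q := ⟨g.1 * Q.1 * g.1ᵀ, by
    have hQ : Q.1ᵀ = Q.1 := Q.2
    change (g.1 * Q.1 * g.1ᵀ)ᵀ = g.1 * Q.1 * g.1ᵀ
    simp only [Matrix.transpose_mul, Matrix.transpose_transpose, hQ, Matrix.mul_assoc]⟩
  one_smul Q := Subtype.ext (by
    change (1 : Matrix (Fin d) (Fin d) ℝ) * Q.1 * (1 : Matrix (Fin d) (Fin d) ℝ)ᵀ = Q.1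
    simp)
  mul_smul g h Q := Subtype.ext (by
    change (g.1 * h.1) * Q.1 * (g.1 * h.1)ᵀ = g.1 * (h.1 * Q.1 * h.1ᵀ) * g.1ᵀ
    simp only [Matrix.transpose_mul, Matrix.mul_assoc])
  smul_zero g := Subtype.ext (by
    change g.1 * (0 : Matrix (Fin d) (Fin d) ℝ) * g.1ᵀ = 0
    simp)
  smul_add g Q R := Subtype.ext (by
    change g.1 * (Q.1 + R.1) * g.1ᵀ = g.1 * Q.1 * g.1ᵀ + g.1 * R.1 * g.1ᵀ
    simp only [Matrix.mul_add, Matrix.add_mul])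

instance symTensorsSMulComm (d : ℕ) :
    SMulCommClass (SpecialLinearGroup (Fin d) ℝ) ℝ (symTensors d) where
  smul_comm g c Q := Subtype.ext (by
    change g.1 * (c • Q.1) * g.1ᵀ = c • (g.1 * Q.1 * g.1ᵀ)
    simp)

/-- The projective space `ℙ(S²V)`; `SL(d, ℝ)` acts on it through its linear action on `S²V`. -/
abbrev ProjSym (d : ℕ) : Type := ℙ ℝ (symTensors d)

/-- The quotient topology on `ℙ(S²V)`. -/
instance projSymTopology (d : ℕ) : TopologicalSpace (ProjSym d) :=
  TopologicalSpace.coinduced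
    (Projectivization.mk' ℝ : {Q : symTensors d // Q ≠ 0} → ProjSym d) inferInstance

/-- The matrix `Q` is a representative of the point `x` of `ℙ(S²V)`. -/
def Represents {d : ℕ} (Q : Matrix (Fin d) (Fin d) ℝ) (x : ProjSym d) : Prop :=
  ∃ (hs : Q ∈ symTensors d) (h0 : (⟨Q, hs⟩ : symTensors d) ≠ 0),
    Projectivization.mk ℝ (⟨Q, hs⟩ : symTensors d) h0 = x

/-- The projective model `𝒳_d`: classes of positive definite symmetric matrices. -/
def projModel (d : ℕ) : Set (ProjSym d) := {x | ∃ Q, Q.PosDef ∧ Represents Q x}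

/-- The Satake compactification: the closure of `𝒳_d` in `ℙ(S²V)`. -/
def satake (d : ℕ) : Set (ProjSym d) := closure (projModel d)

/-! ### Dirichlet–Selberg domains -/

/-- The difference `𝔰(x, h) - 𝔰(o, h)` of Selberg invariants, in terms of representatives
`O`, `Q`, `S` of `o`, `x`, `h`, where `det (O⁻¹ Q) = 1`. -/
def selbergDiff {d : ℕ} (O Q S : Matrix (Fin d) (Fin d) ℝ) : ℝ :=
  Real.log (1 / (d : ℝ) * (Q⁻¹ * S).trace) - Real.log (1 / (d : ℝ) * (O⁻¹ * S).trace)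

/-- The Dirichlet–Selberg domain of `Γ` based at `o`: the points `h` of the Satake
compactification with `𝔰_o(o, h) ≤ 𝔰_o(γ • o, h)` for all `γ ∈ Γ`. The inequality does not depend
on the representatives. -/
def dirichletSelberg {d : ℕ} (Γ : Subgroup (SpecialLinearGroup (Fin d) ℝ)) (o : ProjSym d) :
    Set (ProjSym d) :=
  {h | h ∈ satake d ∧ ∀ γ ∈ Γ, ∀ O Q S : Matrix (Fin d) (Fin d) ℝ,
    O.PosDef → Represents O o → Q.PosDef → Represents Q (γ • o) →
    S.PosSemidef → Represents S h → (O⁻¹ * Q).det = 1 →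
    selbergDiff O O S ≤ selbergDiff O Q S}

/-- A subset of the projective model is convex if the cone of its positive definite
representatives is convex; equivalently, it contains, with two points, the projective segment
inside `𝒳_d` that joins them. -/
def ProjConvex {d : ℕ} (C : Set (ProjSym d)) : Prop :=
  C ⊆ projModel d ∧
    Convex ℝ {Q : Matrix (Fin d) (Fin d) ℝ | Q.PosDef ∧ ∃ x ∈ C, Represents Q x}

/-- The topological boundary in `𝒳_d` of a subset `C` of `𝒳_d`. -/
def modelBoundary {d : ℕ} (C : Set (ProjSym d)) : Set (ProjSym d) :=
  (Subtype.val : projModel d → ProjSym d) ''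
    frontier ((Subtype.val : projModel d → ProjSym d) ⁻¹' C)

/-- The sides of `C`: the nonempty maximal convex subsets of its boundary in `𝒳_d`. -/
def sides {d : ℕ} (C : Set (ProjSym d)) : Set (Set (ProjSym d)) :=
  {S | S.Nonempty ∧ Maximal (fun T => T ⊆ modelBoundary C ∧ ProjConvex T) S}

/-! ### `SO(1, n)` and the copy of hyperbolic space -/

/-- The standard symmetric bilinear form of signature `(1, n)` on `ℝ^(n+1)`. -/
def lorentz {n : ℕ} (v w : Fin (n + 1) → ℝ) : ℝ :=
  v 0 * w 0 - ∑ i : Fin n, v i.succ * w i.succ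

/-- The group `SO(1, n)` of elements of `SL(n+1, ℝ)` that preserve the form. -/
def SO1 (n : ℕ) : Subgroup (SpecialLinearGroup (Fin (n + 1)) ℝ) where
  carrier := {g | ∀ v w, lorentz (g.1 *ᵥ v) (g.1 *ᵥ w) = lorentz v w}
  mul_mem' {g h} hg hh v w := by
    change lorentz ((g.1 * h.1) *ᵥ v) ((g.1 * h.1) *ᵥ w) = lorentz v w
    rw [← Matrix.mulVec_mulVec, ← Matrix.mulVec_mulVec, hg, hh]
  one_mem' v w := by
    change lorentz ((1 : Matrix _ _ ℝ) *ᵥ v) ((1 : Matrix _ _ ℝ) *ᵥ w) = lorentz v w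
    simp
  inv_mem' {g} hg v w := by
    have hmul : g.1 * (g⁻¹).1 = 1 := congrArg Subtype.val (mul_inv_cancel g)
    have key := hg ((g⁻¹).1 *ᵥ v) ((g⁻¹).1 *ᵥ w)
    simpa only [Matrix.mulVec_mulVec, hmul, Matrix.one_mulVec] using key.symm

instance SO1MeasurableSpace (n : ℕ) : MeasurableSpace (SO1 n) := borel _

instance SO1BorelSpace (n : ℕ) : BorelSpace (SO1 n) := ⟨rfl⟩

/-- `M` is the matrix of the bilinear form `q_ℓ`, where `ℓ` is the line spanned by `v`: `ℓ` and its
orthogonal `ℓ^⊥` for `q` are orthogonal for `q_ℓ`, `q_ℓ = q` on `ℓ` and `q_ℓ = -q` on `ℓ^⊥`. -/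
def IsLineForm {n : ℕ} (v : Fin (n + 1) → ℝ) (M : Matrix (Fin (n + 1)) (Fin (n + 1)) ℝ) : Prop :=
  M.IsSymm ∧ v ⬝ᵥ (M *ᵥ v) = lorentz v v ∧
    (∀ w, lorentz v w = 0 → v ⬝ᵥ (M *ᵥ w) = 0) ∧
    ∀ w w', lorentz v w = 0 → lorentz v w' = 0 → w ⬝ᵥ (M *ᵥ w') = -lorentz w w'

/-- The totally geodesic copy of `ℍ^n` in `𝒳_(n+1)`: the points `x_ℓ = [q_ℓ⁻¹]`, for `ℓ` a line on
which the form is positive. -/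
def hyperbolicCopy (n : ℕ) : Set (ProjSym (n + 1)) :=
  {x | ∃ v M, 0 < lorentz v v ∧ IsLineForm v M ∧ Represents M⁻¹ x}

/-! ### Lattices -/

/-- A lattice: a discrete subgroup with a fundamental domain of finite Haar measure. -/
def IsLattice {G : Type*} [Group G] [TopologicalSpace G] [IsTopologicalGroup G]
    [MeasurableSpace G] [BorelSpace G] (Γ : Subgroup G) : Prop :=
  DiscreteTopology Γ ∧
    ∃ μ : Measure G, μ.IsHaarMeasure ∧ ∃ F : Set G, IsFundamentalDomain Γ F μ ∧ μ F < ⊤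

/-- A uniform lattice: a lattice with compact quotient. -/
def IsUniformLattice {G : Type*} [Group G] [TopologicalSpace G] [IsTopologicalGroup G]
    [MeasurableSpace G] [BorelSpace G] (Γ : Subgroup G) : Prop :=
  IsLattice Γ ∧ CompactSpace (G ⧸ Γ)

/-! ### Anosov subgroups -/

/-- The word length of `g` with respect to `S`: the least length of a word in `S ∪ S⁻¹` that
represents `g`. -/
def wordLength {G : Type*} [Group G] (S : Set G) (g : G) : ℕ :=
  sInf {k | ∃ l : List G, (∀ x ∈ l, x ∈ S ∨ x⁻¹ ∈ S) ∧ l.prod = g ∧ l.length = k}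

/-- The `k`-th singular value `σ_k(g)`, for `1 ≤ k ≤ d`, in decreasing order. (The sequence
`LinearMap.singularValues` starts at index `0`.) -/
def singularValue {d : ℕ} (k : ℕ) (g : SpecialLinearGroup (Fin d) ℝ) : ℝ :=
  (Matrix.toEuclideanLin g.1).singularValues (k - 1)

/-- `k`-Anosov subgroups of `SL(d, ℝ)`, for `1 ≤ k ≤ d - 1`: there are a finite generating set and
constants `A, B > 0` with `log (σ_k(γ) / σ_(k+1)(γ)) ≥ A |γ| - B` for all `γ`. -/
def IsAnosov {d : ℕ} (k : ℕ) (Γ : Subgroup (SpecialLinearGroup (Fin d) ℝ)) : Prop :=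
  ∃ S : Finset Γ, Subgroup.closure (S : Set Γ) = ⊤ ∧
    ∃ A > (0 : ℝ), ∃ B > (0 : ℝ), ∀ γ : Γ,
      A * (wordLength (S : Set Γ) γ : ℝ) - B ≤
        Real.log (singularValue k γ.1 / singularValue (k + 1) γ.1)

/-- Projective Anosov means `1`-Anosov. -/
def IsProjectiveAnosov {d : ℕ} (Γ : Subgroup (SpecialLinearGroup (Fin d) ℝ)) : Prop :=
  IsAnosov 1 Γ

/-- Borel Anosov means `k`-Anosov for all `1 ≤ k ≤ d - 1`. -/
def IsBorelAnosov {d : ℕ} (Γ : Subgroup (SpecialLinearGroup (Fin d) ℝ)) : Prop :=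
  ∀ k, 1 ≤ k → k < d → IsAnosov k Γ

end DirichletSelberg

end

open Matrix MeasureTheory
open scoped LinearAlgebra.Projectivization

noncomputable section
namespace DirichletSelberg

open Topology Filter

/-! Infinitely many sides. Write $J$ for the Gram matrix of $q$ and let $o=[q_\ell^{-1}]$ with
$\ell$ spanned by a unit timelike $v$. Since $q_\ell = 2\,Jv(Jv)^T - J$ and the term $J$ is the same
for every line, comparing Selberg invariants of $o$ and $\gamma o$ at a positive definite $S$
amounts to comparing the values of the quadratic form $S$ at $Jv$ and at $J\gamma v$
(`trace_lineForm_mul`, `dirichletSelberg_inter_projModel`). The domain is therefore a locally finite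
polyhedron: the forms that attain at $Jv$ their minimum over an orbit. With finitely many sides,
finitely many of its inequalities would imply all the others (`exists_finite_of_finite_sides`).
Letting $S$ degenerate to the rank one form $\eta\eta^T$ turns this into a statement on vectors:
finitely many conditions $|q(\eta,v)|\le|q(\eta,w)|$ would imply those for the whole orbit of $v$.

This is false (`IsLattice.not_forall_abs_lorentz_le`). Take $\eta\perp v$ that is orthogonal to none
of the finitely many $w$; the finite system then holds near $\eta$. As $n\ge 2$, some unit spacelike
$u$ is orthogonal to $v$ and $\eta$. Recurrence of the boost in the plane of $v,u$ on the finite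
volume quotient (`IsLattice.exists_mul_pow_mul`) gives orbit points $\gamma v$ whose directions
approach the lightlike $v+u\in\eta^\perp$. A small perturbation of $\eta$ is orthogonal to such a
$\gamma v$ but not to $v$, which violates the inequality of $\gamma$.

Anosov property. Each $g\in\mathrm{SO}(1,n)$ is a boost by some $t\ge0$ times an orthogonal matrix
(`exists_boost_mul`), so $g^Tg$ is conjugate to the boost by $2t$, and the first and last singular
value gaps of $g$ have logarithm at least $t$. For a uniform lattice the Švarc–Milnor argument
bounds word length by $t+3$ (`IsUniformLattice.exists_word`). For $n=2$ the first and last gaps are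
all the gaps.

Existence. The group of $\sqrt2x_0^2-\sum x_i^2$ over $\mathbb Z[\sqrt2]$ is a uniform lattice: the
conjugate form is definite, which gives discreteness and a uniform lower bound for lattice vectors.
Geometry of numbers then yields bounded frames, which fall into finitely many classes under the
group (`isUniformLattice_arithSubgroup`). -/

/-! ### The Lorentz form -/

section Lorentz

variable {n : ℕ}

/-- The Gram matrix of the Lorentz form. -/
def lorentzMatrix (n : ℕ) : Matrix (Fin (n + 1)) (Fin (n + 1)) ℝ :=
  diagonal (Fin.cons 1 fun _ => -1)

lemma lorentz_eq_dotProduct (v w : Fin (n + 1) → ℝ) :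
    lorentz v w = v ⬝ᵥ (lorentzMatrix n *ᵥ w) := by
  simp [lorentz, lorentzMatrix, dotProduct, mulVec_diagonal, Fin.sum_univ_succ, sub_eq_add_neg]

lemma lorentzMatrix_transpose : (lorentzMatrix n)ᵀ = lorentzMatrix n := by
  simp [lorentzMatrix]

lemma lorentzMatrix_mul_self : lorentzMatrix n * lorentzMatrix n = 1 := by
  rw [lorentzMatrix, diagonal_mul_diagonal, ← diagonal_one]
  congr 1
  funext i
  refine Fin.cases ?_ (fun j => ?_) i <;> simp

lemma lorentzMatrix_mulVec_mulVec (v : Fin (n + 1) → ℝ) :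
    lorentzMatrix n *ᵥ (lorentzMatrix n *ᵥ v) = v := by
  rw [mulVec_mulVec, lorentzMatrix_mul_self, one_mulVec]

lemma lorentz_comm (v w : Fin (n + 1) → ℝ) : lorentz v w = lorentz w v := by
  simp [lorentz, mul_comm]

lemma lorentz_add_left (u v w : Fin (n + 1) → ℝ) :
    lorentz (u + v) w = lorentz u w + lorentz v w := by
  simp [lorentz_eq_dotProduct, add_dotProduct]

lemma lorentz_add_right (u v w : Fin (n + 1) → ℝ) :
    lorentz u (v + w) = lorentz u v + lorentz u w := by
  rw [lorentz_comm, lorentz_add_left, lorentz_comm v, lorentz_comm w]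

lemma lorentz_smul_left (c : ℝ) (v w : Fin (n + 1) → ℝ) :
    lorentz (c • v) w = c * lorentz v w := by
  simp [lorentz_eq_dotProduct]

lemma lorentz_smul_right (c : ℝ) (v w : Fin (n + 1) → ℝ) :
    lorentz v (c • w) = c * lorentz v w := by
  rw [lorentz_comm, lorentz_smul_left, lorentz_comm]

lemma lorentz_neg_left (v w : Fin (n + 1) → ℝ) : lorentz (-v) w = -lorentz v w := by
  simp [lorentz_eq_dotProduct]

lemma lorentz_sub_left (u v w : Fin (n + 1) → ℝ) :
    lorentz (u - v) w = lorentz u w - lorentz v w := by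
  simp [lorentz_eq_dotProduct, sub_dotProduct]

lemma lorentz_sub_right (u v w : Fin (n + 1) → ℝ) :
    lorentz u (v - w) = lorentz u v - lorentz u w := by
  rw [lorentz_comm, lorentz_sub_left, lorentz_comm v, lorentz_comm w]

lemma continuous_lorentz {X : Type*} [TopologicalSpace X] {f g : X → Fin (n + 1) → ℝ}
    (hf : Continuous f) (hg : Continuous g) : Continuous fun x => lorentz (f x) (g x) := by
  unfold lorentz
  fun_prop

/-- A vector orthogonal to a timelike vector is spacelike. -/
lemma lorentz_self_nonpos_of_orthogonal {v z : Fin (n + 1) → ℝ} (hv : 0 < lorentz v v)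
    (hz : lorentz v z = 0) : lorentz z z ≤ 0 ∧ (lorentz z z = 0 → z = 0) := by
  have cs : (∑ i : Fin n, v i.succ * z i.succ) ^ 2 ≤
      (∑ i : Fin n, v i.succ ^ 2) * ∑ i : Fin n, z i.succ ^ 2 :=
    Finset.sum_mul_sq_le_sq_mul_sq _ _ _
  simp only [lorentz, ← sq] at *
  set a := ∑ i : Fin n, v i.succ ^ 2
  set b := ∑ i : Fin n, z i.succ ^ 2 with hb
  have ha0 : 0 ≤ a := Finset.sum_nonneg fun _ _ => sq_nonneg _
  have hb0 : 0 ≤ b := Finset.sum_nonneg fun _ _ => sq_nonneg _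
  have h0 : (v 0) ^ 2 * (z 0) ^ 2 ≤ a * b := by
    rw [← sub_eq_zero.mp hz] at cs
    nlinarith
  constructor
  · by_contra h
    push Not at h
    nlinarith [mul_nonneg ha0 hb0, mul_pos hv h]
  · intro h
    have hb1 : b = 0 := by
      by_contra hne
      have : 0 < b := lt_of_le_of_ne hb0 (Ne.symm hne)
      have hzb : z 0 ^ 2 = b := by linarith
      rw [hzb] at h0
      nlinarith [mul_pos this (show 0 < v 0 ^ 2 - a from hv)]
    have hz0 : z 0 = 0 := by
      have : z 0 ^ 2 = 0 := by linarith
      simpa using this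
    funext i
    refine Fin.cases hz0 (fun j => ?_) i
    have := (Finset.sum_eq_zero_iff_of_nonneg (fun _ _ => sq_nonneg _)).mp hb1 j
      (Finset.mem_univ _)
    simpa using this

end Lorentz

/-! ### The group `SO(1, n)` -/

section Group

variable {n : ℕ}

lemma mem_SO1_iff (g : SpecialLinearGroup (Fin (n + 1)) ℝ) :
    g ∈ SO1 n ↔ g.1ᵀ * lorentzMatrix n * g.1 = lorentzMatrix n := by
  change (∀ v w, lorentz (g.1 *ᵥ v) (g.1 *ᵥ w) = lorentz v w) ↔ _
  have key : ∀ v w, lorentz (g.1 *ᵥ v) (g.1 *ᵥ w) =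
      v ⬝ᵥ ((g.1ᵀ * lorentzMatrix n * g.1) *ᵥ w) := by
    intro v w
    rw [lorentz_eq_dotProduct, ← mulVec_mulVec, ← mulVec_mulVec, mulVec_transpose,
      dotProduct_comm v, ← dotProduct_mulVec, dotProduct_comm]
  simp only [key, lorentz_eq_dotProduct]
  constructor
  · intro h
    ext i j
    simpa using h (Pi.single i 1) (Pi.single j 1)
  · intro h v w
    rw [h]

lemma SO1_transpose_mul (g : SO1 n) : g.1.1ᵀ * lorentzMatrix n * g.1.1 = lorentzMatrix n :=
  (mem_SO1_iff g.1).mp g.2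

lemma SO1_lorentz (g : SO1 n) (v w : Fin (n + 1) → ℝ) :
    lorentz (g.1.1 *ᵥ v) (g.1.1 *ᵥ w) = lorentz v w := g.2 v w

lemma SO1_coe_mul (g h : SO1 n) : (g * h).1.1 = g.1.1 * h.1.1 := rfl

lemma SO1_coe_one : (1 : SO1 n).1.1 = 1 := rfl

lemma SO1_mul_inv (g : SO1 n) : g.1.1 * (g⁻¹).1.1 = 1 := by
  rw [← SO1_coe_mul, mul_inv_cancel, SO1_coe_one]

lemma SO1_inv_mul (g : SO1 n) : (g⁻¹).1.1 * g.1.1 = 1 := by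
  rw [← SO1_coe_mul, inv_mul_cancel, SO1_coe_one]

lemma SO1_lorentz_left (g : SO1 n) (v w : Fin (n + 1) → ℝ) :
    lorentz (g.1.1 *ᵥ v) w = lorentz v ((g⁻¹).1.1 *ᵥ w) := by
  rw [← SO1_lorentz g v, mulVec_mulVec, SO1_mul_inv, one_mulVec]

/-- An element of `SO(1, n)` from a matrix that preserves the form and has determinant one. -/
def SO1.mk (M : Matrix (Fin (n + 1)) (Fin (n + 1)) ℝ) (hd : M.det = 1)
    (hM : Mᵀ * lorentzMatrix n * M = lorentzMatrix n) : SO1 n :=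
  ⟨⟨M, hd⟩, (mem_SO1_iff _).mpr hM⟩

lemma SO1_ext {g h : SO1 n} (H : g.1.1 = h.1.1) : g = h := Subtype.ext (Subtype.ext H)

lemma isClosed_SO1 : IsClosed (SO1 n : Set (SpecialLinearGroup (Fin (n + 1)) ℝ)) := by
  have : (SO1 n : Set (SpecialLinearGroup (Fin (n + 1)) ℝ)) =
      {g | g.1ᵀ * lorentzMatrix n * g.1 = lorentzMatrix n} := Set.ext fun g => mem_SO1_iff g
  rw [this]
  have hc : Continuous fun g : SpecialLinearGroup (Fin (n + 1)) ℝ => g.1 :=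
    continuous_subtype_val
  exact isClosed_eq ((hc.matrix_transpose.matrix_mul continuous_const).matrix_mul hc)
    continuous_const

lemma isClosedEmbedding_SO1 : IsClosedEmbedding fun g : SO1 n => g.1.1 :=
  SpecialLinearGroup.isClosedEmbedding_val.comp isClosed_SO1.isClosedEmbedding_subtypeVal

lemma continuous_SO1_coe : Continuous fun g : SO1 n => g.1.1 := isClosedEmbedding_SO1.continuous

instance : LocallyCompactSpace (Matrix (Fin (n + 1)) (Fin (n + 1)) ℝ) :=
  inferInstanceAs (LocallyCompactSpace (Fin (n + 1) → Fin (n + 1) → ℝ))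

instance : SecondCountableTopology (Matrix (Fin (n + 1)) (Fin (n + 1)) ℝ) :=
  inferInstanceAs (SecondCountableTopology (Fin (n + 1) → Fin (n + 1) → ℝ))

instance : LocallyCompactSpace (SO1 n) := isClosedEmbedding_SO1.locallyCompactSpace

instance : SecondCountableTopology (SO1 n) :=
  isClosedEmbedding_SO1.isEmbedding.secondCountableTopology

instance : T2Space (SO1 n) := isClosedEmbedding_SO1.isEmbedding.t2Space

lemma isCompact_matrix_entries_le {m : Type*} (R : ℝ) :
    IsCompact {M : Matrix m m ℝ | ∀ i j, |M i j| ≤ R} := by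
  have := IsCompact.matrix (m := m) (n := m) (isCompact_Icc (a := -R) (b := R))
  convert this using 1
  ext M
  simp [Set.matrix, abs_le]

lemma isCompact_SO1_entries_le (R : ℝ) : IsCompact {g : SO1 n | ∀ i j, |g.1.1 i j| ≤ R} :=
  isClosedEmbedding_SO1.isCompact_preimage (isCompact_matrix_entries_le R)

end Group

/-! ### Boosts -/

section Boost

variable {n : ℕ}

/-- The infinitesimal boost in the plane spanned by `v` and `u`. -/
def boostGen (v u : Fin (n + 1) → ℝ) : Matrix (Fin (n + 1)) (Fin (n + 1)) ℝ :=
  vecMulVec u (lorentzMatrix n *ᵥ v) - vecMulVec v (lorentzMatrix n *ᵥ u)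

lemma boostGen_mulVec (v u x : Fin (n + 1) → ℝ) :
    boostGen v u *ᵥ x = lorentz v x • u - lorentz u x • v := by
  have h : ∀ a b : Fin (n + 1) → ℝ, vecMulVec a (lorentzMatrix n *ᵥ b) *ᵥ x = lorentz b x • a := by
    intro a b
    rw [vecMulVec_mulVec, dotProduct_comm, ← lorentz_eq_dotProduct, lorentz_comm]
    simp
  rw [boostGen, sub_mulVec, h, h]

/-- The matrix of the boost by `t` in the plane spanned by `v` and `u`. -/
def boostMatrix (v u : Fin (n + 1) → ℝ) (t : ℝ) : Matrix (Fin (n + 1)) (Fin (n + 1)) ℝ :=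
  1 + Real.sinh t • boostGen v u + (Real.cosh t - 1) • (boostGen v u * boostGen v u)

/-- A pair of orthogonal vectors, the first of norm `1` and the second of norm `-1`. -/
structure IsHyperbolicPair (v u : Fin (n + 1) → ℝ) : Prop where
  left : lorentz v v = 1
  right : lorentz u u = -1
  orth : lorentz v u = 0

variable {v u : Fin (n + 1) → ℝ}

lemma boostMatrix_zero : boostMatrix v u 0 = 1 := by simp [boostMatrix]

/-- The generator swaps `v` and `u` and kills their orthogonal complement, so its square is a
projection. This is why its exponential has the closed form `boostMatrix`. -/
lemma IsHyperbolicPair.gen_cube (h : IsHyperbolicPair v u) :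
    boostGen v u * boostGen v u * boostGen v u = boostGen v u := by
  refine Matrix.ext_of_mulVec_single fun i => ?_
  have h3 : lorentz u v = 0 := by rw [lorentz_comm, h.orth]
  simp only [← mulVec_mulVec, boostGen_mulVec, lorentz_sub_right, lorentz_smul_right, h.left,
    h.right, h.orth, h3]
  module

lemma IsHyperbolicPair.boostMatrix_add (h : IsHyperbolicPair v u) (s t : ℝ) :
    boostMatrix v u (s + t) = boostMatrix v u s * boostMatrix v u t := by
  have h3 := h.gen_cube
  have h4 : boostGen v u * (boostGen v u * boostGen v u) = boostGen v u := by
    rw [← Matrix.mul_assoc, h3]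
  have h5 : boostGen v u * boostGen v u * (boostGen v u * boostGen v u) =
      boostGen v u * boostGen v u := by
    rw [← Matrix.mul_assoc, h3]
  simp only [boostMatrix, Real.sinh_add, Real.cosh_add, Matrix.add_mul, Matrix.mul_add,
    Matrix.smul_mul, Matrix.mul_smul, one_mul, mul_one, h3, h4, h5]
  module

lemma lorentz_boostGen (x y : Fin (n + 1) → ℝ) :
    lorentz (boostGen v u *ᵥ x) y = -lorentz x (boostGen v u *ᵥ y) := by
  simp only [boostGen_mulVec, lorentz_sub_left, lorentz_smul_left, lorentz_comm x]
  ring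

lemma lorentz_boostMatrix (t : ℝ) (x y : Fin (n + 1) → ℝ) :
    lorentz (boostMatrix v u t *ᵥ x) y = lorentz x (boostMatrix v u (-t) *ᵥ y) := by
  simp only [boostMatrix, add_mulVec, smul_mulVec, one_mulVec, ← mulVec_mulVec,
    lorentz_add_left, lorentz_add_right, lorentz_smul_left, lorentz_smul_right,
    lorentz_boostGen, Real.sinh_neg, Real.cosh_neg]
  ring

lemma transpose_mul_lorentzMatrix_mul {M : Matrix (Fin (n + 1)) (Fin (n + 1)) ℝ}
    (hM : ∀ x y, lorentz (M *ᵥ x) (M *ᵥ y) = lorentz x y) :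
    Mᵀ * lorentzMatrix n * M = lorentzMatrix n := by
  ext i j
  have := hM (Pi.single i 1) (Pi.single j 1)
  rw [lorentz_eq_dotProduct, lorentz_eq_dotProduct, mulVec_mulVec, ← vecMul_transpose,
    ← dotProduct_mulVec, mulVec_mulVec, ← Matrix.mul_assoc] at this
  simpa using this

lemma IsHyperbolicPair.boostMatrix_transpose_mul (h : IsHyperbolicPair v u) (t : ℝ) :
    (boostMatrix v u t)ᵀ * lorentzMatrix n * boostMatrix v u t = lorentzMatrix n := by
  refine transpose_mul_lorentzMatrix_mul fun x y => ?_
  rw [lorentz_boostMatrix, mulVec_mulVec, ← h.boostMatrix_add, neg_add_cancel, boostMatrix_zero,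
    one_mulVec]

lemma det_lorentzMatrix_ne_zero : (lorentzMatrix n).det ≠ 0 := by
  intro h
  have := congrArg det (lorentzMatrix_mul_self (n := n))
  rw [det_mul, h] at this
  simp at this

/-- Preserving the form only makes the determinant a square root of one; but a boost is the square
of the boost by half the parameter. -/
lemma IsHyperbolicPair.det_boostMatrix (h : IsHyperbolicPair v u) (t : ℝ) :
    (boostMatrix v u t).det = 1 := by
  have h1 := congrArg det (h.boostMatrix_transpose_mul (t / 2))
  rw [det_mul, det_mul, det_transpose, mul_right_comm, mul_comm] at h1
  have h2 := mul_left_cancel₀ det_lorentzMatrix_ne_zero (h1.trans (mul_one _).symm)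
  rw [← det_mul, ← h.boostMatrix_add, add_halves] at h2
  exact h2

/-- The boost by `t` in the plane spanned by a hyperbolic pair. -/
def IsHyperbolicPair.boost (h : IsHyperbolicPair v u) (t : ℝ) : SO1 n :=
  SO1.mk (boostMatrix v u t) (h.det_boostMatrix t) (h.boostMatrix_transpose_mul t)

lemma IsHyperbolicPair.boost_coe (h : IsHyperbolicPair v u) (t : ℝ) :
    (h.boost t).1.1 = boostMatrix v u t := rfl

lemma IsHyperbolicPair.boost_add (h : IsHyperbolicPair v u) (s t : ℝ) :
    h.boost (s + t) = h.boost s * h.boost t := SO1_ext (h.boostMatrix_add s t)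

lemma IsHyperbolicPair.boost_zero (h : IsHyperbolicPair v u) : h.boost 0 = 1 :=
  SO1_ext boostMatrix_zero

lemma IsHyperbolicPair.boost_pow (h : IsHyperbolicPair v u) (t : ℝ) (k : ℕ) :
    h.boost t ^ k = h.boost (k * t) := by
  induction k with
  | zero => simp [h.boost_zero]
  | succ k ih => rw [pow_succ, ih, ← h.boost_add]; push_cast; ring_nf

lemma IsHyperbolicPair.boostMatrix_mulVec_left (h : IsHyperbolicPair v u) (t : ℝ) :
    boostMatrix v u t *ᵥ v = Real.cosh t • v + Real.sinh t • u := by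
  have h3 : lorentz u v = 0 := by rw [lorentz_comm, h.orth]
  simp only [boostMatrix, add_mulVec, smul_mulVec, one_mulVec, ← mulVec_mulVec, boostGen_mulVec,
    lorentz_sub_right, lorentz_smul_right, h.left, h.right, h.orth, h3]
  module

end Boost

/-! ### Lattices in locally compact groups -/

section Lattice

variable {G : Type*} [Group G] [TopologicalSpace G] [IsTopologicalGroup G]
  [LocallyCompactSpace G] [SecondCountableTopology G] [MeasurableSpace G]
  [BorelSpace G]

open Pointwise

omit [IsTopologicalGroup G] [LocallyCompactSpace G] [MeasurableSpace G] [BorelSpace G] in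
lemma countable_of_discrete_subgroup (Γ : Subgroup G) [DiscreteTopology Γ] : Countable Γ :=
  TopologicalSpace.separableSpace_iff_countable.mp inferInstance

/-- A right translate of a fundamental domain is a fundamental domain. -/
lemma isFundamentalDomain_mul_right {Γ : Subgroup G} {μ : Measure G} [μ.IsHaarMeasure]
    {F : Set G} (hF : IsFundamentalDomain Γ F μ) (g : G) :
    IsFundamentalDomain Γ ((fun x => x * g) ⁻¹' F) μ :=
  hF.preimage_of_equiv (quasiMeasurePreserving_mul_right μ g) (e := id) Function.bijective_id
    fun γ x => by simp [Subgroup.smul_def, mul_assoc]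

/-- Haar measure of a group with a lattice is right invariant. -/
lemma isMulRightInvariant_of_isFundamentalDomain {Γ : Subgroup G} [DiscreteTopology Γ]
    {μ : Measure G} [μ.IsHaarMeasure] {F : Set G} (hF : IsFundamentalDomain Γ F μ)
    (hfin : μ F < ⊤) : μ.IsMulRightInvariant := by
  have := countable_of_discrete_subgroup Γ
  refine ⟨fun g => ?_⟩
  -- The right translate of `μ` is again left invariant, hence a multiple of `μ`; a fundamental
  -- domain of finite nonzero measure shows that the factor is one.
  have hcoe := Measure.isMulLeftInvariant_eq_smul (μ.map (· * g)) μ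
  set c := Measure.haarScalarFactor (μ.map (· * g)) μ
  have hmeas : μ ((fun x => x * g) ⁻¹' F) = μ F :=
    (isFundamentalDomain_mul_right hF g).measure_eq hF
  have hnull : NullMeasurableSet F (μ.map (· * g)) :=
    hF.nullMeasurableSet.mono_ac (quasiMeasurePreserving_mul_right μ g).absolutelyContinuous
  have h1 : (μ.map (· * g)) F = μ F := by
    rw [Measure.map_apply₀ (measurable_mul_const g).aemeasurable hnull, hmeas]
  have h0 : μ F ≠ 0 := hF.measure_ne_zero (NeZero.ne μ)
  rw [hcoe, Measure.smul_apply] at h1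
  have h2 : (c : ENNReal) * μ F = 1 * μ F := by rw [one_mul]; exact h1
  have h3 : (c : ENNReal) = 1 := (ENNReal.mul_left_inj h0 hfin.ne).mp h2
  have h4 : c = 1 := by exact_mod_cast h3
  rw [hcoe, h4, one_smul]

/-- Recurrence for the right action of a cyclic group on the quotient by a lattice. -/
lemma IsLattice.exists_mul_pow_mul {Γ : Subgroup G} (hΓ : IsLattice Γ) {U : Set G}
    (hU : U ∈ 𝓝 (1 : G)) (a : G) (N : ℕ) :
    ∃ γ ∈ Γ, ∃ u ∈ U, ∃ u' ∈ U, ∃ m ≥ N, γ = u * a ^ m * u'⁻¹ := by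
  obtain ⟨_, μ, _, F, hF, hfin⟩ := hΓ
  have := countable_of_discrete_subgroup Γ
  have := isMulRightInvariant_of_isFundamentalDomain hF hfin
  obtain ⟨O, hOU, hO, h1O⟩ := mem_nhds_iff.mp hU
  set A : Set G := ⋃ γ : Γ, γ • O with hA
  have hAopen : IsOpen A := isOpen_iUnion fun γ => hO.smul γ
  have hAinv : ∀ γ : Γ, γ • A = A := by
    intro γ
    rw [hA, Set.smul_set_iUnion]
    simp only [smul_smul]
    exact (Equiv.mulLeft γ).surjective.iUnion_comp (fun δ : Γ => δ • O)
  have hpos : μ (A ∩ F) ≠ 0 := by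
    intro h0
    have h2 := hF.measure_zero_of_invariant A hAinv h0
    have h3 : O ⊆ A := by
      intro x hx
      exact Set.mem_iUnion.mpr ⟨1, by simpa using hx⟩
    exact (hO.measure_pos μ ⟨1, h1O⟩).ne' (measure_mono_null h3 h2)
  -- Exponents spaced by `N + 1`, so that any two distinct ones differ by at least `N`.
  set b : ℕ → G := fun j => a ^ (j * (N + 1)) with hb
  set B : ℕ → Set G := fun j => (fun x => x * (b j)⁻¹) ⁻¹' A with hB
  have hBopen : ∀ j, IsOpen (B j) := fun j => hAopen.preimage (continuous_mul_const _)
  have hBm : ∀ j, μ (B j ∩ F) = μ (A ∩ F) := by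
    intro j
    have e : B j ∩ F = (fun x => x * (b j)⁻¹) ⁻¹' (A ∩ (fun x => x * b j) ⁻¹' F) := by
      ext x
      simp [hB]
    have e2 : μ ((fun x => x * (b j)⁻¹) ⁻¹' (A ∩ (fun x => x * b j) ⁻¹' F)) =
        μ (A ∩ (fun x => x * b j) ⁻¹' F) := measure_preimage_mul_right μ _ _
    rw [e, e2]
    refine (isFundamentalDomain_mul_right hF _).measure_set_eq hF hAopen.measurableSet ?_
    intro γ
    rw [Set.preimage_smul, hAinv]
  -- Pigeonhole: the right translates of the `Γ`-invariant set `A` all have the same positive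
  -- measure inside `F`, which has finite measure, so two of them meet.
  obtain ⟨i, j, hij, x, hxi, hxj⟩ := exists_nonempty_inter_of_measure_univ_lt_tsum_measure
    (μ.restrict F) (s := B) (fun j => (hBopen j).measurableSet.nullMeasurableSet) (by
      simp only [Measure.restrict_apply (hBopen _).measurableSet, hBm,
        Measure.restrict_apply MeasurableSet.univ, Set.univ_inter]
      rw [ENNReal.tsum_const_eq_top_of_ne_zero hpos]
      exact hfin)
  have key : ∀ i j : ℕ, i < j → ∀ x, x ∈ B i → x ∈ B j →
      ∃ γ ∈ Γ, ∃ u ∈ U, ∃ u' ∈ U, ∃ m ≥ N, γ = u * a ^ m * u'⁻¹ := by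
    intro i j hij x hxi hxj
    obtain ⟨γ₁, u₁, hu₁, h₁⟩ := Set.mem_iUnion.mp hxi
    obtain ⟨γ₂, u₂, hu₂, h₂⟩ := Set.mem_iUnion.mp hxj
    simp only [Subgroup.smul_def, smul_eq_mul] at h₁ h₂
    obtain ⟨k, rfl⟩ := Nat.exists_eq_add_of_lt hij
    refine ⟨(γ₂⁻¹ * γ₁ : Γ), SetLike.coe_mem _, u₂, hOU hu₂, u₁, hOU hu₁, (k + 1) * (N + 1), ?_, ?_⟩
    · nlinarith
    · have hbb : b (i + k + 1) = a ^ ((k + 1) * (N + 1)) * b i := by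
        simp only [hb, ← pow_add]
        congr 1
        ring
      rw [hbb] at h₂
      have e1 : (γ₁ : G) = x * (b i)⁻¹ * u₁⁻¹ := by rw [← h₁]; group
      have e2 : (γ₂ : G) = x * (b i)⁻¹ * (a ^ ((k + 1) * (N + 1)))⁻¹ * u₂⁻¹ := by
        rw [eq_mul_inv_iff_mul_eq, h₂]
        group
      rw [Subgroup.coe_mul, Subgroup.coe_inv, e1, e2]
      group
  rcases lt_or_gt_of_ne hij with h | h
  · exact key i j h x hxi hxj
  · exact key j i h x hxj hxi

-- Continuity of `(x, y) ↦ x * y⁻¹` at a diagonal point, with a neighbourhood of `1` that contains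
-- no other element of `Γ`. Such sets are the pieces from which a fundamental domain is assembled.
omit [LocallyCompactSpace G] [SecondCountableTopology G] [MeasurableSpace G] [BorelSpace G] in
lemma exists_isOpen_smul_disjoint (Γ : Subgroup G) [DiscreteTopology Γ] (x : G) :
    ∃ W : Set G, IsOpen W ∧ x ∈ W ∧ ∀ γ ∈ Γ, ∀ w ∈ W, γ * w ∈ W → γ = 1 := by
  obtain ⟨O, hO, hO1⟩ : ∃ O : Set G, IsOpen O ∧ ((↑) : Γ → G) ⁻¹' O = {1} :=
    isOpen_induced_iff.mp (isOpen_discrete ({1} : Set Γ))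
  have h1 : (1 : G) ∈ O := by
    have : (1 : Γ) ∈ ((↑) : Γ → G) ⁻¹' O := by rw [hO1]; rfl
    exact this
  have hc : ContinuousAt (fun p : G × G => p.1 * p.2⁻¹) (x, x) := by fun_prop
  have hn := hc.preimage_mem_nhds (t := O) (hO.mem_nhds (by simpa using h1))
  rw [nhds_prod_eq, Filter.mem_prod_same_iff] at hn
  obtain ⟨V, hV, hVO⟩ := hn
  obtain ⟨W, hWV, hW, hxW⟩ := mem_nhds_iff.mp hV
  refine ⟨W, hW, hxW, fun γ hγ w hw hγw => ?_⟩
  have : γ ∈ O := by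
    simpa using hVO (Set.mk_mem_prod (hWV hγw) (hWV hw))
  have h2 : (⟨γ, hγ⟩ : Γ) ∈ ((↑) : Γ → G) ⁻¹' O := this
  rw [hO1] at h2
  exact congrArg Subtype.val h2

/-- A discrete subgroup `Γ` with `G = K Γ` for a compact set `K` is a uniform lattice. -/
lemma isUniformLattice_of_isCompact [T2Space G] {Γ : Subgroup G} (hd : DiscreteTopology Γ)
    {K : Set G} (hK : IsCompact K) (hcov : ∀ g : G, ∃ k ∈ K, ∃ γ ∈ Γ, g = k * γ) :
    IsUniformLattice Γ := by
  refine ⟨⟨hd, Measure.haar, inferInstance, ?_⟩, ?_⟩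
  · have := countable_of_discrete_subgroup Γ
    have hloc : ∀ x : G, ∃ W : Set G, IsOpen W ∧ x ∈ W ∧ Measure.haar W < ⊤ ∧
        ∀ γ ∈ Γ, ∀ w ∈ W, γ * w ∈ W → γ = 1 := by
      intro x
      obtain ⟨W, hW, hxW, hWΓ⟩ := exists_isOpen_smul_disjoint Γ x
      obtain ⟨V, hxV, hV, hVfin⟩ := (Measure.haar : Measure G).exists_isOpen_measure_lt_top x
      exact ⟨W ∩ V, hW.inter hV, ⟨hxW, hxV⟩,
        (measure_mono Set.inter_subset_right).trans_lt hVfin,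
        fun γ hγ w hw hw' => hWΓ γ hγ w hw.1 hw'.1⟩
    choose W hWo hxW hWfin hWΓ using hloc
    -- Fundamental domains are for left multiplication, while the hypothesis is `G = K Γ`; inversion
    -- turns it into `G = Γ K⁻¹`.
    obtain ⟨t, -, ht⟩ := hK.inv.elim_nhds_subcover W fun x _ => (hWo x).mem_nhds (hxW x)
    have main : ∀ s : Finset G, ∃ F : Set G, MeasurableSet F ∧ Measure.haar F < ⊤ ∧
        (∀ x ∈ s, ∀ w ∈ W x, ∃ γ ∈ Γ, γ * w ∈ F) ∧ ∀ γ ∈ Γ, ∀ w ∈ F, γ * w ∈ F → γ = 1 := by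
      classical
      intro s
      induction s using Finset.induction_on with
      | empty => exact ⟨∅, MeasurableSet.empty, by simp, by simp, by simp⟩
      | insert x s hxs ih =>
        obtain ⟨F, hFm, hFf, hFc, hFi⟩ := ih
        set A : Set G := ⋃ γ : Γ, γ • F with hA
        have hAm : MeasurableSet A := MeasurableSet.iUnion fun γ => hFm.const_smul γ
        have hmemA : ∀ w, w ∈ A ↔ ∃ γ ∈ Γ, γ * w ∈ F := by
          intro w
          simp only [hA, Set.mem_iUnion, Set.mem_smul_set_iff_inv_smul_mem]
          constructor
          · rintro ⟨γ, h⟩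
            exact ⟨_, (γ⁻¹).2, h⟩
          · rintro ⟨γ, hγ, h⟩
            exact ⟨⟨γ, hγ⟩⁻¹, by simpa [Subgroup.smul_def] using h⟩
        -- From the new piece only the points whose orbit misses `F` are added, which keeps orbits
        -- from meeting the union twice.
        refine ⟨F ∪ (W x \ A), hFm.union ((hWo x).measurableSet.diff hAm), ?_, ?_, ?_⟩
        · refine (measure_union_le _ _).trans_lt (ENNReal.add_lt_top.mpr ⟨hFf, ?_⟩)
          exact (measure_mono Set.sdiff_subset).trans_lt (hWfin x)
        · intro y hy w hw
          rcases Finset.mem_insert.mp hy with rfl | hy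
          · by_cases hwA : w ∈ A
            · obtain ⟨γ, hγ, h⟩ := (hmemA w).mp hwA
              exact ⟨γ, hγ, Or.inl h⟩
            · exact ⟨1, Γ.one_mem, Or.inr (by simpa using ⟨hw, hwA⟩)⟩
          · obtain ⟨γ, hγ, h⟩ := hFc y hy w hw
            exact ⟨γ, hγ, Or.inl h⟩
        · rintro γ hγ w (hw | hw) (hγw | hγw)
          · exact hFi γ hγ w hw hγw
          · exact absurd ((hmemA _).mpr ⟨γ⁻¹, Γ.inv_mem hγ, by simpa using hw⟩) hγw.2
          · exact absurd ((hmemA _).mpr ⟨γ, hγ, hγw⟩) hw.2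
          · exact hWΓ x γ hγ w hw.1 hγw.1
    obtain ⟨F, hFm, hFf, hFc, hFi⟩ := main t
    refine ⟨F, IsFundamentalDomain.mk' hFm.nullMeasurableSet fun g => ?_, hFf⟩
    obtain ⟨k, hk, γ, hγ, hg⟩ := hcov g⁻¹
    have hg' : g = γ⁻¹ * k⁻¹ := by rw [← _root_.mul_inv_rev, ← hg, inv_inv]
    obtain ⟨x, hx, hkx⟩ := Set.mem_iUnion₂.mp (ht (Set.inv_mem_inv.mpr hk))
    obtain ⟨δ, hδ, hδF⟩ := hFc x hx _ hkx
    refine ⟨⟨δ * γ, Γ.mul_mem hδ hγ⟩, ?_, ?_⟩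
    · simpa [Subgroup.smul_def, hg'] using hδF
    · rintro ⟨ε, hε⟩ h
      have h1 : ε * g ∈ F := h
      have h2 : δ * γ * g ∈ F := by simpa [hg'] using hδF
      have h3 := hFi (ε * (δ * γ)⁻¹) (Γ.mul_mem hε (Γ.inv_mem (Γ.mul_mem hδ hγ))) (δ * γ * g) h2
        (by simpa [mul_assoc] using h1)
      exact Subtype.ext (mul_inv_eq_one.mp h3)
  · refine ⟨?_⟩
    have : (Set.univ : Set (G ⧸ Γ)) = QuotientGroup.mk '' K := by
      refine Eq.symm (Set.eq_univ_of_forall fun q => ?_)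
      obtain ⟨g, rfl⟩ := QuotientGroup.mk_surjective q
      obtain ⟨k, hk, γ, hγ, rfl⟩ := hcov g
      exact ⟨k, hk, QuotientGroup.eq.mpr (by simpa using hγ)⟩
    rw [this]
    exact hK.image continuous_quotient_mk'

omit [SecondCountableTopology G] in
/-- For a uniform lattice there is a compact set `K` with `G = K Γ`. -/
lemma IsUniformLattice.exists_isCompact {Γ : Subgroup G} (hΓ : IsUniformLattice Γ) :
    ∃ K : Set G, IsCompact K ∧ ∀ g : G, ∃ k ∈ K, ∃ γ ∈ Γ, g = k * γ := by
  have := hΓ.2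
  have hloc : ∀ x : G, ∃ C : Set G, IsCompact C ∧ C ∈ 𝓝 x := fun x => exists_compact_mem_nhds x
  choose C hC hCx using hloc
  have hcover : ∀ q ∈ (Set.univ : Set (G ⧸ Γ)), QuotientGroup.mk '' (C q.out) ∈ 𝓝 q := by
    intro q _
    have := (QuotientGroup.isOpenMap_coe (N := Γ)).image_mem_nhds (hCx q.out)
    simpa using this
  obtain ⟨t, -, ht⟩ := isCompact_univ.elim_nhds_subcover
    (fun q : G ⧸ Γ => QuotientGroup.mk '' (C q.out)) hcover
  refine ⟨⋃ q ∈ t, C q.out, t.isCompact_biUnion fun q _ => hC _, fun g => ?_⟩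
  obtain ⟨q, hq, k, hk, hkg⟩ := Set.mem_iUnion₂.mp (ht (Set.mem_univ (g : G ⧸ Γ)))
  refine ⟨k, Set.mem_iUnion₂.mpr ⟨q, hq, hk⟩, k⁻¹ * g, QuotientGroup.eq.mp hkg, by group⟩

omit [LocallyCompactSpace G] [SecondCountableTopology G] [MeasurableSpace G] [BorelSpace G] in
/-- A discrete subgroup meets a compact set in a finite set. -/
lemma finite_inter_of_isCompact [T2Space G] (Γ : Subgroup G) [DiscreteTopology Γ] {K : Set G}
    (hK : IsCompact K) : {γ : Γ | (γ : G) ∈ K}.Finite := by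
  have hcl : IsClosed (Γ : Set G) := Subgroup.isClosed_of_discrete
  exact (hcl.isClosedEmbedding_subtypeVal.isCompact_preimage hK).finite_of_discrete

end Lattice

/-! ### Orbits of lattices accumulate at every lightlike direction -/

section Accumulation

variable {n : ℕ} {v u : Fin (n + 1) → ℝ}

/-- The linear functional `lorentz v`. -/
def lorentzLin (v : Fin (n + 1) → ℝ) : (Fin (n + 1) → ℝ) →ₗ[ℝ] ℝ where
  toFun := lorentz v
  map_add' := lorentz_add_right v
  map_smul' c w := by simp [lorentz_smul_right]

/-- After rescaling only the expanding eigenvalue survives; for a hyperbolic pair the limit is the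
projection onto the lightlike line of `v + u`. -/
lemma tendsto_exp_neg_smul_boostMatrix :
    Tendsto (fun m : ℕ => Real.exp (-m) • boostMatrix v u m) atTop
      (𝓝 ((1 / 2 : ℝ) • (boostGen v u + boostGen v u * boostGen v u))) := by
  have h1 : Tendsto (fun m : ℕ => Real.exp (-(m : ℝ))) atTop (𝓝 0) :=
    Real.tendsto_exp_neg_atTop_nhds_zero.comp tendsto_natCast_atTop_atTop
  have h2 : ∀ m : ℕ, Real.exp (-(m : ℝ)) • boostMatrix v u m =
      Real.exp (-(m : ℝ)) • 1 +
      ((1 - Real.exp (-(m : ℝ)) * Real.exp (-(m : ℝ))) / 2) • boostGen v u +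
      ((1 + Real.exp (-(m : ℝ)) * Real.exp (-(m : ℝ))) / 2 - Real.exp (-(m : ℝ))) •
        (boostGen v u * boostGen v u) := by
    intro m
    have h3 : Real.exp (-(m : ℝ)) * Real.exp m = 1 := by rw [← Real.exp_add]; simp
    rw [boostMatrix, Real.sinh_eq, Real.cosh_eq, smul_add, smul_add, smul_smul, smul_smul]
    congr 3
    · linear_combination (1 / 2) * h3
    · linear_combination (1 / 2) * h3
  simp only [h2]
  have h4 := (h1.smul_const (1 : Matrix (Fin (n + 1)) (Fin (n + 1)) ℝ)).add
    ((((h1.mul h1).const_sub 1).div_const 2).smul_const (boostGen v u))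
  have h5 := h4.add (((((h1.mul h1).const_add 1).div_const 2).sub h1).smul_const
    (boostGen v u * boostGen v u))
  convert h5 using 2
  simp [smul_add]

/-- If `η` is orthogonal to the hyperbolic pair `(v, u)`, then the orbit of `v` under a lattice
contains points for which `lorentz η` is small compared to `lorentz v`. -/
lemma IsLattice.exists_lorentz_small {Γ : Subgroup (SO1 n)} (hΓ : IsLattice Γ)
    (h : IsHyperbolicPair v u) {η : Fin (n + 1) → ℝ} (hηv : lorentz η v = 0)
    (hηu : lorentz η u = 0) {δ : ℝ} (hδ : 0 < δ) :
    ∃ γ ∈ Γ, 1 < lorentz v (γ.1.1 *ᵥ v) ∧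
      |lorentz η (γ.1.1 *ᵥ v)| ≤ δ * lorentz v (γ.1.1 *ᵥ v) := by
  -- The rescaled image of `v` under `g * boost m * g'⁻¹`. For `g`, `g'` near `1` and large `m` it
  -- tends to `(v + u) / 2`, which pairs to `1 / 2` with `v` and to `0` with `η`.
  let Φ : (SO1 n × SO1 n) × ℕ → Fin (n + 1) → ℝ := fun p =>
    p.1.1.1.1 *ᵥ ((Real.exp (-p.2) • boostMatrix v u p.2) *ᵥ ((p.1.2)⁻¹.1.1 *ᵥ v))
  have hΦ : Tendsto Φ ((𝓝 1 ×ˢ 𝓝 1) ×ˢ atTop) (𝓝 ((1 / 2 : ℝ) • (v + u))) := by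
    have t1 : Tendsto (fun p : (SO1 n × SO1 n) × ℕ => p.1.1.1.1) ((𝓝 1 ×ˢ 𝓝 1) ×ˢ atTop)
        (𝓝 1) := (continuous_SO1_coe.tendsto' 1 1 SO1_coe_one).comp (tendsto_fst.comp tendsto_fst)
    have t2 : Tendsto (fun p : (SO1 n × SO1 n) × ℕ => (p.1.2)⁻¹.1.1) ((𝓝 1 ×ˢ 𝓝 1) ×ˢ atTop)
        (𝓝 1) := ((continuous_SO1_coe.comp continuous_inv).tendsto' (1 : SO1 n) 1
          (by simp)).comp (tendsto_snd.comp tendsto_fst)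
    have t3 := (tendsto_exp_neg_smul_boostMatrix (v := v) (u := u)).comp
      (tendsto_snd (f := 𝓝 (1 : SO1 n) ×ˢ 𝓝 (1 : SO1 n)) (g := (atTop : Filter ℕ)))
    have hc : Continuous fun q : (Matrix (Fin (n + 1)) (Fin (n + 1)) ℝ ×
        Matrix (Fin (n + 1)) (Fin (n + 1)) ℝ) × Matrix (Fin (n + 1)) (Fin (n + 1)) ℝ =>
        q.1.1 *ᵥ (q.2 *ᵥ (q.1.2 *ᵥ v)) := by fun_prop
    have h3 : lorentz u v = 0 := by rw [lorentz_comm, h.orth]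
    have := (hc.tendsto ((1, 1), (1 / 2 : ℝ) • (boostGen v u + boostGen v u * boostGen v u))).comp
      ((t1.prodMk_nhds t2).prodMk_nhds t3)
    have e : (1 : Matrix (Fin (n + 1)) (Fin (n + 1)) ℝ) *ᵥ (((1 / 2 : ℝ) •
        (boostGen v u + boostGen v u * boostGen v u)) *ᵥ
        ((1 : Matrix (Fin (n + 1)) (Fin (n + 1)) ℝ) *ᵥ v)) = (1 / 2 : ℝ) • (v + u) := by
      simp only [one_mulVec, smul_mulVec, add_mulVec, ← mulVec_mulVec, boostGen_mulVec,
        lorentz_sub_right, lorentz_smul_right, h.left, h.right, h.orth, h3]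
      module
    rw [← e]
    exact this
  have hv : Tendsto (fun p => lorentz v (Φ p)) ((𝓝 1 ×ˢ 𝓝 1) ×ˢ atTop) (𝓝 (1 / 2)) := by
    have e : lorentz v ((1 / 2 : ℝ) • (v + u)) = 1 / 2 := by
      rw [lorentz_smul_right, lorentz_add_right, h.left, h.orth]
      ring
    rw [← e]
    exact ((continuous_lorentz continuous_const continuous_id : Continuous (lorentz v)).tendsto
      _).comp hΦ
  have hη : Tendsto (fun p => lorentz η (Φ p)) ((𝓝 1 ×ˢ 𝓝 1) ×ˢ atTop) (𝓝 0) := by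
    have e : lorentz η ((1 / 2 : ℝ) • (v + u)) = 0 := by
      rw [lorentz_smul_right, lorentz_add_right, hηv, hηu]
      ring
    rw [← e]
    exact ((continuous_lorentz continuous_const continuous_id : Continuous (lorentz η)).tendsto
      _).comp hΦ
  have hm : ∀ᶠ p : (SO1 n × SO1 n) × ℕ in (𝓝 1 ×ˢ 𝓝 1) ×ˢ atTop, 4 ≤ Real.exp p.2 :=
    ((Real.tendsto_exp_atTop.comp tendsto_natCast_atTop_atTop).comp tendsto_snd).eventually_ge_atTop
      4
  -- A pairing with `v` above `1 / 4`, scaled back by `exp m ≥ 4`, exceeds `1`; a pairing with `η`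
  -- below `δ / 4` is below `δ` times that with `v`.
  have hev := (hv.eventually (lt_mem_nhds (show (1 / 4 : ℝ) < 1 / 2 by norm_num))).and
    ((hη.eventually (Metric.ball_mem_nhds 0 (show 0 < δ / 4 by positivity))).and hm)
  obtain ⟨A, hA, B, hB, hAB⟩ := Filter.mem_prod_iff.mp hev
  obtain ⟨U₁, hU₁, U₂, hU₂, hU⟩ := Filter.mem_prod_iff.mp hA
  obtain ⟨N, hN⟩ := Filter.mem_atTop_sets.mp hB
  obtain ⟨γ, hγ, g, hg, g', hg', m, hm, rfl⟩ :=
    hΓ.exists_mul_pow_mul (Filter.inter_mem hU₁ hU₂) (h.boost 1) N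
  obtain ⟨e1, e2, e3⟩ := hAB (Set.mk_mem_prod (hU (Set.mk_mem_prod hg.1 hg'.2)) (hN m hm))
  have hpos := Real.exp_pos (m : ℝ)
  have key : (g * h.boost 1 ^ m * g'⁻¹).1.1 *ᵥ v = Real.exp m • Φ ((g, g'), m) := by
    have h3 : Real.exp m * Real.exp (-(m : ℝ)) = 1 := by rw [← Real.exp_add]; simp
    rw [h.boost_pow, mul_one, SO1_coe_mul, SO1_coe_mul, h.boost_coe]
    simp only [Φ, ← mulVec_mulVec, smul_mulVec, mulVec_smul, smul_smul, h3, one_smul]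
  simp only [dist_zero_right, Real.norm_eq_abs] at e2
  refine ⟨_, hγ, ?_, ?_⟩
  · rw [key, lorentz_smul_right]
    change 4 ≤ Real.exp (m : ℝ) at e3
    nlinarith
  · rw [key, lorentz_smul_right, lorentz_smul_right, abs_mul, abs_of_pos hpos,
      mul_left_comm]
    exact mul_le_mul_of_nonneg_left (by nlinarith) hpos.le

/-- For unit timelike vectors, the component of `w` orthogonal to `v` is spacelike. -/
lemma one_lt_lorentz_sq {v w : Fin (n + 1) → ℝ} (hv : lorentz v v = 1) (hw : lorentz w w = 1)
    (h1 : w ≠ v) (h2 : w ≠ -v) : 1 < lorentz v w ^ 2 := by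
  have hx : lorentz v (w - lorentz v w • v) = 0 := by
    rw [lorentz_sub_right, lorentz_smul_right, hv]; ring
  have hxx : lorentz (w - lorentz v w • v) (w - lorentz v w • v) = 1 - lorentz v w ^ 2 := by
    rw [lorentz_sub_left, lorentz_smul_left, hx, lorentz_sub_right, lorentz_smul_right, hw,
      lorentz_comm w v]
    ring
  obtain ⟨a, b⟩ := lorentz_self_nonpos_of_orthogonal (by rw [hv]; norm_num) hx
  rcases a.lt_or_eq with ha | ha
  · rw [hxx] at ha; linarith
  · have e := sub_eq_zero.mp (b ha)
    have e2 : lorentz v w ^ 2 = 1 := by rw [hxx] at ha; linarith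
    rcases sq_eq_one_iff.mp e2 with e3 | e3
    · exact absurd (by rw [e, e3, one_smul]) h1
    · exact absurd (by rw [e, e3, neg_one_smul]) h2

/-- Each `w` cuts out a proper subspace of the complement of `v`: by `one_lt_lorentz_sq` it pairs
nontrivially with its own component orthogonal to `v`. Finitely many proper subspaces do not cover.
-/
lemma exists_orthogonal_ne_zero {v : Fin (n + 1) → ℝ} (hv : lorentz v v = 1)
    {W : Set (Fin (n + 1) → ℝ)} (hW : W.Finite)
    (hW1 : ∀ w ∈ W, lorentz w w = 1 ∧ w ≠ v ∧ w ≠ -v) :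
    ∃ η, lorentz v η = 0 ∧ ∀ w ∈ W, lorentz η w ≠ 0 := by
  classical
  let E := LinearMap.ker (lorentzLin v)
  have := hW.to_subtype
  obtain ⟨η, hη⟩ := Module.Dual.exists_forall_ne_zero_of_forall_exists
    (f := fun w : W => (lorentzLin (w : Fin (n + 1) → ℝ)).comp E.subtype) (by
      rintro ⟨w, hw⟩
      obtain ⟨h1, h2, h3⟩ := hW1 w hw
      refine ⟨⟨w - lorentz v w • v, ?_⟩, ?_⟩
      · change lorentz v (w - lorentz v w • v) = 0
        rw [lorentz_sub_right, lorentz_smul_right, hv]; ring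
      · change lorentz w (w - lorentz v w • v) ≠ 0
        rw [lorentz_sub_right, lorentz_smul_right, h1, lorentz_comm w v]
        have := one_lt_lorentz_sq hv h1 h2 h3
        nlinarith)
  refine ⟨η.1, η.2, fun w hw => ?_⟩
  rw [lorentz_comm]
  exact hη ⟨w, hw⟩

/-- Two linear conditions on a space of dimension at least three leave a nonzero solution, which is
spacelike since it is orthogonal to `v`. The argument for infinitely many sides needs `2 ≤ n` only
here. -/
lemma exists_isHyperbolicPair (hn : 2 ≤ n) {v η : Fin (n + 1) → ℝ} (hv : lorentz v v = 1) :
    ∃ u, IsHyperbolicPair v u ∧ lorentz η u = 0 := by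
  have hker : LinearMap.ker ((lorentzLin v).prod (lorentzLin η)) ≠ ⊥ :=
    LinearMap.ker_ne_bot_of_finrank_lt (by simp; omega)
  obtain ⟨x, hx, hx0⟩ := Submodule.exists_mem_ne_zero_of_ne_bot hker
  have hx1 : lorentz v x = 0 := congrArg Prod.fst (LinearMap.mem_ker.mp hx)
  have hx2 : lorentz η x = 0 := congrArg Prod.snd (LinearMap.mem_ker.mp hx)
  obtain ⟨a, b⟩ := lorentz_self_nonpos_of_orthogonal (by rw [hv]; norm_num) hx1
  have hneg : 0 < -lorentz x x := by
    rcases a.lt_or_eq with h | h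
    · linarith
    · exact absurd (b h) hx0
  have hs := Real.sq_sqrt hneg.le
  have hs0 := (Real.sqrt_pos.mpr hneg).ne'
  refine ⟨(Real.sqrt (-lorentz x x))⁻¹ • x, ⟨hv, ?_, ?_⟩, ?_⟩
  · rw [lorentz_smul_left, lorentz_smul_right]
    field_simp
    linarith
  · rw [lorentz_smul_right, hx1, mul_zero]
  · rw [lorentz_smul_right, hx2, mul_zero]

/-- No finite set of conditions `|lorentz η v| ≤ |lorentz η w|` implies all those for `w` in the
orbit of `v` under a lattice. -/
lemma IsLattice.not_forall_abs_lorentz_le (hn : 2 ≤ n) {Γ : Subgroup (SO1 n)} (hΓ : IsLattice Γ)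
    {v : Fin (n + 1) → ℝ} (hv : lorentz v v = 1) {W : Set (Fin (n + 1) → ℝ)} (hW : W.Finite)
    (hW1 : ∀ w ∈ W, lorentz w w = 1 ∧ w ≠ v ∧ w ≠ -v) :
    ¬ ∀ η, (∀ w ∈ W, |lorentz η v| ≤ |lorentz η w|) →
      ∀ γ ∈ Γ, |lorentz η v| ≤ |lorentz η (γ.1.1 *ᵥ v)| := by
  intro H
  obtain ⟨η, hη, hηW⟩ := exists_orthogonal_ne_zero hv hW hW1
  obtain ⟨u, hu, hηu⟩ := exists_isHyperbolicPair (η := η) hn hv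
  have hηv : lorentz η v = 0 := by rw [lorentz_comm, hη]
  have hopen : ∀ᶠ ξ in 𝓝 η, ∀ w ∈ W, |lorentz ξ v| ≤ |lorentz ξ w| := by
    rw [Filter.eventually_all_finite hW]
    intro w hw
    have c1 : Continuous fun ξ => |lorentz ξ v| :=
      (continuous_lorentz continuous_id continuous_const).abs
    have c2 : Continuous fun ξ => |lorentz ξ w| :=
      (continuous_lorentz continuous_id continuous_const).abs
    have := c1.continuousAt.eventually_lt (x₀ := η) c2.continuousAt
      (by rw [hηv, abs_zero]; exact abs_pos.mpr (hηW w hw))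
    exact this.mono fun _ h => h.le
  have hline : ∀ z : Fin (n + 1) → ℝ, ∀ᶠ c : ℝ in 𝓝 0,
      ∀ w ∈ W, |lorentz (η + c • z) v| ≤ |lorentz (η + c • z) w| := by
    intro z
    have : Tendsto (fun c : ℝ => η + c • z) (𝓝 0) (𝓝 η) :=
      Continuous.tendsto' (by fun_prop) _ _ (by simp)
    exact this.eventually hopen
  obtain ⟨δ, hδ, hball⟩ := Metric.eventually_nhds_iff.mp (hline v)
  obtain ⟨γ, hγ, h1, h2⟩ := hΓ.exists_lorentz_small hu hηv hηu (half_pos hδ)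
  set w := γ.1.1 *ᵥ v with hw
  have hww : lorentz w w = 1 := by rw [hw, SO1_lorentz, hv]
  have hpos : 0 < lorentz v w := by linarith
  -- Adding to `η` the multiple of `v` that makes it orthogonal to `w` stays in the region where the
  -- finite system holds. The inequality at `w` then forces this multiple to be zero.
  have hc : lorentz η w = 0 := by
    have hlt : |-(lorentz η w / lorentz v w)| < δ := by
      rw [abs_neg, abs_div, abs_of_pos hpos, div_lt_iff₀ hpos]
      nlinarith
    have := H _ (hball (y := -(lorentz η w / lorentz v w)) (by rwa [dist_zero_right])) γ hγ
    rw [← hw, lorentz_add_left, lorentz_add_left, lorentz_smul_left, lorentz_smul_left, hηv, hv,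
      neg_mul, neg_mul, div_mul_cancel₀ _ hpos.ne', add_neg_cancel, abs_zero, zero_add, mul_one,
      abs_neg, abs_nonpos_iff, div_eq_zero_iff] at this
    exact this.resolve_right hpos.ne'
  set z := v - lorentz v w • w with hz
  obtain ⟨δ', hδ', hball'⟩ := Metric.eventually_nhds_iff.mp (hline z)
  have := H _ (hball' (y := δ' / 2) (by simp [abs_of_pos hδ']; linarith)) γ hγ
  have hzw : lorentz z w = 0 := by
    rw [hz, lorentz_sub_left, lorentz_smul_left, hww]; ring
  have hzv : lorentz z v = 1 - lorentz v w ^ 2 := by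
    rw [hz, lorentz_sub_left, lorentz_smul_left, hv, lorentz_comm w v]; ring
  rw [← hw, lorentz_add_left, lorentz_add_left, lorentz_smul_left, lorentz_smul_left, hηv, hc, hzw,
    hzv, mul_zero, add_zero, abs_zero, zero_add, abs_nonpos_iff, mul_eq_zero] at this
  rcases this with h | h
  · linarith
  · nlinarith

end Accumulation

/-! ### Polyhedra in the projective model -/

section Polyhedron

variable {d : ℕ}

/-- The quadratic form of a matrix. -/
def quad (S : Matrix (Fin d) (Fin d) ℝ) (x : Fin d → ℝ) : ℝ := x ⬝ᵥ (S *ᵥ x)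

lemma quad_add (S T : Matrix (Fin d) (Fin d) ℝ) (x : Fin d → ℝ) :
    quad (S + T) x = quad S x + quad T x := by
  simp [quad, add_mulVec]

lemma quad_sub (S T : Matrix (Fin d) (Fin d) ℝ) (x : Fin d → ℝ) :
    quad (S - T) x = quad S x - quad T x := by
  simp [quad, sub_mulVec]

lemma quad_smul (c : ℝ) (S : Matrix (Fin d) (Fin d) ℝ) (x : Fin d → ℝ) :
    quad (c • S) x = c * quad S x := by
  simp [quad, smul_mulVec]

lemma quad_smul_right (c : ℝ) (S : Matrix (Fin d) (Fin d) ℝ) (x : Fin d → ℝ) :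
    quad S (c • x) = c ^ 2 * quad S x := by
  simp [quad, mulVec_smul]
  ring

lemma quad_neg_right (S : Matrix (Fin d) (Fin d) ℝ) (x : Fin d → ℝ) :
    quad S (-x) = quad S x := by
  simp [quad, mulVec_neg]

lemma continuous_quad : Continuous fun p : Matrix (Fin d) (Fin d) ℝ × (Fin d → ℝ) =>
    quad p.1 p.2 := by
  unfold quad
  fun_prop

lemma continuous_quad_left (x : Fin d → ℝ) :
    Continuous fun S : Matrix (Fin d) (Fin d) ℝ => quad S x := by
  unfold quad
  fun_prop

lemma posDef_iff_quad {S : Matrix (Fin d) (Fin d) ℝ} :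
    S.PosDef ↔ S.IsSymm ∧ ∀ x, x ≠ 0 → 0 < quad S x := by
  rw [posDef_iff_dotProduct_mulVec, IsHermitian, conjTranspose_eq_transpose_of_trivial]
  simp only [star_trivial]
  rfl

lemma _root_.Matrix.PosDef.isSymm' {S : Matrix (Fin d) (Fin d) ℝ} (hS : S.PosDef) : S.IsSymm :=
  (posDef_iff_quad.mp hS).1

lemma _root_.Matrix.PosDef.quad_pos {S : Matrix (Fin d) (Fin d) ℝ} (hS : S.PosDef)
    {x : Fin d → ℝ} (hx : x ≠ 0) : 0 < quad S x :=
  (posDef_iff_quad.mp hS).2 x hx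

lemma isCompact_dotProduct_sphere : IsCompact {x : Fin d → ℝ | x ⬝ᵥ x = 1} := by
  refine IsCompact.of_isClosed_subset
    (isCompact_univ_pi fun _ : Fin d => isCompact_Icc (a := (-1 : ℝ)) (b := 1))
    (isClosed_eq (by fun_prop) continuous_const) ?_
  intro x hx i _
  have h1 : x i * x i ≤ x ⬝ᵥ x :=
    Finset.single_le_sum (f := fun i => x i * x i) (fun i _ => mul_self_nonneg _)
      (Finset.mem_univ i)
  rw [hx] at h1
  exact abs_le.mp (abs_le_one_iff_mul_self_le_one.mpr h1)

lemma dotProduct_self_pos {x : Fin d → ℝ} (hx : x ≠ 0) : 0 < x ⬝ᵥ x := by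
  refine lt_of_le_of_ne (Finset.sum_nonneg fun i _ => mul_self_nonneg _) fun h => hx ?_
  exact dotProduct_self_eq_zero.mp h.symm

/-- On the compact unit sphere half the minimum of `S` remains a lower bound for nearby `T`;
homogeneity does the rest. Uniformity in `T` is what makes the family of inequalities locally
finite. -/
lemma exists_eventually_le_quad [NeZero d] {S : Matrix (Fin d) (Fin d) ℝ} (hS : S.PosDef) :
    ∃ c > 0, ∀ᶠ T in 𝓝 S, ∀ x, c * (x ⬝ᵥ x) ≤ quad T x := by
  have hne : {x : Fin d → ℝ | x ⬝ᵥ x = 1}.Nonempty := ⟨Pi.single 0 1, by simp⟩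
  obtain ⟨y, hy, hmin⟩ := isCompact_dotProduct_sphere.exists_isMinOn hne
    (continuous_quad.comp (Continuous.prodMk_right S)).continuousOn
  have hy0 : y ≠ 0 := by
    rintro rfl
    simp at hy
  have hpos := hS.quad_pos hy0
  refine ⟨quad S y / 2, half_pos hpos, ?_⟩
  have hev : ∀ᶠ T in 𝓝 S, ∀ x ∈ {x : Fin d → ℝ | x ⬝ᵥ x = 1}, quad S y / 2 < quad T x := by
    refine isCompact_dotProduct_sphere.eventually_forall_of_forall_eventually fun x hx => ?_
    refine continuous_quad.continuousAt.eventually (lt_mem_nhds ?_)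
    exact (half_lt_self hpos).trans_le (hmin hx)
  refine hev.mono fun T hT x => ?_
  by_cases hx : x = 0
  · simp [hx, quad]
  · have hp := dotProduct_self_pos hx
    have hs := Real.sq_sqrt hp.le
    have hs0 := Real.sqrt_pos.mpr hp
    have h1 : ((Real.sqrt (x ⬝ᵥ x))⁻¹ • x) ⬝ᵥ ((Real.sqrt (x ⬝ᵥ x))⁻¹ • x) = 1 := by
      rw [smul_dotProduct, dotProduct_smul, smul_smul, smul_eq_mul, ← _root_.mul_inv_rev, ← sq, hs,
        inv_mul_cancel₀ hp.ne']
    have h2 := hT _ h1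
    rw [quad_smul_right, inv_pow, hs, inv_mul_eq_div, lt_div_iff₀ hp] at h2
    exact h2.le

lemma eventually_posDef [NeZero d] {S : Matrix (Fin d) (Fin d) ℝ} (hS : S.PosDef) :
    ∀ᶠ T in 𝓝 S, T.IsSymm → T.PosDef := by
  obtain ⟨c, hc, h⟩ := exists_eventually_le_quad hS
  refine h.mono fun T hT hs => posDef_iff_quad.mpr ⟨hs, fun x hx => ?_⟩
  exact (mul_pos hc (dotProduct_self_pos hx)).trans_le (hT x)

/-- The type of positive definite matrices. -/
abbrev PDMatrix (d : ℕ) : Type := {Q : Matrix (Fin d) (Fin d) ℝ // Q.PosDef}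

lemma posDef_ne_zero [NeZero d] {Q : Matrix (Fin d) (Fin d) ℝ} (hQ : Q.PosDef) : Q ≠ 0 := by
  rintro rfl
  have := hQ.quad_pos (x := Pi.single 0 1) (by simp)
  simp [quad] at this

variable [NeZero d]

/-- The nonzero symmetric tensor of a positive definite matrix. -/
def PDMatrix.toSym (Q : PDMatrix d) : {A : symTensors d // A ≠ 0} :=
  ⟨⟨Q.1, Q.2.isSymm'⟩, fun h => posDef_ne_zero Q.2 (congrArg Subtype.val h)⟩

/-- The class of a positive definite matrix. -/
def PDMatrix.cls (Q : PDMatrix d) : projModel d :=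
  ⟨Projectivization.mk' ℝ Q.toSym, Q.1, Q.2, Q.2.isSymm', Q.toSym.2, rfl⟩

lemma PDMatrix.represents (Q : PDMatrix d) : Represents Q.1 Q.cls.1 :=
  ⟨Q.2.isSymm', Q.toSym.2, rfl⟩

lemma Represents.eq_cls {Q : Matrix (Fin d) (Fin d) ℝ} {x : ProjSym d} (h : Represents Q x)
    (hQ : Q.PosDef) : (PDMatrix.cls ⟨Q, hQ⟩).1 = x := by
  obtain ⟨_, _, h⟩ := h
  exact h

omit [NeZero d] in
lemma Represents.exists_smul {Q Q' : Matrix (Fin d) (Fin d) ℝ} {x : ProjSym d}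
    (h : Represents Q x) (h' : Represents Q' x) : ∃ c : ℝ, c ≠ 0 ∧ Q' = c • Q := by
  obtain ⟨hs, h0, rfl⟩ := h
  obtain ⟨hs', h0', h⟩ := h'
  obtain ⟨c, hc⟩ := (Projectivization.mk_eq_mk_iff ℝ _ _ h0' h0).mp h
  exact ⟨c, c.ne_zero, (congrArg Subtype.val hc).symm⟩

omit [NeZero d] in
lemma Represents.smul {Q : Matrix (Fin d) (Fin d) ℝ} {x : ProjSym d}
    (h : Represents Q x) {c : ℝ} (hc : c ≠ 0) : Represents (c • Q) x := by
  obtain ⟨hs, h0, rfl⟩ := h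
  have e : (⟨c • Q, (symTensors d).smul_mem c hs⟩ : symTensors d) = c • ⟨Q, hs⟩ := rfl
  refine ⟨(symTensors d).smul_mem c hs, ?_, ?_⟩
  · rw [e]
    exact smul_ne_zero hc h0
  · rw [Projectivization.mk_eq_mk_iff']
    exact ⟨c, rfl⟩

/-- Two positive definite representatives of a point differ by a positive factor. -/
lemma Represents.exists_pos_smul {Q Q' : Matrix (Fin d) (Fin d) ℝ} {x : ProjSym d}
    (h : Represents Q x) (h' : Represents Q' x) (hQ : Q.PosDef) (hQ' : Q'.PosSemidef) :
    ∃ c : ℝ, 0 < c ∧ Q' = c • Q := by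
  obtain ⟨c, hc, rfl⟩ := h.exists_smul h'
  refine ⟨c, lt_of_le_of_ne ?_ hc.symm, rfl⟩
  have h1 := hQ.quad_pos (x := Pi.single 0 1) (by simp)
  have h2 := hQ'.dotProduct_mulVec_nonneg (Pi.single 0 1)
  have h3 : 0 ≤ quad (c • Q) (Pi.single 0 1) := by simpa [quad] using h2
  rw [quad_smul] at h3
  exact nonneg_of_mul_nonneg_left h3 h1

lemma PDMatrix.continuous_cls : Continuous (PDMatrix.cls (d := d)) := by
  have h1 : Continuous (Projectivization.mk' ℝ : {Q : symTensors d // Q ≠ 0} → ProjSym d) :=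
    continuous_coinduced_rng
  refine Continuous.subtype_mk (h1.comp ?_) _
  exact Continuous.subtype_mk (Continuous.subtype_mk continuous_subtype_val _) _

/-- A scalar that makes one representative positive definite does so for all nearby symmetric
tensors. With continuity, this lets boundaries in the projective model be computed on matrices. -/
lemma PDMatrix.isOpenMap_cls : IsOpenMap (PDMatrix.cls (d := d)) := by
  intro V hV
  obtain ⟨V', hV', rfl⟩ := isOpen_induced_iff.mp hV
  refine isOpen_induced_iff.mpr ⟨{x | ∃ Q : PDMatrix d, Q.1 ∈ V' ∧ Q.cls.1 = x}, ?_, ?_⟩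
  · refine isOpen_coinduced.mpr (isOpen_iff_mem_nhds.mpr ?_)
    rintro ⟨⟨A, hA⟩, hA0⟩ ⟨Q, hQV, hQA⟩
    obtain ⟨c, hc, hQ⟩ := Represents.exists_smul (x := Q.cls.1) (Q := A) (Q' := Q.1)
      ⟨hA, hA0, hQA.symm⟩ Q.represents
    have hcont : Continuous fun B : {B : symTensors d // B ≠ 0} => c • B.1.1 :=
      (continuous_subtype_val.comp continuous_subtype_val).const_smul c
    have hev := (eventually_posDef Q.2).and (hV'.mem_nhds hQV)
    rw [hQ] at hev
    refine (hcont.continuousAt (x := ⟨⟨A, hA⟩, hA0⟩)).eventually hev |>.mono ?_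
    rintro ⟨⟨B, hB⟩, hB0⟩ ⟨h1, h2⟩
    have hpd := h1 ((symTensors d).smul_mem c hB)
    exact ⟨⟨c • B, hpd⟩, h2, (Represents.smul ⟨hB, hB0, rfl⟩ hc).eq_cls hpd⟩
  · ext x
    constructor
    · rintro ⟨Q, hQ, h⟩
      exact ⟨Q, hQ, Subtype.ext h⟩
    · rintro ⟨Q, hQ, rfl⟩
      exact ⟨Q, hQ, rfl⟩

/-! ### Faces and sides of a locally finite polyhedron of quadratic forms -/

variable {ι : Type*} (p₀ : Fin d → ℝ) (p : ι → Fin d → ℝ)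

omit [NeZero d] in
/-- The positive definite forms that take on the family `p` no value smaller than at `p₀`. -/
def minDomain : Set (PDMatrix d) := {Q | ∀ i, quad Q.1 p₀ ≤ quad Q.1 (p i)}

/-- The set of classes of the forms in `minDomain`. -/
def minSet : Set (ProjSym d) := {x | ∃ Q ∈ minDomain p₀ p, (PDMatrix.cls Q).1 = x}

/-- The classes of the forms in `minDomain` with the same value at `p₀` and `p i`. -/
def minFace (i : ι) : Set (ProjSym d) :=
  {x | ∃ Q ∈ minDomain p₀ p, quad Q.1 (p i) = quad Q.1 p₀ ∧ (PDMatrix.cls Q).1 = x}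

omit [NeZero d] in
/-- The indices of the nontrivial inequalities that are equalities at `Q`. -/
def activeSet (Q : PDMatrix d) : Set ι :=
  {i | (p i ≠ p₀ ∧ p i ≠ -p₀) ∧ quad Q.1 (p i) = quad Q.1 p₀}

variable {p₀ p}

lemma smul_of_cls_eq {Q Q' : PDMatrix d} (h : (PDMatrix.cls Q).1 = (PDMatrix.cls Q').1) :
    ∃ c : ℝ, 0 < c ∧ Q'.1 = c • Q.1 :=
  Q.represents.exists_pos_smul (h ▸ Q'.represents) Q.2 Q'.2.posSemidef

lemma mem_minSet_cls {Q : PDMatrix d} : (PDMatrix.cls Q).1 ∈ minSet p₀ p ↔ Q ∈ minDomain p₀ p := by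
  refine ⟨?_, fun h => ⟨Q, h, rfl⟩⟩
  rintro ⟨Q', hQ', h⟩ i
  obtain ⟨c, hc, h2⟩ := smul_of_cls_eq h
  rw [h2, quad_smul, quad_smul]
  exact mul_le_mul_of_nonneg_left (hQ' i) hc.le

lemma mem_minFace_cls {Q : PDMatrix d} {i : ι} : (PDMatrix.cls Q).1 ∈ minFace p₀ p i ↔
    Q ∈ minDomain p₀ p ∧ quad Q.1 (p i) = quad Q.1 p₀ := by
  refine ⟨?_, fun h => ⟨Q, h.1, h.2, rfl⟩⟩
  rintro ⟨Q', hQ', h0, h⟩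
  refine ⟨mem_minSet_cls.mp ⟨Q', hQ', h⟩, ?_⟩
  obtain ⟨c, hc, h2⟩ := smul_of_cls_eq h
  rw [h2, quad_smul, quad_smul, h0]

omit [NeZero d] in
lemma isClosed_minDomain : IsClosed (minDomain p₀ p) := by
  have : minDomain p₀ p = ⋂ i, {Q : PDMatrix d | quad Q.1 p₀ ≤ quad Q.1 (p i)} := by
    ext; simp [minDomain]
  rw [this]
  exact isClosed_iInter fun i => isClosed_le
    ((continuous_quad_left _).comp continuous_subtype_val)
    ((continuous_quad_left _).comp continuous_subtype_val)

lemma finite_setOf_quad_le (hfin : ∀ R : ℝ, {i | p i ⬝ᵥ p i ≤ R}.Finite) (Q : PDMatrix d) (R : ℝ) :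
    {i | quad Q.1 (p i) ≤ R}.Finite := by
  obtain ⟨c, hc, h⟩ := exists_eventually_le_quad Q.2
  refine (hfin (R / c)).subset fun i hi => ?_
  have := h.self_of_nhds (p i)
  rw [Set.mem_ofPred_eq, le_div_iff₀ hc, mul_comm]
  exact this.trans hi

lemma finite_activeSet (hfin : ∀ R : ℝ, {i | p i ⬝ᵥ p i ≤ R}.Finite) (Q : PDMatrix d) :
    (activeSet p₀ p Q).Finite :=
  (finite_setOf_quad_le hfin Q (quad Q.1 p₀)).subset fun _ hi => hi.2.le

/-- Near a form only finitely many inequalities matter, and strict ones persist, so without an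
active one the point is interior. Conversely, subtracting a small multiple of `P`, which satisfies
every nontrivial inequality strictly, violates an active one. The indices with `p i = ±p₀` impose no
condition. -/
lemma mem_frontier_minDomain (hfin : ∀ R : ℝ, {i | p i ⬝ᵥ p i ≤ R}.Finite) {P : PDMatrix d}
    (hP : ∀ i, p i ≠ p₀ → p i ≠ -p₀ → quad P.1 p₀ < quad P.1 (p i)) {Q : PDMatrix d} :
    Q ∈ frontier (minDomain p₀ p) ↔ Q ∈ minDomain p₀ p ∧ (activeSet p₀ p Q).Nonempty := by
  rw [isClosed_minDomain.frontier_eq, Set.mem_sdiff]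
  refine and_congr_right fun hQ => ?_
  constructor
  · intro hint
    by_contra hne
    rw [Set.not_nonempty_iff_eq_empty] at hne
    refine hint (mem_interior_iff_mem_nhds.mpr ?_)
    have hlt : ∀ i, p i ≠ p₀ → p i ≠ -p₀ → quad Q.1 p₀ < quad Q.1 (p i) := by
      intro i h1 h2
      refine lt_of_le_of_ne (hQ i) fun h => ?_
      have : i ∈ activeSet p₀ p Q := ⟨⟨h1, h2⟩, h.symm⟩
      rw [hne] at this
      exact this
    obtain ⟨c, hc, h⟩ := exists_eventually_le_quad Q.2
    have hcont : Tendsto (fun T : PDMatrix d => T.1) (𝓝 Q) (𝓝 Q.1) :=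
      continuous_subtype_val.tendsto Q
    have hfin' := hfin ((quad Q.1 p₀ + 1) / c)
    have e1 : ∀ᶠ T in 𝓝 Q.1, quad T p₀ < quad Q.1 p₀ + 1 :=
      (continuous_quad_left p₀).continuousAt.eventually (gt_mem_nhds (lt_add_one _))
    have e2 : ∀ᶠ T in 𝓝 Q.1, ∀ i ∈ {i | p i ⬝ᵥ p i ≤ (quad Q.1 p₀ + 1) / c},
        quad T p₀ ≤ quad T (p i) := by
      rw [Filter.eventually_all_finite hfin']
      intro i _
      by_cases h1 : p i = p₀
      · exact Eventually.of_forall fun T => by rw [h1]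
      by_cases h2 : p i = -p₀
      · exact Eventually.of_forall fun T => by rw [h2, quad_neg_right]
      exact ((continuous_quad_left p₀).continuousAt.eventually_lt
        (continuous_quad_left (p i)).continuousAt (hlt i h1 h2)).mono fun _ h => h.le
    refine (hcont.eventually (h.and (e1.and e2))).mono fun T hT i => ?_
    obtain ⟨h1, h2, h3⟩ := hT
    by_cases hi : p i ⬝ᵥ p i ≤ (quad Q.1 p₀ + 1) / c
    · exact h3 i hi
    · push Not at hi
      rw [div_lt_iff₀ hc] at hi
      have := h1 (p i)
      linarith
  · rintro ⟨i, ⟨h1, h2⟩, h3⟩ hint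
    obtain ⟨V, hVD, hV, hQV⟩ := mem_interior.mp hint
    obtain ⟨V', hV', rfl⟩ := isOpen_induced_iff.mp hV
    have hcont : Tendsto (fun s : ℝ => Q.1 - s • P.1) (𝓝[>] 0) (𝓝 Q.1) :=
      (Continuous.tendsto' (by fun_prop) _ _ (by simp)).mono_left nhdsWithin_le_nhds
    obtain ⟨s, ⟨hs1, hs2⟩, hs⟩ := ((hcont.eventually ((eventually_posDef Q.2).and
      (hV'.mem_nhds hQV))).and self_mem_nhdsWithin).exists
    have hpd := hs1 (Q.2.isSymm'.sub (P.2.isSymm'.smul s))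
    have := hVD (a := ⟨_, hpd⟩) hs2 i
    simp only [quad_sub, quad_smul, h3] at this
    have hs' : (0 : ℝ) < s := hs
    nlinarith [hP i h1 h2]

lemma mem_modelBoundary_minSet (hfin : ∀ R : ℝ, {i | p i ⬝ᵥ p i ≤ R}.Finite) {P : PDMatrix d}
    (hP : ∀ i, p i ≠ p₀ → p i ≠ -p₀ → quad P.1 p₀ < quad P.1 (p i)) {Q : PDMatrix d} :
    (PDMatrix.cls Q).1 ∈ modelBoundary (minSet p₀ p) ↔
      Q ∈ minDomain p₀ p ∧ (activeSet p₀ p Q).Nonempty := by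
  have h1 : (PDMatrix.cls Q).1 ∈ modelBoundary (minSet p₀ p) ↔
      Q ∈ PDMatrix.cls ⁻¹' frontier ((Subtype.val : projModel d → ProjSym d) ⁻¹' minSet p₀ p) := by
    constructor
    · rintro ⟨x, hx, h⟩
      rwa [Set.mem_preimage, ← Subtype.ext h]
    · intro h
      exact ⟨_, h, rfl⟩
  rw [h1, PDMatrix.isOpenMap_cls.preimage_frontier_eq_frontier_preimage PDMatrix.continuous_cls,
    ← mem_frontier_minDomain hfin hP]
  have h2 : PDMatrix.cls ⁻¹' ((Subtype.val : projModel d → ProjSym d) ⁻¹' minSet p₀ p) =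
      minDomain p₀ p := Set.ext fun Q => mem_minSet_cls
  rw [h2]

/-- A nonempty convex subset of the boundary lies in one face. -/
lemma exists_subset_minFace (hfin : ∀ R : ℝ, {i | p i ⬝ᵥ p i ≤ R}.Finite) {P : PDMatrix d}
    (hP : ∀ i, p i ≠ p₀ → p i ≠ -p₀ → quad P.1 p₀ < quad P.1 (p i)) {T : Set (ProjSym d)}
    (hT0 : T.Nonempty) (hTb : T ⊆ modelBoundary (minSet p₀ p)) (hTc : ProjConvex T) :
    ∃ i, (p i ≠ p₀ ∧ p i ≠ -p₀) ∧ T ⊆ minFace p₀ p i := by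
  have hrep : ∀ x ∈ T, ∃ Q : PDMatrix d, (PDMatrix.cls Q).1 = x := by
    intro x hx
    obtain ⟨Q, hQ, h⟩ := hTc.1 hx
    exact ⟨⟨Q, hQ⟩, h.eq_cls hQ⟩
  let A : Set (PDMatrix d) := {Q | (PDMatrix.cls Q).1 ∈ T}
  have hA0 : A.Nonempty := by
    obtain ⟨x, hx⟩ := hT0
    obtain ⟨Q, rfl⟩ := hrep x hx
    exact ⟨Q, hx⟩
  have hAb : ∀ Q ∈ A, Q ∈ minDomain p₀ p ∧ (activeSet p₀ p Q).Nonempty := fun Q hQ =>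
    (mem_modelBoundary_minSet hfin hP).mp (hTb hQ)
  -- A point with the fewest active inequalities, a stand-in for a relative interior point of `T`.
  -- An inequality is active at a midpoint only if it is active at both ends, so whatever is active
  -- at `Q` must be active on all of `T`.
  obtain ⟨Q, hQA, hQmin⟩ : ∃ Q ∈ A, ∀ Q' ∈ A,
      (activeSet p₀ p Q).ncard ≤ (activeSet p₀ p Q').ncard := by
    obtain ⟨Q, hQ, h⟩ := exists_minimalFor_of_wellFoundedLT (· ∈ A)
      (fun Q => (activeSet p₀ p Q).ncard) hA0
    refine ⟨Q, hQ, fun Q' hQ' => ?_⟩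
    by_contra hlt
    exact hlt (h hQ' (not_le.mp hlt).le)
  obtain ⟨hQD, i, hi⟩ := hAb Q hQA
  refine ⟨i, hi.1, fun x hx => ?_⟩
  obtain ⟨Q', rfl⟩ := hrep x hx
  have hQ'D := (hAb Q' hx).1
  refine mem_minFace_cls.mpr ⟨hQ'D, ?_⟩
  by_contra hne
  have hconv : Convex ℝ {Q : Matrix (Fin d) (Fin d) ℝ | Q.PosDef ∧ ∃ x ∈ T, Represents Q x} :=
    hTc.2
  have hQm : Q.1 ∈ {Q : Matrix (Fin d) (Fin d) ℝ | Q.PosDef ∧ ∃ x ∈ T, Represents Q x} :=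
    ⟨Q.2, _, hQA, Q.represents⟩
  have hQm' : Q'.1 ∈ {Q : Matrix (Fin d) (Fin d) ℝ | Q.PosDef ∧ ∃ x ∈ T, Represents Q x} :=
    ⟨Q'.2, _, hx, Q'.represents⟩
  obtain ⟨hpd, y, hy, hrepr⟩ := hconv hQm hQm' (show (0 : ℝ) ≤ 1 / 2 by norm_num)
    (show (0 : ℝ) ≤ 1 / 2 by norm_num) (by norm_num)
  set R : PDMatrix d := ⟨(1 / 2 : ℝ) • Q.1 + (1 / 2 : ℝ) • Q'.1, hpd⟩ with hR
  have hRA : R ∈ A := by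
    have : (PDMatrix.cls R).1 = y := hrepr.eq_cls hpd
    change (PDMatrix.cls R).1 ∈ T
    rwa [this]
  have hval : ∀ x, quad R.1 x = (quad Q.1 x + quad Q'.1 x) / 2 := by
    intro x
    rw [hR, quad_add, quad_smul, quad_smul]
    ring
  have hsub : activeSet p₀ p R ⊆ activeSet p₀ p Q \ {i} := by
    rintro j ⟨hj, hj2⟩
    rw [hval, hval] at hj2
    have h1 := hQD j
    have h2 := hQ'D j
    refine ⟨⟨hj, by linarith⟩, ?_⟩
    rintro rfl
    exact hne (by linarith)
  have h1 := hQmin R hRA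
  have h2 := Set.ncard_le_ncard hsub ((finite_activeSet hfin Q).subset Set.sdiff_subset)
  have h3 := Set.ncard_sdiff_singleton_lt_of_mem hi (finite_activeSet hfin Q)
  omega

lemma minFace_subset_modelBoundary (hfin : ∀ R : ℝ, {i | p i ⬝ᵥ p i ≤ R}.Finite) {P : PDMatrix d}
    (hP : ∀ i, p i ≠ p₀ → p i ≠ -p₀ → quad P.1 p₀ < quad P.1 (p i)) {i : ι}
    (hi : p i ≠ p₀ ∧ p i ≠ -p₀) : minFace p₀ p i ⊆ modelBoundary (minSet p₀ p) := by
  rintro x ⟨Q, hQ, h, rfl⟩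
  exact (mem_modelBoundary_minSet hfin hP).mpr ⟨hQ, i, hi, h⟩

lemma projConvex_minFace (i : ι) : ProjConvex (minFace p₀ p i) := by
  refine ⟨?_, ?_⟩
  · rintro x ⟨Q, -, -, rfl⟩
    exact (PDMatrix.cls Q).2
  · rintro A ⟨hA, x, hx, hAx⟩ B ⟨hB, y, hy, hBy⟩ a b ha hb hab
    rw [← hAx.eq_cls hA, mem_minFace_cls] at hx
    rw [← hBy.eq_cls hB, mem_minFace_cls] at hy
    have hpd : (a • A + b • B).PosDef := by
      refine posDef_iff_quad.mpr ⟨(hA.isSymm'.smul a).add (hB.isSymm'.smul b), fun z hz => ?_⟩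
      rw [quad_add, quad_smul, quad_smul]
      have h1 := hA.quad_pos hz
      have h2 := hB.quad_pos hz
      rcases ha.eq_or_lt with rfl | ha
      · have : b = 1 := by linarith
        subst this
        simpa using h2
      · positivity
    refine ⟨hpd, _, ?_, PDMatrix.represents ⟨_, hpd⟩⟩
    refine mem_minFace_cls.mpr ⟨fun j => ?_, ?_⟩
    · simp only [quad_add, quad_smul]
      exact add_le_add (mul_le_mul_of_nonneg_left (hx.1 j) ha)
        (mul_le_mul_of_nonneg_left (hy.1 j) hb)
    · have h1 := hx.2
      have h2 := hy.2
      simp only at h1 h2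
      simp only [quad_add, quad_smul, h1, h2]

/-- Every side is a face. -/
lemma exists_eq_minFace_of_mem_sides (hfin : ∀ R : ℝ, {i | p i ⬝ᵥ p i ≤ R}.Finite)
    {P : PDMatrix d} (hP : ∀ i, p i ≠ p₀ → p i ≠ -p₀ → quad P.1 p₀ < quad P.1 (p i))
    {S : Set (ProjSym d)} (hS : S ∈ sides (minSet p₀ p)) :
    ∃ i, (p i ≠ p₀ ∧ p i ≠ -p₀) ∧ S = minFace p₀ p i := by
  obtain ⟨h0, ⟨hb, hc⟩, hmax⟩ := hS
  obtain ⟨i, hi, hsub⟩ := exists_subset_minFace hfin hP h0 hb hc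
  exact ⟨i, hi, hsub.antisymm
    (hmax ⟨minFace_subset_modelBoundary hfin hP hi, projConvex_minFace i⟩ hsub)⟩

/-- Every boundary point lies in a side. -/
lemma exists_mem_sides (hfin : ∀ R : ℝ, {i | p i ⬝ᵥ p i ≤ R}.Finite)
    {P : PDMatrix d} (hP : ∀ i, p i ≠ p₀ → p i ≠ -p₀ → quad P.1 p₀ < quad P.1 (p i))
    {Q : PDMatrix d} (hQ : Q ∈ minDomain p₀ p) (hQ0 : (activeSet p₀ p Q).Nonempty) :
    ∃ i, minFace p₀ p i ∈ sides (minSet p₀ p) ∧ quad Q.1 (p i) = quad Q.1 p₀ := by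
  -- Only finitely many faces pass through `Q`; one that is maximal for inclusion is a side, because
  -- every convex set in the boundary lies in a face.
  obtain ⟨_, ⟨i, hi, rfl⟩, hmax⟩ := ((finite_activeSet hfin Q).image
    (minFace p₀ p)).exists_maximal (hQ0.image _)
  have hQi : (PDMatrix.cls Q).1 ∈ minFace p₀ p i := mem_minFace_cls.mpr ⟨hQ, hi.2⟩
  refine ⟨i, ⟨⟨_, hQi⟩, ⟨minFace_subset_modelBoundary hfin hP hi.1, projConvex_minFace i⟩, ?_⟩,
    hi.2⟩
  rintro T ⟨hTb, hTc⟩ hsub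
  obtain ⟨j, hj, hTj⟩ := exists_subset_minFace hfin hP ⟨_, hsub hQi⟩ hTb hTc
  have hQj := (mem_minFace_cls.mp (hTj (hsub hQi))).2
  exact hTj.trans (hmax ⟨j, ⟨hj, hQj⟩, rfl⟩ (hsub.trans hTj))

/-- If there are finitely many sides, finitely many of the inequalities imply all of them. -/
theorem exists_finite_of_finite_sides (hfin : ∀ R : ℝ, {i | p i ⬝ᵥ p i ≤ R}.Finite)
    {P : PDMatrix d} (hP : ∀ i, p i ≠ p₀ → p i ≠ -p₀ → quad P.1 p₀ < quad P.1 (p i))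
    (hsides : (sides (minSet p₀ p)).Finite) :
    ∃ t : Set ι, t.Finite ∧ (∀ i ∈ t, p i ≠ p₀ ∧ p i ≠ -p₀) ∧
      ∀ Q : PDMatrix d, (∀ i ∈ t, quad Q.1 p₀ ≤ quad Q.1 (p i)) → Q ∈ minDomain p₀ p := by
  have hch : ∀ S : sides (minSet p₀ p), ∃ i, (p i ≠ p₀ ∧ p i ≠ -p₀) ∧ S.1 = minFace p₀ p i :=
    fun S => exists_eq_minFace_of_mem_sides hfin hP S.2
  choose f hf1 hf2 using hch
  have := hsides.to_subtype
  refine ⟨Set.range f, Set.finite_range f, ?_, fun Q hQ => ?_⟩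
  · rintro _ ⟨S, rfl⟩
    exact hf1 S
  by_contra hQD
  have hpd : ∀ r : Set.Icc (0 : ℝ) 1, ((1 - r.1) • P.1 + r.1 • Q.1).PosDef := by
    intro r
    refine posDef_iff_quad.mpr
      ⟨(P.2.isSymm'.smul _).add (Q.2.isSymm'.smul _), fun z hz => ?_⟩
    rw [quad_add, quad_smul, quad_smul]
    have h1 := P.2.quad_pos hz
    have h2 := Q.2.quad_pos hz
    obtain ⟨r, h3, h4⟩ := r
    rcases h3.eq_or_lt with rfl | h3
    · simpa using h1
    · have : 0 ≤ 1 - r := by linarith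
      positivity
  -- The segment from the interior point `P` to `Q` has to cross the boundary, and it does so in a
  -- side, hence on one of the selected walls.
  let path : Set.Icc (0 : ℝ) 1 → PDMatrix d := fun r => ⟨_, hpd r⟩
  have hpath : Continuous path := Continuous.subtype_mk (by fun_prop) _
  have hP0 : P ∈ minDomain p₀ p := by
    intro i
    by_cases h1 : p i = p₀
    · rw [h1]
    by_cases h2 : p i = -p₀
    · rw [h2, quad_neg_right]
    exact (hP i h1 h2).le
  have e0 : path ⟨0, by simp⟩ = P := Subtype.ext (by simp [path])
  have e1 : path ⟨1, by simp⟩ = Q := Subtype.ext (by simp [path])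
  obtain ⟨r, hr⟩ := nonempty_frontier_iff.mpr (⟨⟨⟨0, by simp⟩, by rwa [Set.mem_preimage, e0]⟩,
    fun h => hQD (by rw [← e1]; exact (Set.eq_univ_iff_forall.mp h _ :))⟩ :
    (path ⁻¹' minDomain p₀ p).Nonempty ∧ path ⁻¹' minDomain p₀ p ≠ Set.univ)
  replace hr := hpath.frontier_preimage_subset _ hr
  obtain ⟨hD, hne⟩ := (mem_frontier_minDomain hfin hP).mp hr
  obtain ⟨i, hi, hval⟩ := exists_mem_sides hfin hP hD hne
  have hface := hf2 ⟨_, hi⟩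
  set j := f ⟨_, hi⟩ with hj
  have hmem : (PDMatrix.cls (path r)).1 ∈ minFace p₀ p j := by
    rw [← hface]
    exact mem_minFace_cls.mpr ⟨hD, hval⟩
  have hvj := (mem_minFace_cls.mp hmem).2
  simp only [path, quad_add, quad_smul] at hvj
  have h1 := hP j (hf1 _).1 (hf1 _).2
  have h2 := hQ j ⟨_, rfl⟩
  -- Equality on the wall is a weighted sum of a strict inequality at `P` and a weak one at `Q`, so
  -- the weight of `P` vanishes and `Q` itself lies in the closed domain.
  have hr1 : r.1 = 1 := by
    by_contra hne1
    have hlt : 0 < 1 - r.1 := by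
      have := lt_of_le_of_ne r.2.2 hne1
      linarith
    nlinarith [mul_pos hlt (sub_pos.mpr h1), mul_nonneg r.2.1 (sub_nonneg.mpr h2)]
  have : path r = Q := by rw [← e1]; exact congrArg path (Subtype.ext hr1)
  exact hQD (this ▸ hD)

end Polyhedron

/-! ### Dirichlet–Selberg domains of lattices in `SO(1, n)` -/

section Domain

variable {n : ℕ}

/-- The form `q_ℓ` for the line `ℓ` spanned by a unit timelike vector `v`. -/
def lineForm (v : Fin (n + 1) → ℝ) : Matrix (Fin (n + 1)) (Fin (n + 1)) ℝ :=
  (2 : ℝ) • vecMulVec (lorentzMatrix n *ᵥ v) (lorentzMatrix n *ᵥ v) - lorentzMatrix n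

lemma dotProduct_lineForm_mulVec (v x y : Fin (n + 1) → ℝ) :
    x ⬝ᵥ (lineForm v *ᵥ y) = 2 * lorentz v x * lorentz v y - lorentz x y := by
  have h : (lorentzMatrix n *ᵥ v) ⬝ᵥ y = lorentz v y := by
    rw [dotProduct_comm, ← lorentz_eq_dotProduct, lorentz_comm]
  rw [lineForm, sub_mulVec, dotProduct_sub, ← lorentz_eq_dotProduct, smul_mulVec,
    vecMulVec_mulVec, dotProduct_smul, h, op_smul_eq_smul, dotProduct_smul,
    ← lorentz_eq_dotProduct, lorentz_comm x v]
  simp only [smul_eq_mul]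
  ring

lemma quad_lineForm (v x : Fin (n + 1) → ℝ) :
    quad (lineForm v) x = 2 * lorentz v x ^ 2 - lorentz x x := by
  rw [quad, dotProduct_lineForm_mulVec]; ring

lemma ext_of_dotProduct_mulVec {d : ℕ} {A B : Matrix (Fin d) (Fin d) ℝ}
    (h : ∀ x y, x ⬝ᵥ (A *ᵥ y) = x ⬝ᵥ (B *ᵥ y)) : A = B := by
  ext i j
  simpa using h (Pi.single i 1) (Pi.single j 1)

lemma lineForm_isSymm (v : Fin (n + 1) → ℝ) : (lineForm v).IsSymm := by
  simp [lineForm, IsSymm, transpose_vecMulVec, lorentzMatrix_transpose]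

/-- With `z` the component of `x` orthogonal to `v`, the value at `x` is `lorentz v x ^ 2 - lorentz
z z`, and `z` is spacelike or zero. -/
lemma posDef_lineForm {v : Fin (n + 1) → ℝ} (hv : lorentz v v = 1) : (lineForm v).PosDef := by
  refine posDef_iff_quad.mpr ⟨lineForm_isSymm v, fun x hx => ?_⟩
  have h1 : lorentz v (x - lorentz v x • v) = 0 := by
    rw [lorentz_sub_right, lorentz_smul_right, hv]; ring
  have h2 : lorentz (x - lorentz v x • v) (x - lorentz v x • v) =
      lorentz x x - lorentz v x ^ 2 := by
    rw [lorentz_sub_left, lorentz_smul_left, h1, lorentz_sub_right, lorentz_smul_right,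
      lorentz_comm x v]
    ring
  obtain ⟨a, b⟩ := lorentz_self_nonpos_of_orthogonal (by rw [hv]; norm_num) h1
  rw [quad_lineForm]
  rcases a.lt_or_eq with ha | ha
  · nlinarith [sq_nonneg (lorentz v x)]
  · have e := sub_eq_zero.mp (b ha)
    have hne : lorentz v x ≠ 0 := by
      intro h0
      rw [h0, zero_smul] at e
      exact hx e
    have := pow_pos (abs_pos.mpr hne) 2
    rw [sq_abs] at this
    nlinarith

/-- The line form of a line is given by any unit vector of the line. -/
lemma IsLineForm.eq_lineForm {v : Fin (n + 1) → ℝ} {M : Matrix (Fin (n + 1)) (Fin (n + 1)) ℝ}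
    (h : IsLineForm v M) (hv : 0 < lorentz v v) :
    M = lineForm ((Real.sqrt (lorentz v v))⁻¹ • v) := by
  obtain ⟨hs, h1, h2, h3⟩ := h
  refine ext_of_dotProduct_mulVec fun x y => ?_
  have hsq := Real.sq_sqrt hv.le
  have hs0 := (Real.sqrt_pos.mpr hv).ne'
  have hsymm : ∀ x y, x ⬝ᵥ (M *ᵥ y) = y ⬝ᵥ (M *ᵥ x) := by
    intro x y
    rw [dotProduct_mulVec, ← mulVec_transpose, hs, dotProduct_comm]
  set c := lorentz v v with hc
  have hz : ∀ x, lorentz v (x - (lorentz v x / c) • v) = 0 := by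
    intro x
    rw [lorentz_sub_right, lorentz_smul_right, ← hc, div_mul_cancel₀ _ hv.ne', sub_self]
  have hx : x = (lorentz v x / c) • v + (x - (lorentz v x / c) • v) := by abel
  have hy : y = (lorentz v y / c) • v + (y - (lorentz v y / c) • v) := by abel
  have e1 : x ⬝ᵥ (M *ᵥ y) = lorentz v x / c * (lorentz v y / c) * c -
      lorentz (x - (lorentz v x / c) • v) (y - (lorentz v y / c) • v) := by
    conv_lhs => rw [hx, hy]
    rw [mulVec_add, dotProduct_add, add_dotProduct, add_dotProduct, mulVec_smul, dotProduct_smul,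
      dotProduct_smul, smul_dotProduct, smul_dotProduct, h1, h2 _ (hz y), hsymm _ v, h2 _ (hz x),
      h3 _ _ (hz x) (hz y)]
    simp only [smul_eq_mul]
    ring
  rw [e1, dotProduct_lineForm_mulVec]
  simp only [lorentz_sub_left, lorentz_sub_right, lorentz_smul_left, lorentz_smul_right, ← hc,
    lorentz_comm x v]
  have hsi : (Real.sqrt c)⁻¹ * (Real.sqrt c)⁻¹ = c⁻¹ := by
    rw [← _root_.mul_inv_rev, ← sq, hsq]
  have e2 : 2 * ((Real.sqrt c)⁻¹ * lorentz v x) * ((Real.sqrt c)⁻¹ * lorentz v y) =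
      2 * c⁻¹ * lorentz v x * lorentz v y := by
    rw [← hsi]; ring
  rw [e2]
  field_simp
  ring

lemma transpose_mul_lineForm_mul (γ : SO1 n) (v : Fin (n + 1) → ℝ) :
    γ.1.1ᵀ * lineForm (γ.1.1 *ᵥ v) * γ.1.1 = lineForm v := by
  refine ext_of_dotProduct_mulVec fun x y => ?_
  rw [← mulVec_mulVec, ← mulVec_mulVec, mulVec_transpose, dotProduct_comm x, ← dotProduct_mulVec,
    dotProduct_comm]
  have h := dotProduct_lineForm_mulVec (γ.1.1 *ᵥ v) (γ.1.1 *ᵥ x) (γ.1.1 *ᵥ y)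
  rw [SO1_lorentz, SO1_lorentz, SO1_lorentz, ← dotProduct_lineForm_mulVec] at h
  rw [← h, dotProduct_comm]

/-- Equivariance of the line forms: this replaces the orbit of the base point in the symmetric space
by the orbit of the vector `v`. -/
lemma inv_mul_inv_mul_transpose (γ : SO1 n) {v : Fin (n + 1) → ℝ} (hv : lorentz v v = 1) :
    (γ.1.1 * (lineForm v)⁻¹ * γ.1.1ᵀ)⁻¹ = lineForm (γ.1.1 *ᵥ v) := by
  refine inv_eq_left_inv ?_
  have hu : IsUnit (lineForm v).det := (posDef_lineForm hv).det_pos.ne'.isUnit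
  have hT : (γ⁻¹).1.1ᵀ * γ.1.1ᵀ = 1 := by
    rw [← transpose_mul, SO1_mul_inv, transpose_one]
  calc lineForm (γ.1.1 *ᵥ v) * (γ.1.1 * (lineForm v)⁻¹ * γ.1.1ᵀ)
      = ((γ⁻¹).1.1ᵀ * γ.1.1ᵀ) * lineForm (γ.1.1 *ᵥ v) *
        (γ.1.1 * (lineForm v)⁻¹ * γ.1.1ᵀ) := by rw [hT, one_mul]
    _ = (γ⁻¹).1.1ᵀ * ((γ.1.1ᵀ * lineForm (γ.1.1 *ᵥ v) * γ.1.1) * (lineForm v)⁻¹) * γ.1.1ᵀ := by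
        simp only [Matrix.mul_assoc]
    _ = 1 := by
        rw [transpose_mul_lineForm_mul, mul_nonsing_inv _ hu, mul_one, hT]

/-- A sum of rank one terms turns the trace into a sum of values of `S`. Needed to compare
logarithms in `selbergDiff`. -/
lemma trace_mul_pos {d : ℕ} {A S : Matrix (Fin d) (Fin d) ℝ} (hA : A.PosSemidef) (hA0 : A ≠ 0)
    (hS : S.PosDef) : 0 < (A * S).trace := by
  obtain ⟨m, a, rfl⟩ := posSemidef_iff_eq_sum_vecMulVec.mp hA
  have e : ((∑ i, vecMulVec (a i) (star (a i))) * S).trace = ∑ i, quad S (a i) := by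
    rw [Matrix.sum_mul, trace_sum]
    refine Finset.sum_congr rfl fun i _ => ?_
    rw [vecMulVec_mul, trace_vecMulVec, star_trivial, quad, dotProduct_mulVec, dotProduct_comm]
  rw [e]
  have hnn : ∀ i, 0 ≤ quad S (a i) := by
    intro i
    by_cases h : a i = 0
    · simp [h, quad]
    · exact (hS.quad_pos h).le
  refine Finset.sum_pos' (fun i _ => hnn i) ?_
  by_contra h
  push Not at h
  refine hA0 (Finset.sum_eq_zero fun i hi => ?_)
  have : a i = 0 := by
    by_contra h0
    exact absurd (hS.quad_pos h0) (not_lt.mpr (h i hi))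
  rw [this]
  simp

/-- The last term does not involve `v`, so it drops out when two points of the hyperbolic space are
compared. -/
lemma trace_lineForm_mul (v : Fin (n + 1) → ℝ) (S : Matrix (Fin (n + 1)) (Fin (n + 1)) ℝ) :
    (lineForm v * S).trace =
      2 * quad S (lorentzMatrix n *ᵥ v) - (lorentzMatrix n * S).trace := by
  rw [lineForm, Matrix.sub_mul, trace_sub, Matrix.smul_mul, trace_smul, vecMulVec_mul,
    trace_vecMulVec, quad, dotProduct_mulVec, dotProduct_comm, smul_eq_mul]

lemma selbergDiff_le_iff {v w : Fin (n + 1) → ℝ} (hv : lorentz v v = 1) (hw : lorentz w w = 1)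
    {O Q S : Matrix (Fin (n + 1)) (Fin (n + 1)) ℝ} {a c : ℝ} (ha : 0 < a) (hc : 0 < c)
    (hO : O⁻¹ = a • lineForm v) (hQ : Q⁻¹ = a • lineForm w) (hS : S.PosDef) :
    selbergDiff O O (c • S) ≤ selbergDiff O Q (c • S) ↔
      quad S (lorentzMatrix n *ᵥ v) ≤ quad S (lorentzMatrix n *ᵥ w) := by
  have hpos : ∀ w : Fin (n + 1) → ℝ, lorentz w w = 1 →
      0 < 1 / ((n + 1 : ℕ) : ℝ) * ((a • lineForm w) * (c • S)).trace := by
    intro w hw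
    have := trace_mul_pos (posDef_lineForm hw).posSemidef (posDef_ne_zero (posDef_lineForm hw)) hS
    rw [Matrix.smul_mul, Matrix.mul_smul, trace_smul, trace_smul, smul_eq_mul, smul_eq_mul]
    positivity
  rw [selbergDiff, selbergDiff, sub_le_sub_iff_right, hO, hQ, Real.log_le_log_iff (hpos v hv)
    (hpos w hw), mul_le_mul_iff_right₀ (by positivity)]
  rw [Matrix.smul_mul, Matrix.mul_smul, Matrix.smul_mul, Matrix.mul_smul]
  simp only [trace_smul, smul_eq_mul]
  rw [mul_le_mul_iff_right₀ ha, mul_le_mul_iff_right₀ hc, trace_lineForm_mul, trace_lineForm_mul]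
  constructor <;> intro h <;> linarith

lemma Represents.smul_SL {d : ℕ} {Q : Matrix (Fin d) (Fin d) ℝ} {x : ProjSym d}
    (h : Represents Q x) (g : SpecialLinearGroup (Fin d) ℝ) :
    Represents (g.1 * Q * g.1ᵀ) (g • x) := by
  obtain ⟨hs, h0, rfl⟩ := h
  exact ⟨(g • (⟨Q, hs⟩ : symTensors d)).2, (smul_ne_zero_iff_ne g).mpr h0, rfl⟩

/-- The interior part of the Dirichlet–Selberg domain is a set of forms that attain at `v` their
minimum over the orbit of `v`. -/
lemma dirichletSelberg_inter_projModel (Γ : Subgroup (SO1 n)) {v : Fin (n + 1) → ℝ}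
    (hv : lorentz v v = 1) {o : ProjSym (n + 1)} (ho : Represents (lineForm v)⁻¹ o) :
    dirichletSelberg (Γ.map (SO1 n).subtype) o ∩ projModel (n + 1) =
      minSet (lorentzMatrix n *ᵥ v)
        (fun γ : Γ => lorentzMatrix n *ᵥ ((γ : SO1 n).1.1 *ᵥ v)) := by
  have hpdv := posDef_lineForm hv
  have hpdi : (lineForm v)⁻¹.PosDef := hpdv.inv
  have hu : IsUnit (lineForm v).det := hpdv.det_pos.ne'.isUnit
  have hinv : ((lineForm v)⁻¹)⁻¹ = lineForm v := nonsing_inv_nonsing_inv _ hu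
  have hdet : ∀ γ : SO1 n, (γ.1.1 * (lineForm v)⁻¹ * γ.1.1ᵀ).det = ((lineForm v)⁻¹).det := by
    intro γ
    rw [det_mul, det_mul, det_transpose, γ.1.2]; ring
  have hpdγ : ∀ γ : SO1 n, (γ.1.1 * (lineForm v)⁻¹ * γ.1.1ᵀ).PosDef := by
    intro γ
    have := (posDef_lineForm (v := γ.1.1 *ᵥ v) (by rw [SO1_lorentz, hv])).inv
    rw [← inv_mul_inv_mul_transpose γ hv, nonsing_inv_nonsing_inv] at this
    · exact this
    · rw [hdet]
      exact hpdi.det_pos.ne'.isUnit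
  ext x
  constructor
  · rintro ⟨⟨-, hx⟩, Q, hQ, hQx⟩
    refine ⟨⟨Q, hQ⟩, fun γ => ?_, hQx.eq_cls hQ⟩
    have := hx γ.1.1 ⟨γ.1, γ.2, rfl⟩ (lineForm v)⁻¹ _ Q hpdi ho (hpdγ γ) (ho.smul_SL _)
      hQ.posSemidef hQx (by
        rw [hinv, det_mul, hdet, ← det_mul, mul_nonsing_inv _ hu, det_one])
    rw [← one_smul ℝ Q] at this
    exact (selbergDiff_le_iff hv (by rw [SO1_lorentz, hv]) one_pos one_pos (by rw [hinv, one_smul])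
      (by rw [inv_mul_inv_mul_transpose γ.1 hv, one_smul]) hQ).mp this
  · rintro ⟨⟨S, hS⟩, hmin, rfl⟩
    refine ⟨⟨subset_closure (PDMatrix.cls _).2, ?_⟩, (PDMatrix.cls _).2⟩
    rintro _ ⟨γ, hγ, rfl⟩ O Q S' hO hOo hQ hQo hS' hS'x hd
    obtain ⟨a, ha, rfl⟩ := ho.exists_pos_smul hOo hpdi hO.posSemidef
    obtain ⟨b, hb, rfl⟩ := (ho.smul_SL γ.1).exists_pos_smul hQo (hpdγ γ) hQ.posSemidef
    obtain ⟨c, hc, rfl⟩ := (PDMatrix.represents ⟨S, hS⟩).exists_pos_smul hS'x hS hS'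
    have hinva : (a • (lineForm v)⁻¹)⁻¹ = a⁻¹ • lineForm v := by
      refine inv_eq_left_inv ?_
      rw [Matrix.smul_mul, Matrix.mul_smul, smul_smul, inv_mul_cancel₀ ha.ne', one_smul,
        mul_nonsing_inv _ hu]
    -- The determinant normalisation makes a power of the positive ratio of the two scalars equal to
    -- one.
    have hab : a = b := by
      rw [hinva, det_mul, det_smul, det_smul, hdet] at hd
      have h1 : (lineForm v).det * ((lineForm v)⁻¹).det = 1 := by
        rw [← det_mul, mul_nonsing_inv _ hu, det_one]
      have h2 : (a⁻¹ * b) ^ (Fintype.card (Fin (n + 1))) = 1 := by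
        rw [mul_pow]
        linear_combination hd - a⁻¹ ^ (Fintype.card (Fin (n + 1))) *
          b ^ (Fintype.card (Fin (n + 1))) * h1
      have h3 : a⁻¹ * b = 1 := (pow_eq_one_iff_of_nonneg (by positivity) (by simp)).mp h2
      field_simp at h3
      exact h3.symm
    subst hab
    have hinvγ : (a • (γ.1.1 * (lineForm v)⁻¹ * γ.1.1ᵀ))⁻¹ = a⁻¹ • lineForm (γ.1.1 *ᵥ v) := by
      refine inv_eq_left_inv ?_
      rw [← inv_mul_inv_mul_transpose γ hv, Matrix.smul_mul, Matrix.mul_smul, smul_smul,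
        inv_mul_cancel₀ ha.ne', one_smul, nonsing_inv_mul]
      exact (hpdγ γ).det_pos.ne'.isUnit
    exact (selbergDiff_le_iff hv (by rw [SO1_lorentz, hv]) (inv_pos.mpr ha) hc hinva hinvγ hS).mpr
      (hmin ⟨γ, hγ⟩)

lemma lorentzMatrix_mulVec_dotProduct (x y : Fin (n + 1) → ℝ) :
    (lorentzMatrix n *ᵥ x) ⬝ᵥ (lorentzMatrix n *ᵥ y) = x ⬝ᵥ y := by
  rw [dotProduct_mulVec, ← mulVec_transpose, lorentzMatrix_transpose, lorentzMatrix_mulVec_mulVec]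

lemma lorentz_lorentzMatrix_mulVec (x y : Fin (n + 1) → ℝ) :
    lorentz (lorentzMatrix n *ᵥ x) (lorentzMatrix n *ᵥ y) = lorentz x y := by
  rw [lorentz_eq_dotProduct, lorentzMatrix_mulVec_dotProduct, lorentz_eq_dotProduct]

lemma sq_le_dotProduct_self {d : ℕ} (x : Fin d → ℝ) (i : Fin d) : x i ^ 2 ≤ x ⬝ᵥ x := by
  rw [sq]
  exact Finset.single_le_sum (f := fun i => x i * x i) (fun i _ => mul_self_nonneg _)
    (Finset.mem_univ i)

/-- The action on timelike vectors is proper. -/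
lemma exists_isCompact_of_orbit_le {v : Fin (n + 1) → ℝ} (hv : lorentz v v = 1) (R : ℝ) :
    ∃ C : Set (SO1 n), IsCompact C ∧
      ∀ g : SO1 n, (g.1.1 *ᵥ v) ⬝ᵥ (g.1.1 *ᵥ v) ≤ R → g ∈ C := by
  obtain ⟨c, hc, h⟩ := exists_eventually_le_quad (posDef_lineForm hv)
  replace h := h.self_of_nhds
  -- The columns of `g⁻¹` are bounded: at `y = g⁻¹ e_j` the form `lineForm v` takes the value `2 *
  -- lorentz (g v) e_j ^ 2 - lorentz e_j e_j ≤ 2 * R + 1`, and it is at least `c` times the squared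
  -- norm of `y`.
  refine ⟨_, (isCompact_SO1_entries_le (n := n) (Real.sqrt ((2 * R + 1) / c))).inv,
    fun g hg => Set.mem_inv.mpr fun i j => ?_⟩
  set w := g.1.1 *ᵥ v with hw
  set y := (g⁻¹).1.1 *ᵥ Pi.single j 1 with hy
  have h1 := h y
  have h2 : lorentz v y = lorentz w (Pi.single j 1) := (SO1_lorentz_left _ _ _).symm
  have h3 : lorentz y y = lorentz (Pi.single j 1) (Pi.single j (1 : ℝ) : Fin (n + 1) → ℝ) :=
    SO1_lorentz _ _ _
  have h4 : lorentz w (Pi.single j 1) = (lorentzMatrix n *ᵥ w) j := by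
    rw [lorentz_comm, lorentz_eq_dotProduct]; simp
  have h5 : lorentz w (Pi.single j 1) ^ 2 ≤ R := by
    rw [h4]
    refine (sq_le_dotProduct_self _ j).trans ?_
    rwa [lorentzMatrix_mulVec_dotProduct]
  have h6 : -1 ≤ lorentz (Pi.single j 1) (Pi.single j (1 : ℝ) : Fin (n + 1) → ℝ) := by
    rw [lorentz_eq_dotProduct]
    simp only [mulVec_single, single_dotProduct, lorentzMatrix]
    refine Fin.cases ?_ (fun k => ?_) j <;> simp
  rw [quad_lineForm, h2, h3] at h1
  have h7 : y i ^ 2 ≤ (2 * R + 1) / c := by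
    rw [le_div_iff₀ hc]
    nlinarith [sq_le_dotProduct_self y i]
  have h8 : (g⁻¹).1.1 i j = y i := by simp [hy]
  rw [h8, ← Real.sqrt_sq_eq_abs]
  exact Real.sqrt_le_sqrt h7

/-- Orbits of timelike vectors under discrete groups are locally finite. -/
lemma finite_setOf_orbit_le (Γ : Subgroup (SO1 n)) [DiscreteTopology Γ] {v : Fin (n + 1) → ℝ}
    (hv : lorentz v v = 1) (R : ℝ) :
    {γ : Γ | ((γ : SO1 n).1.1 *ᵥ v) ⬝ᵥ ((γ : SO1 n).1.1 *ᵥ v) ≤ R}.Finite := by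
  obtain ⟨C, hC, h⟩ := exists_isCompact_of_orbit_le hv R
  exact (finite_inter_of_isCompact Γ hC).subset fun γ hγ => h _ hγ

/-- Dirichlet–Selberg domains of lattices based at points of the hyperbolic space have infinitely
many sides. -/
theorem IsLattice.infinite_sides (hn : 2 ≤ n) {Γ : Subgroup (SO1 n)} (hΓ : IsLattice Γ)
    {o : ProjSym (n + 1)} (ho : o ∈ hyperbolicCopy n) :
    (sides (dirichletSelberg (Γ.map (SO1 n).subtype) o ∩ projModel (n + 1))).Infinite := by
  obtain ⟨v', M, hv', hM, hMo⟩ := ho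
  rw [hM.eq_lineForm hv'] at hMo
  set v := (Real.sqrt (lorentz v' v'))⁻¹ • v' with hvdef
  have hv : lorentz v v = 1 := by
    rw [hvdef, lorentz_smul_left, lorentz_smul_right, ← mul_assoc, ← _root_.mul_inv_rev, ← sq,
      Real.sq_sqrt hv'.le, inv_mul_cancel₀ hv'.ne']
  rw [dirichletSelberg_inter_projModel Γ hv hMo]
  have hΓd : DiscreteTopology Γ := hΓ.1
  intro hfinite
  set J := lorentzMatrix n with hJ
  have hJJ : ∀ x, J *ᵥ (J *ᵥ x) = x := lorentzMatrix_mulVec_mulVec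
  -- An interior point of the domain: its value at `J w` is `2 * lorentz v w ^ 2 - 1`, smallest on
  -- the hyperboloid exactly at `w = ±v`.
  let P : PDMatrix (n + 1) := ⟨lineForm (J *ᵥ v),
    posDef_lineForm (by rw [lorentz_lorentzMatrix_mulVec, hv])⟩
  have hPval : ∀ w, lorentz w w = 1 → quad P.1 (J *ᵥ w) = 2 * lorentz v w ^ 2 - 1 := by
    intro w hw
    rw [quad_lineForm, lorentz_lorentzMatrix_mulVec, lorentz_lorentzMatrix_mulVec, hw]
  have hne : ∀ w : Fin (n + 1) → ℝ, (J *ᵥ w ≠ J *ᵥ v ∧ J *ᵥ w ≠ -(J *ᵥ v)) →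
      w ≠ v ∧ w ≠ -v := by
    rintro w ⟨h1, h2⟩
    exact ⟨fun h => h1 (by rw [h]), fun h => h2 (by rw [h, mulVec_neg])⟩
  have hww : ∀ γ : Γ, lorentz ((γ : SO1 n).1.1 *ᵥ v) ((γ : SO1 n).1.1 *ᵥ v) = 1 := fun γ => by
    rw [SO1_lorentz, hv]
  have hP : ∀ γ : Γ, J *ᵥ ((γ : SO1 n).1.1 *ᵥ v) ≠ J *ᵥ v →
      J *ᵥ ((γ : SO1 n).1.1 *ᵥ v) ≠ -(J *ᵥ v) →
      quad P.1 (J *ᵥ v) < quad P.1 (J *ᵥ ((γ : SO1 n).1.1 *ᵥ v)) := by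
    intro γ h1 h2
    rw [hPval _ hv, hPval _ (hww γ), hv]
    have := one_lt_lorentz_sq hv (hww γ) (hne _ ⟨h1, h2⟩).1 (hne _ ⟨h1, h2⟩).2
    linarith
  obtain ⟨t, ht, ht1, ht2⟩ := exists_finite_of_finite_sides (fun R => by
    simp only [hJ, lorentzMatrix_mulVec_dotProduct]
    exact finite_setOf_orbit_le Γ hv R) hP hfinite
  refine hΓ.not_forall_abs_lorentz_le hn hv (ht.image fun γ : Γ => (γ : SO1 n).1.1 *ᵥ v) ?_ ?_
  · rintro _ ⟨γ, hγ, rfl⟩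
    exact ⟨hww γ, hne _ (ht1 γ hγ)⟩
  · intro η hη γ hγ
    have hS : ∀ x, quad (vecMulVec η η) (J *ᵥ x) = lorentz η x ^ 2 := by
      intro x
      rw [quad, vecMulVec_mulVec, op_smul_eq_smul, dotProduct_smul, lorentz_eq_dotProduct,
        dotProduct_comm (J *ᵥ x) η, smul_eq_mul, sq]
    -- The rank one form of `η` is only semidefinite; adding `ε` times `P` makes it definite and
    -- keeps the selected inequalities. Then `ε` tends to zero.
    have key : ∀ ε : ℝ, 0 < ε → lorentz η v ^ 2 + ε * quad P.1 (J *ᵥ v) ≤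
        lorentz η (γ.1.1 *ᵥ v) ^ 2 + ε * quad P.1 (J *ᵥ (γ.1.1 *ᵥ v)) := by
      intro ε hε
      have hpd : (vecMulVec η η + ε • P.1).PosDef := by
        refine posDef_iff_quad.mpr ⟨?_, fun x hx => ?_⟩
        · exact IsSymm.add (by simp [IsSymm, transpose_vecMulVec]) (P.2.isSymm'.smul ε)
        · rw [quad_add, quad_smul, ← hJJ x, hS]
          have := P.2.quad_pos hx
          rw [hJJ]
          positivity
      have := ht2 ⟨_, hpd⟩ (fun δ hδ => by
        simp only [quad_add, quad_smul, hS]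
        have h1 := hη _ ⟨δ, hδ, rfl⟩
        have h2 := hP δ (ht1 δ hδ).1 (ht1 δ hδ).2
        have h3 := sq_le_sq.mpr h1
        have h4 := mul_le_mul_of_nonneg_left h2.le hε.le
        linarith) ⟨γ, hγ⟩
      simpa only [quad_add, quad_smul, hS] using this
    refine sq_le_sq.mp (le_of_forall_pos_le_add fun ε hε => ?_)
    set a := quad P.1 (J *ᵥ (γ.1.1 *ᵥ v))
    set b := quad P.1 (J *ᵥ v)
    have h1 := key (ε / (|a - b| + 1)) (by positivity)
    have h2 : ε / (|a - b| + 1) * (a - b) ≤ ε := by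
      rw [div_mul_eq_mul_div, div_le_iff₀ (by positivity)]
      exact mul_le_mul_of_nonneg_left ((le_abs_self _).trans (by linarith)) hε.le
    linarith

end Domain

/-! ### Singular values of elements of `SO(1, n)` -/

section SingularValues

/-- Singular value gaps of a matrix `g` for which `gᵀ g` has the eigenvalues `E`, `1`, `E⁻¹`,
the first and the last one simple. -/
lemma log_le_log_singularValue_div {n : ℕ} (hn : 1 ≤ n)
    (g : SpecialLinearGroup (Fin (n + 1)) ℝ) {E : ℝ} (hE : 1 ≤ E) {a b : Fin (n + 1) → ℝ}
    (ha : a ≠ 0) (hb : b ≠ 0) (hga : (g.1ᵀ * g.1) *ᵥ a = E • a)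
    (hgb : (g.1ᵀ * g.1) *ᵥ b = E⁻¹ • b)
    (heig : ∀ (μ : ℝ) (x : Fin (n + 1) → ℝ), x ≠ 0 → (g.1ᵀ * g.1) *ᵥ x = μ • x →
      μ = 1 ∨ (μ = E ∧ ∃ c : ℝ, x = c • a) ∨ (μ = E⁻¹ ∧ ∃ c : ℝ, x = c • b)) :
    Real.log E / 2 ≤ Real.log (singularValue 1 g / singularValue 2 g) ∧
      Real.log E / 2 ≤ Real.log (singularValue n g / singularValue (n + 1) g) := by
  set T := Matrix.toEuclideanLin g.1 with hT
  have hsymm := T.isSymmetric_adjoint_comp_self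
  have hfr : Module.finrank ℝ (EuclideanSpace ℝ (Fin (n + 1))) = n + 1 := by simp
  have happ : ∀ x, (LinearMap.adjoint T ∘ₗ T) x = WithLp.toLp 2 ((g.1ᵀ * g.1) *ᵥ x.ofLp) := by
    intro x
    rw [hT, ← Matrix.toEuclideanLin_conjTranspose_eq_adjoint, conjTranspose_eq_transpose_of_trivial,
      LinearMap.comp_apply, ← mulVec_mulVec]
    rfl
  set l := hsymm.eigenvalues hfr with hl
  set e := hsymm.eigenvectorBasis hfr with he
  have hne : ∀ i, (e i).ofLp ≠ 0 := fun i h =>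
    e.orthonormal.ne_zero i (WithLp.ofLp_injective 2 h)
  have hei : ∀ i, (g.1ᵀ * g.1) *ᵥ (e i).ofLp = l i • (e i).ofLp := by
    intro i
    have h1 := hsymm.apply_eigenvectorBasis hfr i
    rw [happ] at h1
    exact congrArg WithLp.ofLp h1
  have hval := fun i => heig (l i) _ (hne i) (hei i)
  have hex : ∀ (μ : ℝ) (x : Fin (n + 1) → ℝ), x ≠ 0 → (g.1ᵀ * g.1) *ᵥ x = μ • x →
      ∃ i, l i = μ := by
    intro μ x hx h
    have : Module.End.HasEigenvalue (LinearMap.adjoint T ∘ₗ T) μ := by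
      refine Module.End.hasEigenvalue_of_hasEigenvector (x := WithLp.toLp 2 x) ⟨?_, ?_⟩
      · rw [Module.End.mem_eigenspace_iff, happ]
        exact congrArg (WithLp.toLp 2) h
      · intro h0
        exact hx (congrArg WithLp.ofLp h0)
    obtain ⟨i, hi⟩ := hsymm.exists_eigenvalues_eq hfr this
    exact ⟨i, hi⟩
  -- Orthonormal eigenvectors cannot share a line, so an eigenvalue above or below `1` occurs only
  -- once: all but the first are at most `1`, all but the last at least `1`.
  have hindep : ∀ i j, i ≠ j → ∀ w : Fin (n + 1) → ℝ, ∀ c c' : ℝ, (e i).ofLp = c • w →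
      (e j).ofLp = c' • w → False := by
    intro i j hij w c c' h1 h2
    have h3 : c' • e i = c • e j := by
      refine WithLp.ofLp_injective 2 ?_
      rw [WithLp.ofLp_smul, WithLp.ofLp_smul, h1, h2, smul_smul, smul_smul, mul_comm]
    have h4 := congrArg (fun z => inner ℝ (e i) z) h3
    simp only [inner_smul_right, e.inner_eq_one, e.inner_eq_zero hij, mul_zero, mul_one] at h4
    rw [h4, zero_smul] at h2
    exact hne j h2
  have hE0 : 0 < E := by linarith
  have hEi : E⁻¹ ≤ 1 := inv_le_one_of_one_le₀ hE
  have hpos : ∀ i, 0 < l i := by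
    intro i
    rcases hval i with h | ⟨h, -⟩ | ⟨h, -⟩ <;> rw [h] <;> positivity
  have hanti := hsymm.eigenvalues_antitone hfr
  have hle : ∀ i j, i < j → l j ≤ 1 := by
    intro i j hij
    by_contra h1
    push Not at h1
    have h2 : 1 < l i := h1.trans_le (hanti hij.le)
    obtain ⟨c, hc⟩ : ∃ c : ℝ, (e i).ofLp = c • a := by
      rcases hval i with h | ⟨-, h⟩ | ⟨h, -⟩
      · linarith
      · exact h
      · linarith
    obtain ⟨c', hc'⟩ : ∃ c : ℝ, (e j).ofLp = c • a := by
      rcases hval j with h | ⟨-, h⟩ | ⟨h, -⟩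
      · linarith
      · exact h
      · linarith
    exact hindep i j hij.ne a c c' hc hc'
  have hge : ∀ i j, i < j → 1 ≤ l i := by
    intro i j hij
    by_contra h1
    push Not at h1
    have h2 : l j < 1 := (hanti hij.le).trans_lt h1
    obtain ⟨c, hc⟩ : ∃ c : ℝ, (e i).ofLp = c • b := by
      rcases hval i with h | ⟨h, -⟩ | ⟨-, h⟩
      · linarith
      · linarith
      · exact h
    obtain ⟨c', hc'⟩ : ∃ c : ℝ, (e j).ofLp = c • b := by
      rcases hval j with h | ⟨h, -⟩ | ⟨-, h⟩
      · linarith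
      · linarith
      · exact h
    exact hindep i j hij.ne b c c' hc hc'
  have hsv : ∀ i : Fin (n + 1), T.singularValues i = Real.sqrt (l i) :=
    fun i => T.singularValues_fin hfr i
  have hlog : ∀ i j : Fin (n + 1), E * l j ≤ l i →
      Real.log E / 2 ≤ Real.log (T.singularValues i / T.singularValues j) := by
    intro i j hij
    rw [hsv, hsv, ← Real.sqrt_div (hpos i).le, Real.log_sqrt (div_pos (hpos i) (hpos j)).le]
    have : E ≤ l i / l j := by rwa [le_div_iff₀ (hpos j)]
    have := Real.log_le_log hE0 this
    linarith
  constructor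
  · refine hlog 0 ⟨1, by omega⟩ ?_
    obtain ⟨i, hi⟩ := hex E a ha hga
    have h1 : E ≤ l 0 := hi ▸ hanti (Fin.zero_le i)
    have h2 := hle 0 ⟨1, by omega⟩ (by simp [Fin.lt_def])
    nlinarith [hpos ⟨1, by omega⟩]
  -- Eigenvalues are indexed from `0`, `singularValue` from `1`.
  · have := hlog ⟨n - 1, by omega⟩ ⟨n, by omega⟩ ?_
    · simpa [singularValue] using this
    obtain ⟨i, hi⟩ := hex E⁻¹ b hb hgb
    have h1 : l ⟨n, by omega⟩ ≤ E⁻¹ := hi ▸ hanti (Fin.le_def.mpr (by simp; omega))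
    have h2 := hge ⟨n - 1, by omega⟩ ⟨n, by omega⟩ (by rw [Fin.lt_def]; simp; omega)
    calc E * l ⟨n, by omega⟩ ≤ E * E⁻¹ := mul_le_mul_of_nonneg_left h1 hE0.le
      _ = 1 := mul_inv_cancel₀ hE0.ne'
      _ ≤ _ := h2

/-! ### Boost decomposition and the singular value gaps of $\mathrm{SO}(1,n)$ -/

variable {n : ℕ}

/-- The base point of the hyperboloid. -/
def timeVec (n : ℕ) : Fin (n + 1) → ℝ := Pi.single 0 1

lemma lorentz_timeVec (x : Fin (n + 1) → ℝ) : lorentz (timeVec n) x = x 0 := by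
  simp [lorentz, timeVec]

lemma lineForm_timeVec : lineForm (timeVec n) = 1 := by
  refine ext_of_dotProduct_mulVec fun x y => ?_
  rw [dotProduct_lineForm_mulVec, lorentz_timeVec, lorentz_timeVec, one_mulVec, lorentz,
    dotProduct, Fin.sum_univ_succ]
  ring

lemma lineForm_neg (v : Fin (n + 1) → ℝ) : lineForm (-v) = lineForm v := by
  refine ext_of_dotProduct_mulVec fun x y => ?_
  rw [dotProduct_lineForm_mulVec, dotProduct_lineForm_mulVec, lorentz_neg_left, lorentz_neg_left]
  ring

/-- Every element of `SO(1, n)` is the product of a boost and an orthogonal matrix. -/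
lemma exists_boost_mul (hn : 1 ≤ n) (g : SO1 n) :
    ∃ (u : Fin (n + 1) → ℝ) (h : IsHyperbolicPair (timeVec n) u) (t : ℝ) (k : SO1 n),
      0 ≤ t ∧ g = h.boost t * k ∧
        (k.1.1 *ᵥ timeVec n = timeVec n ∨ k.1.1 *ᵥ timeVec n = -timeVec n) := by
  set x := g.1.1 *ᵥ timeVec n with hx
  have hee : lorentz (timeVec n) (timeVec n) = 1 := by rw [lorentz_timeVec]; simp [timeVec]
  have hxx : lorentz x x = 1 := by rw [hx, SO1_lorentz, hee]
  -- Elements of determinant one may still exchange the two sheets of the hyperboloid; `s` records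
  -- this.
  obtain ⟨s, hs, hs0⟩ : ∃ s : ℝ, (s = 1 ∨ s = -1) ∧ 0 ≤ s * x 0 := by
    rcases le_total 0 (x 0) with h | h
    · exact ⟨1, Or.inl rfl, by linarith⟩
    · exact ⟨-1, Or.inr rfl, by linarith⟩
  have hss : s * s = 1 := by rcases hs with rfl | rfl <;> norm_num
  set y := s • x - (s * x 0) • timeVec n with hy
  have hey : lorentz (timeVec n) y = 0 := by
    rw [hy, lorentz_sub_right, lorentz_smul_right, lorentz_smul_right, hee, lorentz_timeVec]; ring
  have hyy : lorentz y y = 1 - x 0 ^ 2 := by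
    rw [hy, lorentz_sub_right, lorentz_smul_right, lorentz_smul_right, lorentz_sub_left,
      lorentz_sub_left, lorentz_smul_left, lorentz_smul_left, lorentz_smul_left,
      lorentz_smul_left, hxx, hee, lorentz_comm x, lorentz_timeVec]
    linear_combination (1 - x 0 ^ 2) * hss
  obtain ⟨r, u, hr, hu, hyu⟩ : ∃ (r : ℝ) (u : Fin (n + 1) → ℝ), 0 ≤ r ∧
      IsHyperbolicPair (timeVec n) u ∧ y = r • u := by
    obtain ⟨h1, h2⟩ := lorentz_self_nonpos_of_orthogonal (by rw [hee]; norm_num) hey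
    rcases h1.lt_or_eq with h1 | h1
    · have h3 := Real.sq_sqrt (show 0 ≤ -lorentz y y by linarith)
      have h4 := (Real.sqrt_pos.mpr (show 0 < -lorentz y y by linarith)).ne'
      refine ⟨Real.sqrt (-lorentz y y), (Real.sqrt (-lorentz y y))⁻¹ • y, Real.sqrt_nonneg _,
        ⟨hee, ?_, ?_⟩, ?_⟩
      · rw [lorentz_smul_left, lorentz_smul_right]
        field_simp
        linarith
      · rw [lorentz_smul_right, hey, mul_zero]
      · rw [smul_smul, mul_inv_cancel₀ h4, one_smul]
    · refine ⟨0, Pi.single ⟨1, by omega⟩ 1, le_rfl, ⟨hee, ?_, ?_⟩, by rw [h2 h1, zero_smul]⟩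
      · have : (⟨1, by omega⟩ : Fin (n + 1)) = Fin.succ ⟨0, by omega⟩ := rfl
        rw [lorentz_eq_dotProduct, lorentzMatrix]
        simp only [mulVec_single, single_dotProduct]
        simp
        rw [this, Fin.cons_succ]
      · rw [lorentz_timeVec]
        simp [Fin.ext_iff]
  have hr2 : 1 + r ^ 2 = (s * x 0) ^ 2 := by
    have : lorentz y y = -r ^ 2 := by
      rw [hyu, lorentz_smul_left, lorentz_smul_right, hu.right]; ring
    rw [hyy] at this
    linear_combination this - x 0 ^ 2 * hss
  have hsx : s • x = (hu.boost (Real.arsinh r)).1.1 *ᵥ timeVec n := by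
    rw [hu.boost_coe, hu.boostMatrix_mulVec_left, Real.sinh_arsinh, Real.cosh_arsinh, hr2,
      Real.sqrt_sq hs0, ← hyu, hy]
    abel
  refine ⟨u, hu, Real.arsinh r, (hu.boost (Real.arsinh r))⁻¹ * g, Real.arsinh_nonneg_iff.mpr hr,
    by group, ?_⟩
  have hk : ((hu.boost (Real.arsinh r))⁻¹ * g).1.1 *ᵥ timeVec n = s • timeVec n := by
    have hxs : x = s • (s • x) := by rw [smul_smul, hss, one_smul]
    rw [SO1_coe_mul, ← mulVec_mulVec, ← hx, hxs, hsx, mulVec_smul, mulVec_mulVec, SO1_inv_mul,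
      one_mulVec]
  rcases hs with rfl | rfl
  · exact Or.inl (by rw [hk, one_smul])
  · exact Or.inr (by rw [hk, neg_one_smul])

/-- An element that preserves the base line preserves its line form, and that form is the Euclidean
one. -/
lemma transpose_mul_self_of_timeVec {k : SO1 n}
    (hk : k.1.1 *ᵥ timeVec n = timeVec n ∨ k.1.1 *ᵥ timeVec n = -timeVec n) :
    k.1.1ᵀ * k.1.1 = 1 := by
  have h := transpose_mul_lineForm_mul k (timeVec n)
  have h1 : lineForm (k.1.1 *ᵥ timeVec n) = 1 := by
    rcases hk with h | h
    · rw [h, lineForm_timeVec]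
    · rw [h, lineForm_neg, lineForm_timeVec]
  rw [h1, lineForm_timeVec, mul_one] at h
  exact h

lemma IsHyperbolicPair.apply_zero {u : Fin (n + 1) → ℝ} (h : IsHyperbolicPair (timeVec n) u) :
    u 0 = 0 := by
  rw [← lorentz_timeVec u, h.orth]

/-- The Gram matrix fixes `timeVec` and negates `u`, which makes the generator symmetric. Hence a
boost by `t` times its transpose is the boost by `2 * t`. -/
lemma IsHyperbolicPair.transpose_boostMatrix {u : Fin (n + 1) → ℝ}
    (h : IsHyperbolicPair (timeVec n) u) (t : ℝ) :
    (boostMatrix (timeVec n) u t)ᵀ = boostMatrix (timeVec n) u t := by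
  have h1 : lorentzMatrix n *ᵥ timeVec n = timeVec n := by
    funext i
    rw [lorentzMatrix, mulVec_diagonal, timeVec]
    refine Fin.cases ?_ (fun j => ?_) i <;> simp
  have h2 : lorentzMatrix n *ᵥ u = -u := by
    funext i
    rw [lorentzMatrix, mulVec_diagonal, Pi.neg_apply]
    refine Fin.cases ?_ (fun j => ?_) i
    · simp [h.apply_zero]
    · simp
  have hX : (boostGen (timeVec n) u)ᵀ = boostGen (timeVec n) u := by
    rw [boostGen, h1, h2, transpose_sub, transpose_vecMulVec, transpose_vecMulVec, vecMulVec_neg,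
      neg_vecMulVec]
    abel
  rw [boostMatrix, transpose_add, transpose_add, transpose_smul, transpose_smul, transpose_mul,
    transpose_one, hX]

/-- Eigenvectors of boosts. -/
lemma IsHyperbolicPair.eigen_boostMatrix {v u : Fin (n + 1) → ℝ} (h : IsHyperbolicPair v u)
    {t μ : ℝ} {x : Fin (n + 1) → ℝ} (hx : x ≠ 0) (hμ : boostMatrix v u t *ᵥ x = μ • x) :
    μ = 1 ∨ (μ = Real.exp t ∧ ∃ c : ℝ, x = c • (v + u)) ∨
      (μ = Real.exp (-t) ∧ ∃ c : ℝ, x = c • (v - u)) := by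
  by_cases h1 : μ = 1
  · exact Or.inl h1
  right
  have h3 : lorentz u v = 0 := by rw [lorentz_comm, h.orth]
  have hsub : 1 - μ ≠ 0 := fun h0 => h1 (by linarith)
  set A := lorentz v x with hA
  set B := -lorentz u x with hB
  have hexp : boostMatrix v u t *ᵥ x = x + (Real.sinh t * B + (Real.cosh t - 1) * A) • v +
      (Real.sinh t * A + (Real.cosh t - 1) * B) • u := by
    simp only [boostMatrix, add_mulVec, smul_mulVec, one_mulVec, ← mulVec_mulVec, boostGen_mulVec,
      lorentz_sub_right, lorentz_smul_right, h.left, h.right, h.orth, h3, ← hA]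
    rw [show lorentz u x = -B by rw [hB]; ring]
    module
  have eA : Real.cosh t * A + Real.sinh t * B = μ * A := by
    have := congrArg (lorentz v) (hexp.symm.trans hμ)
    rw [lorentz_add_right, lorentz_add_right, lorentz_smul_right, lorentz_smul_right,
      lorentz_smul_right, h.left, h.orth, ← hA] at this
    linear_combination this
  have eB : Real.sinh t * A + Real.cosh t * B = μ * B := by
    have := congrArg (lorentz u) (hexp.symm.trans hμ)
    rw [lorentz_add_right, lorentz_add_right, lorentz_smul_right, lorentz_smul_right,
      lorentz_smul_right, h3, h.right, show lorentz u x = -B by rw [hB]; ring] at this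
    linear_combination -this
  -- The boost moves `x` only within the plane of `v` and `u`, so an eigenvector for an eigenvalue
  -- other than `1` lies in that plane. There `A + B` and `A - B` are the coordinates that the boost
  -- scales.
  have hspan : x = A • v + B • u := by
    have h4 : (1 - μ) • x = (1 - μ) • (A • v + B • u) := by
      have h5 := hexp.symm.trans hμ
      have e1 : Real.sinh t * B + (Real.cosh t - 1) * A = -(1 - μ) * A := by
        linear_combination eA
      have e2 : Real.sinh t * A + (Real.cosh t - 1) * B = -(1 - μ) * B := by
        linear_combination eB
      rw [e1, e2] at h5
      have h6 : x - μ • x = (1 - μ) • (A • v + B • u) := by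
        rw [← h5]; module
      rw [← h6]; module
    exact smul_right_injective _ hsub h4
  have f1 : (A + B) * (Real.exp t - μ) = 0 := by
    rw [← Real.cosh_add_sinh]; linear_combination eA + eB
  have f2 : (A - B) * (Real.exp (-t) - μ) = 0 := by
    rw [← Real.cosh_sub_sinh]; linear_combination eA - eB
  rcases mul_eq_zero.mp f1 with g1 | g1
  · rcases mul_eq_zero.mp f2 with g2 | g2
    · have hA0 : A = 0 := by linarith
      have hB0 : B = 0 := by linarith
      exact absurd (by rw [hspan, hA0, hB0]; simp) hx
    · refine Or.inr ⟨by linarith, A, ?_⟩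
      rw [hspan, show B = -A by linarith]
      module
  · by_cases g2 : A - B = 0
    · refine Or.inl ⟨by linarith, A, ?_⟩
      rw [hspan, show B = A by linarith]
      module
    · have g3 := (mul_eq_zero.mp f2).resolve_left g2
      have g4 : Real.exp t = Real.exp (-t) := by linarith
      have g5 : t = 0 := by
        have := Real.exp_injective g4
        linarith
      refine absurd ?_ h1
      rw [g5, Real.exp_zero] at g1
      linarith

lemma IsHyperbolicPair.boostMatrix_mulVec_add {v u : Fin (n + 1) → ℝ} (h : IsHyperbolicPair v u)
    (t : ℝ) : boostMatrix v u t *ᵥ (v + u) = Real.exp t • (v + u) := by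
  have h3 : lorentz u v = 0 := by rw [lorentz_comm, h.orth]
  simp only [boostMatrix, add_mulVec, smul_mulVec, one_mulVec, ← mulVec_mulVec, boostGen_mulVec,
    lorentz_sub_right, lorentz_add_right, lorentz_smul_right, h.left, h.right, h.orth, h3]
  rw [← Real.cosh_add_sinh]
  module

lemma IsHyperbolicPair.boostMatrix_mulVec_sub {v u : Fin (n + 1) → ℝ} (h : IsHyperbolicPair v u)
    (t : ℝ) : boostMatrix v u t *ᵥ (v - u) = Real.exp (-t) • (v - u) := by
  have h3 : lorentz u v = 0 := by rw [lorentz_comm, h.orth]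
  simp only [boostMatrix, add_mulVec, smul_mulVec, one_mulVec, ← mulVec_mulVec, boostGen_mulVec,
    lorentz_sub_right, lorentz_smul_right, h.left, h.right, h.orth, h3]
  rw [← Real.cosh_sub_sinh]
  module

/-- The first and the last singular value gap of a boost times an orthogonal matrix. -/
lemma IsHyperbolicPair.le_log_singularValue_div (hn : 1 ≤ n) {u : Fin (n + 1) → ℝ}
    (h : IsHyperbolicPair (timeVec n) u) {t : ℝ} (ht : 0 ≤ t) {k : SO1 n}
    (hk : k.1.1 *ᵥ timeVec n = timeVec n ∨ k.1.1 *ᵥ timeVec n = -timeVec n) :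
    t ≤ Real.log (singularValue 1 (h.boost t * k).1 / singularValue 2 (h.boost t * k).1) ∧
      t ≤ Real.log (singularValue n (h.boost t * k).1 /
        singularValue (n + 1) (h.boost t * k).1) := by
  have hkk := transpose_mul_self_of_timeVec hk
  have hkk' : k.1.1 * k.1.1ᵀ = 1 := mul_eq_one_comm.mp hkk
  set B := boostMatrix (timeVec n) u (2 * t) with hB
  have hM : (h.boost t * k).1.1ᵀ * (h.boost t * k).1.1 = k.1.1ᵀ * B * k.1.1 := by
    rw [SO1_coe_mul, transpose_mul, h.boost_coe, h.transpose_boostMatrix, hB, two_mul,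
      h.boostMatrix_add]
    simp only [Matrix.mul_assoc]
  have happ : ∀ x, (k.1.1ᵀ * B * k.1.1) *ᵥ (k.1.1ᵀ *ᵥ x) = k.1.1ᵀ *ᵥ (B *ᵥ x) := by
    intro x
    rw [mulVec_mulVec, mulVec_mulVec, Matrix.mul_assoc, hkk', mul_one]
  have hne : ∀ x, x ≠ 0 → k.1.1ᵀ *ᵥ x ≠ 0 := by
    intro x hx h0
    have := congrArg (fun z => k.1.1 *ᵥ z) h0
    simp only [mulVec_mulVec, hkk', one_mulVec, mulVec_zero] at this
    exact hx this
  have hadd : timeVec n + u ≠ 0 := by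
    intro h0
    have := congrFun h0 0
    simp [timeVec, h.apply_zero] at this
  have hsub : timeVec n - u ≠ 0 := by
    intro h0
    have := congrFun h0 0
    simp [timeVec, h.apply_zero] at this
  have key := log_le_log_singularValue_div hn (h.boost t * k).1 (E := Real.exp (2 * t))
    (Real.one_le_exp (by linarith)) (hne _ hadd) (hne _ hsub) ?_ ?_ ?_
  · rw [Real.log_exp, mul_div_cancel_left₀ _ (two_ne_zero)] at key
    exact key
  · rw [hM, happ, h.boostMatrix_mulVec_add, mulVec_smul]
  · rw [hM, happ, h.boostMatrix_mulVec_sub, mulVec_smul, Real.exp_neg]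
  · intro μ x hx hμ
    rw [hM] at hμ
    have hx' : x = k.1.1ᵀ *ᵥ (k.1.1 *ᵥ x) := by rw [mulVec_mulVec, hkk, one_mulVec]
    have hkx : k.1.1 *ᵥ x ≠ 0 := by
      intro h0
      rw [h0, mulVec_zero] at hx'
      exact hx hx'
    have hBx : B *ᵥ (k.1.1 *ᵥ x) = μ • (k.1.1 *ᵥ x) := by
      have := congrArg (fun z => k.1.1 *ᵥ z) hμ
      simp only [mulVec_mulVec, mulVec_smul, ← Matrix.mul_assoc, hkk', one_mul] at this
      rwa [mulVec_mulVec]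
    rcases h.eigen_boostMatrix hkx hBx with h1 | ⟨h1, c, hc⟩ | ⟨h1, c, hc⟩
    · exact Or.inl h1
    · exact Or.inr (Or.inl ⟨h1, c, by rw [hx', hc, mulVec_smul]⟩)
    · exact Or.inr (Or.inr ⟨by rw [h1, Real.exp_neg], c, by rw [hx', hc, mulVec_smul]⟩)

end SingularValues

/-! ### Uniform lattices are Anosov -/

section Anosov

open Pointwise

/-- Words from chains of group elements with bounded steps. -/
lemma exists_word_of_prod {G : Type*} [Group G] {Γ : Subgroup G} {K B : Set G} (h1 : (1 : G) ∈ K)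
    (hcov : ∀ g : G, ∃ k ∈ K, ∃ γ ∈ Γ, g = k * γ) {S : Set Γ}
    (hS : ∀ γ : Γ, ∀ k ∈ K, ∀ k' ∈ K, ∀ b ∈ B, (γ : G) = k⁻¹ * b * k' → γ ∈ S)
    (l : List G) (hl : ∀ b ∈ l, b ∈ B) : ∀ b ∈ B, ∀ k ∈ K, ∀ γ : Γ, k * γ = b * l.prod →
      ∃ w : List Γ, (∀ s ∈ w, s ∈ S) ∧ w.prod = γ ∧ w.length = l.length + 1 := by
  induction l with
  | nil =>
    intro b hb k hk γ h
    refine ⟨[γ], ?_, by simp, by simp⟩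
    simp only [List.mem_singleton, forall_eq]
    refine hS γ k hk 1 h1 b hb ?_
    rw [List.prod_nil, mul_one] at h
    rw [← h]
    group
  | cons c l ih =>
    intro b hb k hk γ h
    obtain ⟨k', hk', γ', hγ', hg⟩ := hcov (c * l.prod)
    obtain ⟨w, hw1, hw2, hw3⟩ := ih (fun x hx => hl x (List.mem_cons_of_mem _ hx)) c
      (hl c List.mem_cons_self) k' hk' ⟨γ', hγ'⟩ hg.symm
    -- From `k * γ = b * k' * γ'` the new letter equals `k⁻¹ * b * k'`, an element of `Γ` of bounded
    -- size.
    refine ⟨(γ * ⟨γ', hγ'⟩⁻¹) :: w, ?_, ?_, by simp [hw3]⟩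
    · intro s hs
      rcases List.mem_cons.mp hs with rfl | hs
      · refine hS _ k hk k' hk' b hb ?_
        rw [List.prod_cons, hg] at h
        have e : (γ : G) = k⁻¹ * (b * (k' * γ')) := by rw [← h]; group
        push_cast
        rw [e]
        group
      · exact hw1 s hs
    · rw [List.prod_cons, hw2, inv_mul_cancel_right]

variable {n : ℕ}

/-- Uniform lattices in `SO(1, n)` are undistorted. -/
lemma IsUniformLattice.exists_word {Γ : Subgroup (SO1 n)} (hΓ : IsUniformLattice Γ) :
    ∃ S : Set Γ, S.Finite ∧ ∀ (u : Fin (n + 1) → ℝ) (h : IsHyperbolicPair (timeVec n) u) (t : ℝ)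
      (k : SO1 n), 0 ≤ t →
      (k.1.1 *ᵥ timeVec n = timeVec n ∨ k.1.1 *ᵥ timeVec n = -timeVec n) →
      ∀ γ : Γ, (γ : SO1 n) = h.boost t * k →
        ∃ w : List Γ, (∀ s ∈ w, s ∈ S) ∧ w.prod = γ ∧ (w.length : ℝ) ≤ t + 3 := by
  have hΓd : DiscreteTopology Γ := hΓ.1.1
  have hee : lorentz (timeVec n) (timeVec n) = 1 := by rw [lorentz_timeVec]; simp [timeVec]
  have hee' : timeVec n ⬝ᵥ timeVec n = 1 := by simp [timeVec]
  obtain ⟨K₀, hK₀, hcov₀⟩ := hΓ.exists_isCompact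
  set K := insert 1 K₀ with hK
  have hKc : IsCompact K := hK₀.insert 1
  have hcov : ∀ g : SO1 n, ∃ k ∈ K, ∃ γ ∈ Γ, g = k * γ := fun g => by
    obtain ⟨k, hk, h⟩ := hcov₀ g
    exact ⟨k, Set.mem_insert_of_mem _ hk, h⟩
  -- The squared Euclidean norm of the image of `timeVec` under a boost by `1`, so that boosts by at
  -- most `1` count as single steps.
  set R := Real.cosh 1 ^ 2 + Real.sinh 1 ^ 2 with hR
  obtain ⟨C, hC, hCB⟩ := exists_isCompact_of_orbit_le hee R
  set B : Set (SO1 n) := {g | (g.1.1 *ᵥ timeVec n) ⬝ᵥ (g.1.1 *ᵥ timeVec n) ≤ R} with hB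
  have hcomp : IsCompact (K⁻¹ * C * K) := (hKc.inv.mul hC).mul hKc
  refine ⟨_, finite_inter_of_isCompact Γ hcomp, ?_⟩
  have hS : ∀ γ : Γ, ∀ k ∈ K, ∀ k' ∈ K, ∀ b ∈ B, (γ : SO1 n) = k⁻¹ * b * k' →
      γ ∈ {γ : Γ | (γ : SO1 n) ∈ K⁻¹ * C * K} := by
    intro γ k hk k' hk' b hb h
    change (γ : SO1 n) ∈ K⁻¹ * C * K
    rw [h]
    exact Set.mul_mem_mul (Set.mul_mem_mul (Set.inv_mem_inv.mpr hk) (hCB b hb)) hk'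
  intro u h t k ht hk γ hγ
  have hR1 : 1 ≤ R := by nlinarith [Real.one_le_cosh 1, sq_nonneg (Real.sinh 1)]
  have hkB : k ∈ B := by
    change (k.1.1 *ᵥ timeVec n) ⬝ᵥ (k.1.1 *ᵥ timeVec n) ≤ R
    rcases hk with h | h <;> simp [h, hee', hR1]
  have huu : u ⬝ᵥ u = 1 := by
    have h1 := h.right
    rw [lorentz, h.apply_zero] at h1
    rw [dotProduct, Fin.sum_univ_succ, h.apply_zero]
    linarith
  have heu : timeVec n ⬝ᵥ u = 0 := by simp [timeVec, h.apply_zero]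
  have hboost : ∀ s : ℝ, 0 ≤ s → s ≤ 1 → h.boost s ∈ B := by
    intro s hs0 hs1
    change ((h.boost s).1.1 *ᵥ timeVec n) ⬝ᵥ ((h.boost s).1.1 *ᵥ timeVec n) ≤ R
    have e : ((h.boost s).1.1 *ᵥ timeVec n) ⬝ᵥ ((h.boost s).1.1 *ᵥ timeVec n) =
        Real.cosh s ^ 2 + Real.sinh s ^ 2 := by
      rw [h.boost_coe, h.boostMatrix_mulVec_left]
      simp only [add_dotProduct, dotProduct_add, smul_dotProduct, dotProduct_smul, hee', huu, heu,
        dotProduct_comm u, smul_eq_mul]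
      ring
    rw [e, hR]
    have h1 : Real.cosh s ≤ Real.cosh 1 :=
      Real.cosh_le_cosh.mpr (by rw [abs_of_nonneg hs0, abs_one]; exact hs1)
    have h2 : Real.sinh s ≤ Real.sinh 1 := Real.sinh_le_sinh.mpr hs1
    have h3 : 0 ≤ Real.sinh s := Real.sinh_nonneg_iff.mpr hs0
    have h4 := Real.cosh_pos s
    gcongr
  set N := ⌈t⌉₊ with hN
  have hNt : t ≤ N := Nat.le_ceil t
  have hstep : h.boost (t / N) ∈ B := by
    refine hboost _ (by positivity) (div_le_one_of_le₀ hNt (by positivity))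
  have hpow : h.boost (t / N) ^ N = h.boost t := by
    rw [h.boost_pow]
    rcases Nat.eq_zero_or_pos N with h0 | h0
    · have : t = 0 := le_antisymm (by simpa [h0] using hNt) ht
      rw [this]; simp
    · rw [mul_div_cancel₀]
      exact_mod_cast h0.ne'
  -- The chain consists of a trivial first step, `N = ⌈t⌉₊` equal boosts and the orthogonal factor:
  -- `N + 2` letters, at most `t + 3`.
  obtain ⟨w, hw1, hw2, hw3⟩ := exists_word_of_prod (Set.mem_insert 1 K₀) hcov hS
    (List.replicate N (h.boost (t / N)) ++ [k]) (by
      intro b hb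
      rcases List.mem_append.mp hb with hb | hb
      · rw [List.eq_of_mem_replicate hb]; exact hstep
      · rw [List.mem_singleton.mp hb]; exact hkB) 1
    (by simpa [h.boost_zero] using hboost 0 le_rfl zero_le_one) 1 (Set.mem_insert 1 K₀) γ
    (by simp [hpow, hγ])
  refine ⟨w, hw1, hw2, ?_⟩
  rw [hw3, List.length_append, List.length_replicate, List.length_singleton]
  have := Nat.ceil_lt_add_one ht
  push_cast
  linarith

/-- A gap of singular values that is at least the size of the boost component gives the Anosov
property of uniform lattices. -/
lemma IsUniformLattice.isAnosov (hn : 1 ≤ n) {Γ : Subgroup (SO1 n)} (hΓ : IsUniformLattice Γ)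
    {j : ℕ} (hj : ∀ (u : Fin (n + 1) → ℝ) (h : IsHyperbolicPair (timeVec n) u) (t : ℝ)
      (k : SO1 n), 0 ≤ t →
      (k.1.1 *ᵥ timeVec n = timeVec n ∨ k.1.1 *ᵥ timeVec n = -timeVec n) →
      t ≤ Real.log (singularValue j (h.boost t * k).1 /
        singularValue (j + 1) (h.boost t * k).1)) :
    IsAnosov j (Γ.map (SO1 n).subtype) := by
  classical
  obtain ⟨S, hS, hword⟩ := hΓ.exists_word
  let e : Γ ≃* Γ.map (SO1 n).subtype :=
    Γ.equivMapOfInjective (SO1 n).subtype Subtype.val_injective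
  have he : ∀ γ : Γ, ((e γ : Γ.map (SO1 n).subtype) : SpecialLinearGroup (Fin (n + 1)) ℝ) =
      (γ : SO1 n).1 := fun γ => rfl
  have key : ∀ δ : Γ.map (SO1 n).subtype, ∃ t : ℝ, ∃ w : List (Γ.map (SO1 n).subtype),
      (∀ s ∈ w, s ∈ hS.toFinset.image e) ∧ w.prod = δ ∧ (w.length : ℝ) ≤ t + 3 ∧
      t ≤ Real.log (singularValue j δ.1 / singularValue (j + 1) δ.1) := by
    intro δ
    obtain ⟨γ, rfl⟩ := e.surjective δ
    obtain ⟨u, h, t, k, ht, hγ, hk⟩ := exists_boost_mul hn (γ : SO1 n)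
    obtain ⟨w, hw1, hw2, hw3⟩ := hword u h t k ht hk γ hγ
    refine ⟨t, w.map e, ?_, ?_, by simpa using hw3, ?_⟩
    · intro s hs
      obtain ⟨s', hs', rfl⟩ := List.mem_map.mp hs
      exact Finset.mem_image_of_mem _ (hS.mem_toFinset.mpr (hw1 s' hs'))
    · rw [List.prod_hom, hw2]
    · rw [he, hγ]
      exact hj u h t k ht hk
  refine ⟨hS.toFinset.image e, ?_, 1, one_pos, 3, by norm_num, fun δ => ?_⟩
  · rw [Subgroup.eq_top_iff']
    intro δ
    obtain ⟨t, w, hw1, rfl, -⟩ := key δ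
    exact Subgroup.list_prod_mem _ fun s hs => Subgroup.subset_closure (hw1 s hs)
  · obtain ⟨t, w, hw1, hw2, hw3, ht⟩ := key δ
    have hle : wordLength ((hS.toFinset.image e : Finset _) : Set (Γ.map (SO1 n).subtype)) δ ≤
        w.length := Nat.sInf_le ⟨w, fun x hx => Or.inl (hw1 x hx), hw2, rfl⟩
    have hle' : (wordLength ((hS.toFinset.image e : Finset _) : Set (Γ.map (SO1 n).subtype)) δ : ℝ)
        ≤ w.length := by exact_mod_cast hle
    linarith

/-- Uniform lattices in `SO(1, n)` are projective Anosov. -/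
theorem IsUniformLattice.isProjectiveAnosov (hn : 1 ≤ n) {Γ : Subgroup (SO1 n)}
    (hΓ : IsUniformLattice Γ) : IsProjectiveAnosov (Γ.map (SO1 n).subtype) :=
  hΓ.isAnosov hn fun _ h _ _ ht hk => (h.le_log_singularValue_div hn ht hk).1

/-- Uniform lattices in `SO(1, 2)` are Borel Anosov. -/
theorem IsUniformLattice.isBorelAnosov (hn : n = 2) {Γ : Subgroup (SO1 n)}
    (hΓ : IsUniformLattice Γ) : IsBorelAnosov (Γ.map (SO1 n).subtype) := by
  subst hn
  intro j hj1 hj3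
  obtain rfl | rfl : j = 1 ∨ j = 2 := by omega
  · exact hΓ.isProjectiveAnosov (by norm_num)
  · exact hΓ.isAnosov (by norm_num) fun _ h _ _ ht hk =>
      (h.le_log_singularValue_div (by norm_num) ht hk).2

end Anosov

/-! ### Covering radius of lattices in vector spaces -/

section Covering

variable {E : Type*} [NormedAddCommGroup E] [NormedSpace ℝ E] [FiniteDimensional ℝ E]
  [MeasurableSpace E] [BorelSpace E] (μ : Measure E) [μ.IsAddHaarMeasure]

omit [NormedSpace ℝ E] [FiniteDimensional ℝ E] in
/-- A measurable set with disjoint translates has at most the measure of a set whose translates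
cover the space. -/
lemma measure_le_of_disjoint_translates (Λ : AddSubgroup E) [Countable Λ] {s F : Set E}
    (hs : MeasurableSet s) (hF : MeasurableSet F)
    (hdisj : ∀ x ∈ s, ∀ y ∈ s, x - y ∈ Λ → x = y) (hcov : ∀ x, ∃ l ∈ Λ, x - l ∈ F) :
    μ s ≤ μ F := by
  have h1 : s ⊆ ⋃ l : Λ, s ∩ (fun x => x + -(l : E)) ⁻¹' F := by
    intro x hx
    obtain ⟨l, hl, h⟩ := hcov x
    exact Set.mem_iUnion.mpr ⟨⟨l, hl⟩, hx, by simpa [sub_eq_add_neg] using h⟩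
  have hm : ∀ l : Λ, MeasurableSet ((fun x => x + (l : E)) ⁻¹' s ∩ F) := fun l =>
    (hs.preimage (measurable_add_const _)).inter hF
  have h2 : ∀ l : Λ, μ (s ∩ (fun x => x + -(l : E)) ⁻¹' F) =
      μ ((fun x => x + (l : E)) ⁻¹' s ∩ F) := by
    intro l
    rw [← measure_preimage_add_right μ (l : E) (s ∩ (fun x => x + -(l : E)) ⁻¹' F)]
    congr 1
    ext x
    simp
  calc μ s ≤ μ (⋃ l : Λ, s ∩ (fun x => x + -(l : E)) ⁻¹' F) := measure_mono h1
    _ ≤ ∑' l : Λ, μ (s ∩ (fun x => x + -(l : E)) ⁻¹' F) := measure_iUnion_le _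
    _ = ∑' l : Λ, μ ((fun x => x + (l : E)) ⁻¹' s ∩ F) := by simp only [h2]
    _ = μ (⋃ l : Λ, (fun x => x + (l : E)) ⁻¹' s ∩ F) := by
        refine (measure_iUnion (fun l l' hll' => Set.disjoint_left.mpr ?_) hm).symm
        intro x hx hx'
        refine hll' (Subtype.ext ?_)
        have h3 := hdisj _ hx.1 _ hx'.1 (by
          have : x + (l : E) - (x + (l' : E)) = ((l - l' : Λ) : E) := by push_cast; abel
          rw [this]
          exact SetLike.coe_mem _)
        exact add_left_cancel h3
    _ ≤ μ F := measure_mono (Set.iUnion_subset fun l => Set.inter_subset_right)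

omit [FiniteDimensional ℝ E] in
/-- The covering radius of a lattice is bounded in terms of a lower bound for the length of its
nonzero vectors and an upper bound for its covolume. -/
lemma exists_covering_radius {ε : ℝ} (hε : 0 < ε) {M : ENNReal} (hM : M < ⊤) :
    ∃ ρ : ℝ, 0 < ρ ∧ ∀ Λ : AddSubgroup E, Countable Λ → (∀ l ∈ Λ, ‖l‖ < ε → l = 0) →
      (∃ F : Set E, MeasurableSet F ∧ μ F ≤ M ∧ ∀ x, ∃ l ∈ Λ, x - l ∈ F) →
      ∀ x, ∃ l ∈ Λ, ‖x - l‖ ≤ ρ := by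
  set V := μ (Metric.ball (0 : E) (ε / 2)) with hV
  have hV0 : V ≠ 0 := (Metric.measure_ball_pos μ 0 (half_pos hε)).ne'
  obtain ⟨m, hm⟩ : ∃ m : ℕ, M < m * V := by
    rcases eq_or_ne V ⊤ with h | h
    · exact ⟨1, by simpa [h] using hM⟩
    · obtain ⟨m, hm⟩ := ENNReal.exists_nat_mul_gt hV0 hM.ne
      exact ⟨m, hm⟩
  refine ⟨m * ε + 1, by positivity, ?_⟩
  rintro Λ hΛ hshort ⟨F, hFm, hFM, hcov⟩ x
  by_contra hx
  push Not at hx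
  have h0Λ : (0 : E) ∈ (Λ : Set E) := Λ.zero_mem
  -- If `x` is far from `Λ`, the segment from `0` to `x` has points at distance `j * ε` from `Λ` for
  -- each `j < m`. The `ε / 2`-balls about them are pairwise disjoint modulo `Λ`, and each injects
  -- modulo `Λ`, so their total volume `m * V` is at most the covolume bound `M`, against the choice
  -- of `m`.
  set f : ℝ → ℝ := fun t => Metric.infDist (t • x) (Λ : Set E) with hf
  have hfc : Continuous f := (Metric.continuous_infDist_pt _).comp (by fun_prop)
  have hf0 : f 0 = 0 := by
    simp only [hf, zero_smul]
    exact Metric.infDist_zero_of_mem h0Λ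
  have hf1 : m * ε ≤ f 1 := by
    simp only [hf, one_smul]
    refine (Metric.le_infDist ⟨0, h0Λ⟩).mpr fun l hl => ?_
    rw [dist_eq_norm]
    have := hx l hl
    linarith
  have hsub : Set.Icc (f 0) (f 1) ⊆ f '' Set.Icc 0 1 :=
    intermediate_value_Icc zero_le_one hfc.continuousOn
  have hex : ∀ j : Fin m, ∃ t : ℝ, f t = j * ε := by
    intro j
    have : (j : ℝ) * ε ∈ Set.Icc (f 0) (f 1) := by
      refine ⟨by rw [hf0]; positivity, le_trans ?_ hf1⟩
      have : (j : ℝ) ≤ m := by exact_mod_cast j.2.le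
      gcongr
    obtain ⟨t, -, ht⟩ := hsub this
    exact ⟨t, ht⟩
  choose t ht using hex
  have hinv : ∀ y, ∀ l ∈ Λ, Metric.infDist (y - l) (Λ : Set E) ≤ Metric.infDist y (Λ : Set E) := by
    intro y l hl
    refine (Metric.le_infDist ⟨0, h0Λ⟩).mpr fun l' hl' => ?_
    have := Metric.infDist_le_dist_of_mem (x := y - l) (Λ.sub_mem hl' hl)
    rwa [dist_sub_right] at this
  have hdist : ∀ y z, y - z ∈ Λ → Metric.infDist y (Λ : Set E) = Metric.infDist z (Λ : Set E) := by
    intro y z h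
    refine le_antisymm ?_ ?_
    · have := hinv z _ (Λ.neg_mem h)
      simpa using this
    · have := hinv y _ h
      simpa using this
  have hsep : ∀ i j y z, y ∈ Metric.ball (t i • x) (ε / 2) → z ∈ Metric.ball (t j • x) (ε / 2) →
      y - z ∈ Λ → i = j := by
    intro i j y z hy hz hyz
    have h1 := Metric.infDist_le_infDist_add_dist (s := (Λ : Set E)) (x := t i • x) (y := y)
    have h2 := Metric.infDist_le_infDist_add_dist (s := (Λ : Set E)) (x := y) (y := t i • x)
    have h3 := Metric.infDist_le_infDist_add_dist (s := (Λ : Set E)) (x := t j • x) (y := z)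
    have h4 := Metric.infDist_le_infDist_add_dist (s := (Λ : Set E)) (x := z) (y := t j • x)
    have e1 : Metric.infDist (t i • x) (Λ : Set E) = i * ε := ht i
    have e2 : Metric.infDist (t j • x) (Λ : Set E) = j * ε := ht j
    rw [dist_comm] at h1 h3
    rw [Metric.mem_ball] at hy hz
    have h5 := hdist y z hyz
    have h6 : ((i : ℝ) - j) * ε < 1 * ε := by linarith
    have h7 : ((j : ℝ) - i) * ε < 1 * ε := by linarith
    have h8 := lt_of_mul_lt_mul_right h6 hε.le
    have h9 := lt_of_mul_lt_mul_right h7 hε.le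
    have h10 : (i : ℕ) < (j : ℕ) + 1 := by
      have : (i : ℝ) < (j : ℝ) + 1 := by linarith
      exact_mod_cast this
    have h11 : (j : ℕ) < (i : ℕ) + 1 := by
      have : (j : ℝ) < (i : ℝ) + 1 := by linarith
      exact_mod_cast this
    exact Fin.ext (by omega)
  set s : Set E := ⋃ j : Fin m, Metric.ball (t j • x) (ε / 2) with hs
  have hsm : MeasurableSet s := MeasurableSet.iUnion fun j => measurableSet_ball
  have hμs : μ s = m * V := by
    rw [hs, measure_iUnion (fun i j hij => Set.disjoint_left.mpr fun y hy hz =>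
      hij (hsep i j y y hy hz (by simp))) fun j => measurableSet_ball]
    simp [Measure.addHaar_ball_center, hV]
  have hle := measure_le_of_disjoint_translates μ Λ hsm hFm (fun y hy z hz hyz => by
    obtain ⟨i, hi⟩ := Set.mem_iUnion.mp hy
    obtain ⟨j, hj⟩ := Set.mem_iUnion.mp hz
    obtain rfl := hsep i j y z hi hj hyz
    have h1 : ‖y - z‖ < ε := by
      rw [← dist_eq_norm]
      have := dist_triangle_right y z (t i • x)
      rw [Metric.mem_ball] at hi hj
      linarith
    exact sub_eq_zero.mp (hshort _ hyz h1)) hcov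
  rw [hμs] at hle
  exact absurd (hle.trans hFM) (not_le.mpr hm)

end Covering

/-! ### The ring `ℤ[√2]` and its two real embeddings -/

section Quadratic

open Zsqrtd

/-- The embedding `√2 ↦ √2`. -/
def emb₁ : ℤ√2 →+* ℝ := Zsqrtd.lift ⟨Real.sqrt 2, by simp⟩

/-- The embedding `√2 ↦ -√2`. -/
def emb₂ : ℤ√2 →+* ℝ := Zsqrtd.lift ⟨-Real.sqrt 2, by simp⟩

lemma emb₁_apply (x : ℤ√2) : emb₁ x = x.re + x.im * Real.sqrt 2 := rfl

lemma emb₂_apply (x : ℤ√2) : emb₂ x = x.re - x.im * Real.sqrt 2 := by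
  change (x.re : ℝ) + x.im * -Real.sqrt 2 = _
  ring

lemma emb₁_mul_emb₂ (x : ℤ√2) : emb₁ x * emb₂ x = (x.norm : ℤ) := by
  have h := Real.mul_self_sqrt (show (0 : ℝ) ≤ 2 by norm_num)
  rw [emb₁_apply, emb₂_apply, norm_def]
  push_cast
  linear_combination -(x.im : ℝ) ^ 2 * h

lemma two_ne_mul_self (m : ℤ) : (2 : ℤ) ≠ m * m := by
  intro h
  have h1 : m < 2 := by nlinarith
  have h2 : -2 < m := by nlinarith
  interval_cases m <;> omega

lemma emb₁_injective : Function.Injective emb₁ := Zsqrtd.lift_injective _ two_ne_mul_self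

lemma emb₂_injective : Function.Injective emb₂ := Zsqrtd.lift_injective _ two_ne_mul_self

/-- The product of the two conjugates is the norm, an integer. All discreteness statements below
come from this. -/
lemma eq_zero_of_abs_emb_mul_lt {x : ℤ√2} (h : |emb₁ x| * |emb₂ x| < 1) : x = 0 := by
  rw [← abs_mul, emb₁_mul_emb₂] at h
  have h1 : |x.norm| < 1 := by exact_mod_cast h
  exact (norm_eq_zero two_ne_mul_self x).mp (Int.abs_lt_one_iff.mp h1)

lemma natAbs_norm_le {x : ℤ√2} {R : ℝ} (h1 : |emb₁ x| ≤ R) (h2 : |emb₂ x| ≤ R) :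
    x.norm.natAbs ≤ ⌈R * R⌉₊ := by
  have h3 : |(x.norm : ℝ)| ≤ R * R := by
    rw [← emb₁_mul_emb₂, abs_mul]
    exact mul_le_mul h1 h2 (abs_nonneg _) ((abs_nonneg _).trans h1)
  have h4 : (x.norm.natAbs : ℝ) ≤ ⌈R * R⌉₊ := by
    rw [Nat.cast_natAbs, Int.cast_abs]
    exact h3.trans (Nat.le_ceil _)
  exact_mod_cast h4

lemma finite_emb_le (R : ℝ) : {x : ℤ√2 | |emb₁ x| ≤ R ∧ |emb₂ x| ≤ R}.Finite := by
  have hinj : Function.Injective fun x : ℤ√2 => (x.re, x.im) := fun x y h => by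
    rw [Prod.mk.injEq] at h
    exact Zsqrtd.ext h.1 h.2
  refine Set.Finite.of_finite_image (f := fun x : ℤ√2 => (x.re, x.im)) ?_ hinj.injOn
  refine ((Set.finite_Icc (-⌈R⌉) ⌈R⌉).prod (Set.finite_Icc (-⌈R⌉) ⌈R⌉)).subset ?_
  rintro _ ⟨x, ⟨h1, h2⟩, rfl⟩
  have hs : 1 ≤ Real.sqrt 2 := Real.one_le_sqrt.mpr one_le_two
  rw [emb₁_apply, abs_le] at h1
  rw [emb₂_apply, abs_le] at h2
  have hre : |(x.re : ℝ)| ≤ R := abs_le.mpr ⟨by linarith, by linarith⟩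
  have him : |(x.im : ℝ)| ≤ R := by
    have h3 : |(x.im : ℝ) * Real.sqrt 2| ≤ R := abs_le.mpr ⟨by linarith, by linarith⟩
    rw [abs_mul, abs_of_nonneg (Real.sqrt_nonneg 2)] at h3
    nlinarith [abs_nonneg (x.im : ℝ)]
  have hceil : ∀ z : ℤ, |(z : ℝ)| ≤ R → z ∈ Set.Icc (-⌈R⌉) ⌈R⌉ := by
    intro z hz
    have : |z| ≤ ⌈R⌉ := by exact_mod_cast hz.trans (Int.le_ceil R)
    exact abs_le.mp this
  exact ⟨hceil _ hre, hceil _ him⟩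

lemma exists_approx_emb (x y : ℝ) : ∃ z : ℤ√2, |x - emb₁ z| ≤ 2 ∧ |y - emb₂ z| ≤ 2 := by
  have hs := Real.mul_self_sqrt (show (0 : ℝ) ≤ 2 by norm_num)
  have hs0 : 0 < Real.sqrt 2 := Real.sqrt_pos.mpr two_pos
  have hs2 : Real.sqrt 2 ≤ 2 := by nlinarith
  set a := (x + y) / 2 with ha
  set b := (x - y) / (2 * Real.sqrt 2) with hb
  have hb' : b * Real.sqrt 2 = (x - y) / 2 := by rw [hb]; field_simp
  have h1 := abs_sub_round a
  have h2 := abs_sub_round b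
  have h3 : |(b - round b) * Real.sqrt 2| ≤ 1 := by
    rw [abs_mul, abs_of_pos hs0]
    nlinarith [abs_nonneg (b - round b)]
  refine ⟨⟨round a, round b⟩, ?_, ?_⟩
  · have e : x - emb₁ ⟨round a, round b⟩ = (a - round a) + (b - round b) * Real.sqrt 2 := by
      rw [emb₁_apply, sub_mul, hb', ha]; ring
    rw [e]
    exact (abs_add_le _ _).trans (by linarith)
  · have e : y - emb₂ ⟨round a, round b⟩ = (a - round a) - (b - round b) * Real.sqrt 2 := by
      rw [emb₂_apply, sub_mul, hb', ha]; ring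
    rw [e]
    exact (abs_sub _ _).trans (by linarith)

/-- An element divides its norm. This provides one modulus that serves for all determinants of
bounded norm. -/
lemma dvd_factorial_of_natAbs_norm_le {x : ℤ√2} (hx : x ≠ 0) {B : ℕ} (h : x.norm.natAbs ≤ B) :
    x ∣ (B.factorial : ℤ√2) := by
  have h0 : 0 < x.norm.natAbs := by
    rw [Int.natAbs_pos]
    exact fun h0 => hx ((norm_eq_zero two_ne_mul_self x).mp h0)
  have h1 : x ∣ (x.norm : ℤ√2) := ⟨star x, norm_eq_mul_conj x⟩
  have h2 : x.norm ∣ (B.factorial : ℤ) :=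
    Int.natAbs_dvd.mp (Int.natCast_dvd_natCast.mpr (Nat.dvd_factorial h0 h))
  have h3 : (x.norm : ℤ√2) ∣ ((B.factorial : ℤ) : ℤ√2) := (intCast_dvd_intCast _ _).mpr h2
  refine h1.trans ?_
  exact_mod_cast h3

instance : Countable (ℤ√2) := by
  have hinj : Function.Injective fun x : ℤ√2 => (x.re, x.im) := fun x y h => by
    rw [Prod.mk.injEq] at h
    exact Zsqrtd.ext h.1 h.2
  exact hinj.countable

end Quadratic

/-! ### An arithmetic uniform lattice in `SO(1, n)` -/

section Arithmetic

open Zsqrtd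

variable {n : ℕ}

instance : IsDomain (ℤ√2) := emb₁_injective.isDomain

/-- The form `√2 x₀² - x₁² - ⋯ - xₙ²` over `ℤ[√2]`. -/
def arithForm (v w : Fin (n + 1) → ℤ√2) : ℤ√2 :=
  sqrtd * (v 0 * w 0) - ∑ i : Fin n, v i.succ * w i.succ

variable (n) in
/-- The Gram matrix of `arithForm`. -/
def arithMatrix : Matrix (Fin (n + 1)) (Fin (n + 1)) (ℤ√2) :=
  diagonal (Fin.cons sqrtd fun _ => -1)

variable (n) in
/-- The real diagonal matrix that carries the first conjugate of `arithForm` to `lorentz`. -/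
def scaleMatrix : Matrix (Fin (n + 1)) (Fin (n + 1)) ℝ :=
  diagonal (Fin.cons (Real.sqrt (Real.sqrt 2)) fun _ => 1)

lemma arithForm_eq_dotProduct (v w : Fin (n + 1) → ℤ√2) :
    arithForm v w = v ⬝ᵥ (arithMatrix n *ᵥ w) := by
  simp [arithForm, arithMatrix, dotProduct, mulVec_diagonal, Fin.sum_univ_succ, sub_eq_add_neg]
  ring

lemma transpose_mul_arithMatrix_mul_apply (W : Matrix (Fin (n + 1)) (Fin (n + 1)) (ℤ√2))
    (i j : Fin (n + 1)) :
    (Wᵀ * arithMatrix n * W) i j = arithForm (W.col i) (W.col j) := by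
  rw [arithForm_eq_dotProduct, Matrix.mul_assoc, Matrix.mul_apply_eq_vecMul]
  rfl

lemma emb₁_sqrtd : emb₁ sqrtd = Real.sqrt 2 := by simp [emb₁_apply]

lemma emb₂_sqrtd : emb₂ sqrtd = -Real.sqrt 2 := by simp [emb₂_apply]

lemma sqrt_two_le_two : Real.sqrt 2 ≤ 2 := by
  rw [Real.sqrt_le_left two_pos.le]; norm_num

lemma emb₂_arithForm (v w : Fin (n + 1) → ℤ√2) :
    emb₂ (arithForm v w) = -(Real.sqrt 2 * (emb₂ (v 0) * emb₂ (w 0)) +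
      ∑ i : Fin n, emb₂ (v i.succ) * emb₂ (w i.succ)) := by
  simp only [arithForm, map_sub, map_mul, map_sum, emb₂_sqrtd]
  ring

/-- The second conjugate of the form is negative definite with coefficients of absolute value at
least one. In particular the form is anisotropic, which is the source of cocompactness. -/
lemma sq_emb₂_le (w : Fin (n + 1) → ℤ√2) (i : Fin (n + 1)) :
    emb₂ (w i) ^ 2 ≤ -emb₂ (arithForm w w) := by
  rw [emb₂_arithForm, neg_neg]
  have h1 : 1 ≤ Real.sqrt 2 := Real.one_le_sqrt.mpr one_le_two
  have hs : 0 ≤ ∑ i : Fin n, emb₂ (w i.succ) * emb₂ (w i.succ) :=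
    Finset.sum_nonneg fun i _ => mul_self_nonneg _
  have h0 := mul_self_nonneg (emb₂ (w 0))
  refine Fin.cases ?_ (fun i => ?_) i
  · nlinarith
  · have := Finset.single_le_sum (f := fun i : Fin n => emb₂ (w i.succ) * emb₂ (w i.succ))
      (fun i _ => mul_self_nonneg _) (Finset.mem_univ i)
    nlinarith

lemma abs_emb₂_arithForm_le {v w : Fin (n + 1) → ℤ√2} {C : ℝ} (hv : ∀ i, |emb₂ (v i)| ≤ C)
    (hw : ∀ i, |emb₂ (w i)| ≤ C) : |emb₂ (arithForm v w)| ≤ 2 * (n + 1) * C ^ 2 := by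
  have hvw : ∀ i, |emb₂ (v i) * emb₂ (w i)| ≤ C ^ 2 := fun i => by
    rw [abs_mul, sq]
    exact mul_le_mul (hv i) (hw i) (abs_nonneg _) ((abs_nonneg _).trans (hv i))
  rw [emb₂_arithForm, abs_neg]
  have h1 : |∑ i : Fin n, emb₂ (v i.succ) * emb₂ (w i.succ)| ≤ n * C ^ 2 := by
    refine (Finset.abs_sum_le_sum_abs _ _).trans ?_
    refine (Finset.sum_le_card_nsmul _ _ _ fun i _ => hvw i.succ).trans ?_
    simp
  have h2 : |Real.sqrt 2 * (emb₂ (v 0) * emb₂ (w 0))| ≤ 2 * C ^ 2 := by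
    rw [abs_mul, abs_of_nonneg (Real.sqrt_nonneg 2)]
    exact mul_le_mul sqrt_two_le_two (hvw 0) (abs_nonneg _) two_pos.le
  have h3 : 0 ≤ (n : ℝ) * C ^ 2 := by positivity
  exact (abs_add_le _ _).trans (by linarith)

lemma abs_lorentz_le {v w : Fin (n + 1) → ℝ} {C : ℝ} (hv : ∀ i, |v i| ≤ C)
    (hw : ∀ i, |w i| ≤ C) : |lorentz v w| ≤ 2 * (n + 1) * C ^ 2 := by
  have hvw : ∀ i, |v i * w i| ≤ C ^ 2 := fun i => by
    rw [abs_mul, sq]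
    exact mul_le_mul (hv i) (hw i) (abs_nonneg _) ((abs_nonneg _).trans (hv i))
  have h1 : |∑ i : Fin n, v i.succ * w i.succ| ≤ n * C ^ 2 := by
    refine (Finset.abs_sum_le_sum_abs _ _).trans ?_
    refine (Finset.sum_le_card_nsmul _ _ _ fun i _ => hvw i.succ).trans ?_
    simp
  have h3 : 0 ≤ (n : ℝ) * C ^ 2 := by positivity
  rw [lorentz]
  exact (abs_sub _ _).trans (by linarith [hvw 0, sq_nonneg C])

lemma scaleMatrix_transpose : (scaleMatrix n)ᵀ = scaleMatrix n := by simp [scaleMatrix]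

lemma det_scaleMatrix : (scaleMatrix n).det = Real.sqrt (Real.sqrt 2) := by
  simp [scaleMatrix, Fin.prod_univ_succ]

lemma one_le_det_scaleMatrix : 1 ≤ (scaleMatrix n).det := by
  rw [det_scaleMatrix, Real.one_le_sqrt, Real.one_le_sqrt]
  exact one_le_two

lemma isUnit_det_scaleMatrix : IsUnit (scaleMatrix n).det :=
  (zero_lt_one.trans_le one_le_det_scaleMatrix).ne'.isUnit

lemma scaleMatrix_mul_lorentzMatrix_mul :
    scaleMatrix n * lorentzMatrix n * scaleMatrix n = (arithMatrix n).map emb₁ := by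
  rw [scaleMatrix, lorentzMatrix, arithMatrix, diagonal_mul_diagonal, diagonal_mul_diagonal,
    diagonal_map (map_zero _)]
  congr 1
  funext i
  refine Fin.cases ?_ (fun i => ?_) i
  · simp [emb₁_sqrtd]
  · simp

lemma SO1_scale_transpose_mul (g : SO1 n) :
    (g.1.1 * scaleMatrix n)ᵀ * lorentzMatrix n * (g.1.1 * scaleMatrix n) =
      (arithMatrix n).map emb₁ := by
  have h := congrArg (fun M => scaleMatrix n * M * scaleMatrix n) (SO1_transpose_mul g)
  simp only [scaleMatrix_mul_lorentzMatrix_mul] at h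
  rw [← h, transpose_mul, scaleMatrix_transpose]
  simp only [Matrix.mul_assoc]

lemma det_SO1_scale (g : SO1 n) : (g.1.1 * scaleMatrix n).det = (scaleMatrix n).det := by
  rw [det_mul, g.1.2, one_mul]

lemma emb₁_arithForm (g : SO1 n) (v w : Fin (n + 1) → ℤ√2) :
    emb₁ (arithForm v w) = lorentz ((g.1.1 * scaleMatrix n) *ᵥ (emb₁ ∘ v))
      ((g.1.1 * scaleMatrix n) *ᵥ (emb₁ ∘ w)) := by
  have h := SO1_scale_transpose_mul g
  generalize g.1.1 * scaleMatrix n = G at h ⊢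
  rw [lorentz_eq_dotProduct, dotProduct_comm, dotProduct_mulVec, ← mulVec_transpose,
    dotProduct_comm, mulVec_mulVec, mulVec_mulVec, h, arithForm_eq_dotProduct,
    RingHom.map_dotProduct]
  congr 1
  funext i
  exact RingHom.map_mulVec _ _ _ _

lemma transpose_mul_arithMatrix_mul_of_map {G H : Matrix (Fin (n + 1)) (Fin (n + 1)) ℝ}
    {A : Matrix (Fin (n + 1)) (Fin (n + 1)) (ℤ√2)}
    (hG : Gᵀ * lorentzMatrix n * G = (arithMatrix n).map emb₁)
    (hH : Hᵀ * lorentzMatrix n * H = (arithMatrix n).map emb₁) (h : G = H * A.map emb₁) :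
    Aᵀ * arithMatrix n * A = arithMatrix n := by
  refine Matrix.map_injective emb₁_injective ?_
  change (Aᵀ * arithMatrix n * A).map emb₁ = (arithMatrix n).map emb₁
  rw [← hG, h, Matrix.map_mul, Matrix.map_mul, ← hH, transpose_mul, ← transpose_map]
  simp only [Matrix.mul_assoc]

lemma scaleMatrix_transpose_mul :
    (scaleMatrix n)ᵀ * lorentzMatrix n * scaleMatrix n = (arithMatrix n).map emb₁ := by
  rw [scaleMatrix_transpose, scaleMatrix_mul_lorentzMatrix_mul]

lemma det_eq_one_of_scale {g : SO1 n} {A : Matrix (Fin (n + 1)) (Fin (n + 1)) (ℤ√2)}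
    (h : g.1.1 * scaleMatrix n = scaleMatrix n * A.map emb₁) : A.det = 1 := by
  have h1 := congrArg det h
  rw [det_SO1_scale, det_mul] at h1
  have h2 := mul_left_cancel₀ isUnit_det_scaleMatrix.ne_zero ((mul_one _).trans h1)
  refine emb₁_injective ?_
  rw [map_one, h2, RingHom.map_det, RingHom.mapMatrix_apply]

variable (n) in
/-- The elements of `SO(1, n)` that, in the coordinates given by `scaleMatrix`, have entries in
`ℤ[√2]`. -/
def arithSubgroup : Subgroup (SO1 n) where
  carrier := {g | ∃ A : Matrix (Fin (n + 1)) (Fin (n + 1)) (ℤ√2),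
    g.1.1 * scaleMatrix n = scaleMatrix n * A.map emb₁}
  mul_mem' := by
    rintro g h ⟨A, hA⟩ ⟨B, hB⟩
    refine ⟨A * B, ?_⟩
    rw [SO1_coe_mul, Matrix.mul_assoc, hB, ← Matrix.mul_assoc, hA, Matrix.mul_assoc,
      Matrix.map_mul]
  one_mem' := ⟨1, by rw [SO1_coe_one]; simp⟩
  inv_mem' := by
    rintro g ⟨A, hA⟩
    -- The determinant of `A` is one, so the inverse is again integral.
    refine ⟨A.adjugate, ?_⟩
    have h1 : A.map emb₁ * A.adjugate.map emb₁ = 1 := by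
      rw [← Matrix.map_mul, mul_adjugate, det_eq_one_of_scale hA]
      simp
    calc (g⁻¹).1.1 * scaleMatrix n
        = (g⁻¹).1.1 * (scaleMatrix n * A.map emb₁) * A.adjugate.map emb₁ := by
          rw [Matrix.mul_assoc, Matrix.mul_assoc, h1, Matrix.mul_one]
      _ = scaleMatrix n * A.adjugate.map emb₁ := by
          rw [← hA, ← Matrix.mul_assoc, SO1_inv_mul, Matrix.one_mul]

lemma abs_emb₂_le_two {A : Matrix (Fin (n + 1)) (Fin (n + 1)) (ℤ√2)}
    (hA : Aᵀ * arithMatrix n * A = arithMatrix n) (i j : Fin (n + 1)) : |emb₂ (A i j)| ≤ 2 := by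
  have h1 := sq_emb₂_le (A.col j) i
  rw [← transpose_mul_arithMatrix_mul_apply, hA] at h1
  have h2 : -emb₂ (arithMatrix n j j) ≤ 2 := by
    refine Fin.cases ?_ (fun j => ?_) j
    · simp [arithMatrix, emb₂_sqrtd]
    · simp [arithMatrix]
  exact abs_le_of_sq_le_sq (h1.trans (h2.trans (by norm_num))) two_pos.le

/-- By definiteness of the second conjugate form, the entries of `A - 1` have second conjugate at
most `3`. If the first conjugates are below `1 / 3`, the entries have norm less than one and vanish.
-/
lemma discreteTopology_arithSubgroup : DiscreteTopology (arithSubgroup n) := by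
  set D := scaleMatrix n with hD
  set f : SO1 n → Matrix (Fin (n + 1)) (Fin (n + 1)) ℝ := fun g => D⁻¹ * (g.1.1 * D) - 1 with hf
  have hfc : Continuous f := by
    have := continuous_SO1_coe (n := n)
    simp only [hf]
    fun_prop
  have hU : IsOpen {g : SO1 n | ∀ i j, |f g i j| < 1 / 3} := by
    simp only [Set.ofPred_forall]
    exact isOpen_iInter_of_finite fun i => isOpen_iInter_of_finite fun j =>
      isOpen_lt ((hfc.matrix_elem i j).abs) continuous_const
  refine discreteTopology_of_isOpen_singleton_one ?_
  convert hU.preimage (continuous_subtype_val (p := fun g => g ∈ arithSubgroup n)) using 1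
  ext ⟨g, A, hA⟩
  simp only [Set.mem_singleton_iff, Set.mem_preimage, Set.mem_ofPred_eq]
  have hfg : f g = (A - 1).map emb₁ := by
    simp only [hf, hD]
    rw [hA, ← Matrix.mul_assoc, nonsing_inv_mul _ isUnit_det_scaleMatrix, Matrix.one_mul,
      Matrix.map_sub _ (map_sub _), Matrix.map_one _ (map_zero _) (map_one _)]
  have hform := transpose_mul_arithMatrix_mul_of_map (SO1_scale_transpose_mul g)
    scaleMatrix_transpose_mul hA
  constructor
  · intro h i j
    have h0 : g = 1 := congrArg Subtype.val h
    have : f g = 0 := by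
      simp only [h0, hf, SO1_coe_one, Matrix.one_mul]
      rw [hD, nonsing_inv_mul _ isUnit_det_scaleMatrix, sub_self]
    rw [this]
    simp
  · intro h
    have hA1 : A = 1 := by
      ext1 i j
      refine sub_eq_zero.mp (eq_zero_of_abs_emb_mul_lt (x := A i j - (1 : Matrix _ _ _) i j) ?_)
      have h1 := h i j
      rw [hfg] at h1
      have h2 : |emb₂ (A i j - (1 : Matrix _ _ _) i j)| ≤ 3 := by
        rw [map_sub]
        have h3 : |emb₂ ((1 : Matrix (Fin (n + 1)) (Fin (n + 1)) (ℤ√2)) i j)| ≤ 1 := by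
          rw [Matrix.one_apply]
          split_ifs <;> simp
        exact (abs_sub _ _).trans (by linarith [abs_emb₂_le_two hform i j])
      calc |emb₁ (A i j - (1 : Matrix _ _ _) i j)| * |emb₂ (A i j - (1 : Matrix _ _ _) i j)|
          ≤ |emb₁ (A i j - (1 : Matrix _ _ _) i j)| * 3 := by gcongr
        _ < 1 / 3 * 3 := mul_lt_mul_of_pos_right h1 three_pos
        _ = 1 := by norm_num
    refine Subtype.ext (SO1_ext ?_)
    have h4 : g.1.1 * scaleMatrix n = 1 * scaleMatrix n := by
      rw [hA, hA1]
      simp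
    have h5 := congrArg (· * (scaleMatrix n)⁻¹) h4
    simp only [Matrix.mul_assoc, mul_nonsing_inv _ isUnit_det_scaleMatrix, Matrix.mul_one] at h5
    exact h5

/-! ### Geometry of numbers and cocompactness of the arithmetic group -/

/-- The lattice `ℤ[√2]ⁿ⁺¹`, embedded by its two conjugates, and moved by `g` in the first one. -/
def arithEmbedding (g : SO1 n) :
    (Fin (n + 1) → ℤ√2) →+ (Fin (n + 1) → ℝ) × (Fin (n + 1) → ℝ) where
  toFun w := ((g.1.1 * scaleMatrix n) *ᵥ (emb₁ ∘ w), emb₂ ∘ w)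
  map_zero' := by
    have h1 : emb₁ ∘ (0 : Fin (n + 1) → ℤ√2) = 0 := by funext; simp
    have h2 : emb₂ ∘ (0 : Fin (n + 1) → ℤ√2) = 0 := by funext; simp
    simp [h1, h2]
  map_add' v w := by
    have h1 : emb₁ ∘ (v + w) = emb₁ ∘ v + emb₁ ∘ w := by funext; simp
    have h2 : emb₂ ∘ (v + w) = emb₂ ∘ v + emb₂ ∘ w := by funext; simp
    simp [h1, h2, mulVec_add]

/-- Both conjugates of the value of the form at `w` are then below one, whatever `g` is, because `g`
preserves `lorentz`. The value is zero and `w` vanishes by anisotropy. -/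
lemma arithEmbedding_eq_zero (g : SO1 n) (w : Fin (n + 1) → ℤ√2)
    (h : ‖arithEmbedding g w‖ < 1 / (2 * (n + 1))) : w = 0 := by
  set ε : ℝ := 1 / (2 * (n + 1)) with hε
  have hε0 : 0 < ε := by positivity
  have h1 : ∀ i, |((g.1.1 * scaleMatrix n) *ᵥ (emb₁ ∘ w)) i| ≤ ε := fun i =>
    (norm_le_pi_norm _ i).trans ((norm_fst_le (arithEmbedding g w)).trans h.le)
  have h2 : ∀ i, |emb₂ (w i)| ≤ ε := fun i =>
    (norm_le_pi_norm (emb₂ ∘ w) i).trans ((norm_snd_le (arithEmbedding g w)).trans h.le)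
  have h3 := abs_lorentz_le h1 h1
  rw [← emb₁_arithForm] at h3
  have h4 := abs_emb₂_arithForm_le h2 h2
  have h5 : 2 * (n + 1) * ε ^ 2 = ε := by
    rw [hε]; field_simp
  have h6 : ε < 1 := by
    rw [hε, div_lt_one (by positivity)]
    have : (0 : ℝ) ≤ n := by positivity
    linarith
  rw [h5] at h3 h4
  have h7 : arithForm w w = 0 := eq_zero_of_abs_emb_mul_lt
    ((mul_le_mul h3 h4 (abs_nonneg _) hε0.le).trans_lt (by nlinarith))
  funext i
  have h8 := sq_emb₂_le w i
  rw [h7, map_zero, neg_zero] at h8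
  refine emb₂_injective ?_
  rw [pow_eq_zero_iff two_ne_zero |>.mp (le_antisymm h8 (sq_nonneg _)), Pi.zero_apply, map_zero]

variable (n) in
lemma exists_approx_arithEmbedding : ∃ ρ : ℝ, 0 < ρ ∧ ∀ (g : SO1 n)
    (x : (Fin (n + 1) → ℝ) × (Fin (n + 1) → ℝ)), ∃ w, ‖x - arithEmbedding g w‖ ≤ ρ := by
  let E := (Fin (n + 1) → ℝ) × (Fin (n + 1) → ℝ)
  let μ : Measure E := (volume : Measure (Fin (n + 1) → ℝ)).prod volume
  have hμ : μ.IsAddHaarMeasure := Measure.prod.instIsAddHaarMeasure _ _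
  obtain ⟨ρ, hρ, H⟩ := exists_covering_radius μ
    (ε := 1 / (2 * (n + 1))) (by positivity)
    (M := ENNReal.ofReal |(scaleMatrix n).det| * μ (Metric.closedBall (0 : E) 2))
    (ENNReal.mul_lt_top ENNReal.ofReal_lt_top measure_closedBall_lt_top)
  refine ⟨ρ, hρ, fun g x => ?_⟩
  set G := g.1.1 * scaleMatrix n with hG
  have hGu : IsUnit G.det := by rw [hG, det_SO1_scale]; exact isUnit_det_scaleMatrix
  set T : E →ₗ[ℝ] E := (toLin' G).prodMap LinearMap.id with hT
  have hF : ∃ F : Set E, MeasurableSet F ∧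
      μ F ≤ ENNReal.ofReal |(scaleMatrix n).det| * μ (Metric.closedBall (0 : E) 2) ∧
      ∀ x, ∃ l ∈ (arithEmbedding g).range, x - l ∈ F := by
    -- Coordinatewise rounding in `ℤ[√2]` has error at most `2`. Since `g` has determinant one, the
    -- volume of the image does not depend on `g`, and neither does the covering radius.
    refine ⟨T '' Metric.closedBall 0 2, ?_, ?_, ?_⟩
    · exact ((isCompact_closedBall (0 : E) 2).image
        (LinearMap.continuous_of_finiteDimensional T)).measurableSet
    · rw [Measure.addHaar_image_linearMap, hT, LinearMap.det_prodMap, LinearMap.det_toLin', hG,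
        det_SO1_scale, LinearMap.det_id, mul_one]
    · rintro ⟨x, y⟩
      set u := G⁻¹ *ᵥ x with hu
      choose w hw₁ hw₂ using fun i => exists_approx_emb (u i) (y i)
      refine ⟨_, ⟨w, rfl⟩, (u - emb₁ ∘ w, y - emb₂ ∘ w), ?_, ?_⟩
      · rw [mem_closedBall_zero_iff, Prod.norm_def]
        exact max_le ((pi_norm_le_iff_of_nonneg two_pos.le).mpr hw₁)
          ((pi_norm_le_iff_of_nonneg two_pos.le).mpr hw₂)
      · refine Prod.ext ?_ rfl
        change G *ᵥ (u - emb₁ ∘ w) = x - G *ᵥ (emb₁ ∘ w)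
        rw [mulVec_sub, hu, mulVec_mulVec, mul_nonsing_inv _ hGu, one_mulVec]
  obtain ⟨_, ⟨w, rfl⟩, hw⟩ := H (arithEmbedding g).range
    (Set.countable_range (arithEmbedding g)).to_subtype (by
      rintro _ ⟨w, rfl⟩ hw
      rw [arithEmbedding_eq_zero g w hw, map_zero]) hF x
  exact ⟨w, hw⟩

/-- `W` is a basis of a sublattice of `ℤ[√2]ⁿ⁺¹` whose image under `arithEmbedding g` has entries
bounded by `C`. -/
structure IsBoundedFrame (C : ℝ) (g : SO1 n) (W : Matrix (Fin (n + 1)) (Fin (n + 1)) (ℤ√2)) :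
    Prop where
  left : ∀ i j, |(g.1.1 * scaleMatrix n * W.map emb₁) i j| ≤ C
  right : ∀ i j, |emb₂ (W i j)| ≤ C
  det_ne_zero : W.det ≠ 0

variable (n) in
lemma exists_isBoundedFrame : ∃ C : ℝ, ∀ g : SO1 n, ∃ W, IsBoundedFrame C g W := by
  obtain ⟨ρ, hρ, H⟩ := exists_approx_arithEmbedding n
  -- Lattice points within `ρ` of `R e_j` form a column diagonally dominant matrix: the diagonal is
  -- at least `R - ρ > n * ρ`. Hence the determinant is nonzero.
  set R : ℝ := (n + 1) * ρ + 1 with hR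
  have hR0 : 0 < R := by positivity
  refine ⟨R + ρ, fun g => ?_⟩
  choose w hw using fun j => H g (R • Pi.single j 1, 0)
  set W : Matrix (Fin (n + 1)) (Fin (n + 1)) (ℤ√2) := Matrix.of fun i j => w j i with hW
  set N := g.1.1 * scaleMatrix n * W.map emb₁ with hN
  have h1 : ∀ i j, |R * (Pi.single j (1 : ℝ) : Fin (n + 1) → ℝ) i - N i j| ≤ ρ := fun i j =>
    (norm_le_pi_norm _ i).trans ((norm_fst_le _).trans (hw j))
  have h2 : ∀ i j, |0 - emb₂ (W i j)| ≤ ρ := fun i j =>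
    (norm_le_pi_norm _ i).trans ((norm_snd_le _).trans (hw j))
  have hoff : ∀ i j, i ≠ j → |N i j| ≤ ρ := fun i j hij => by
    have := h1 i j
    rwa [Pi.single_eq_of_ne hij, mul_zero, zero_sub, abs_neg] at this
  have hdiag : ∀ j, |R - N j j| ≤ ρ := fun j => by
    have := h1 j j
    rwa [Pi.single_eq_same, mul_one] at this
  refine ⟨W, fun i j => ?_, fun i j => ?_, fun h0 => ?_⟩
  · rcases eq_or_ne i j with rfl | hij
    · have := abs_le.mp (hdiag i)
      exact abs_le.mpr ⟨by linarith, by linarith⟩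
    · exact (hoff i j hij).trans (by linarith)
  · have := h2 i j
    rw [zero_sub, abs_neg] at this
    linarith
  · refine det_ne_zero_of_sum_col_lt_diag (A := N) (fun k => ?_) ?_
    · calc ∑ i ∈ Finset.univ.erase k, ‖N i k‖ ≤ ∑ i ∈ Finset.univ.erase k, ρ :=
            Finset.sum_le_sum fun i hi => hoff i k (Finset.ne_of_mem_erase hi)
        _ = n * ρ := by simp [Finset.card_erase_of_mem]
        _ < ‖N k k‖ := by
            have := abs_le.mp (hdiag k)
            refine lt_of_lt_of_le ?_ (le_abs_self _)
            linarith
    · rw [hN, det_mul, ← RingHom.mapMatrix_apply, ← RingHom.map_det, h0, map_zero, mul_zero]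

lemma abs_det_le {N : Matrix (Fin (n + 1)) (Fin (n + 1)) ℝ} {C : ℝ} (h : ∀ i j, |N i j| ≤ C) :
    |N.det| ≤ (n + 1).factorial * C ^ (n + 1) := by
  have := det_le (abv := AbsoluteValue.abs) (A := N) h
  simpa using this

namespace IsBoundedFrame

variable {C : ℝ} {g : SO1 n} {W : Matrix (Fin (n + 1)) (Fin (n + 1)) (ℤ√2)}

lemma gram_le (h : IsBoundedFrame C g W) (i j : Fin (n + 1)) :
    |emb₁ ((Wᵀ * arithMatrix n * W) i j)| ≤ 2 * (n + 1) * C ^ 2 ∧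
      |emb₂ ((Wᵀ * arithMatrix n * W) i j)| ≤ 2 * (n + 1) * C ^ 2 := by
  rw [transpose_mul_arithMatrix_mul_apply]
  refine ⟨?_, abs_emb₂_arithForm_le (fun k => h.right k i) fun k => h.right k j⟩
  rw [emb₁_arithForm g]
  exact abs_lorentz_le (fun k => h.left k i) fun k => h.left k j

lemma det_le (h : IsBoundedFrame C g W) :
    |emb₁ W.det| ≤ (n + 1).factorial * C ^ (n + 1) ∧
      |emb₂ W.det| ≤ (n + 1).factorial * C ^ (n + 1) := by
  constructor
  · have h1 := abs_det_le h.left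
    rw [det_mul, det_SO1_scale, abs_mul, ← RingHom.mapMatrix_apply, ← RingHom.map_det] at h1
    refine le_trans (le_mul_of_one_le_left (abs_nonneg _) ?_) h1
    exact one_le_det_scaleMatrix.trans (le_abs_self _)
  · rw [RingHom.map_det]
    exact abs_det_le h.right

end IsBoundedFrame

/-- Two frames with the same Gram matrix and the same determinant, that are congruent modulo this
determinant, are equivalent under the arithmetic subgroup. -/
lemma exists_arithSubgroup_mul_eq {W W' : Matrix (Fin (n + 1)) (Fin (n + 1)) (ℤ√2)} {m : ℤ√2}
    (h0 : W.det ≠ 0) (hm : W.det ∣ m)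
    (hgram : W'ᵀ * arithMatrix n * W' = Wᵀ * arithMatrix n * W) (hdet : W'.det = W.det)
    (hmod : ∀ i j, m ∣ W' i j - W i j) :
    ∃ γ ∈ arithSubgroup n,
      γ.1.1 * scaleMatrix n * W.map emb₁ = scaleMatrix n * W'.map emb₁ := by
  obtain ⟨e, he⟩ := hm
  choose y hy using hmod
  set Y : Matrix (Fin (n + 1)) (Fin (n + 1)) (ℤ√2) := Matrix.of y with hY
  have hW' : W' = W + m • Y := by
    ext1 i j
    rw [Matrix.add_apply, Matrix.smul_apply, hY, Matrix.of_apply, smul_eq_mul, ← hy,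
      add_sub_cancel]
  -- This is `W' * W⁻¹`, integral because `m` absorbs the denominator `W.det`.
  set A := 1 + e • (Y * W.adjugate) with hA
  have hAW : A * W = W' := by
    rw [hA, hW', he, Matrix.add_mul, Matrix.one_mul, smul_mul_assoc, Matrix.mul_assoc,
      adjugate_mul, Matrix.mul_smul, Matrix.mul_one, smul_smul, mul_comm e]
  have hdetA : A.det = 1 := by
    have h1 := congrArg det hAW
    rw [det_mul, hdet] at h1
    exact mul_right_cancel₀ h0 (h1.trans (one_mul _).symm)
  have hW₁ : IsUnit (W.map emb₁).det := by
    rw [← RingHom.mapMatrix_apply, ← RingHom.map_det]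
    exact ((map_ne_zero_iff _ emb₁_injective).mpr h0).isUnit
  set D := scaleMatrix n with hD
  have hDD : D⁻¹ * D = 1 := nonsing_inv_mul _ isUnit_det_scaleMatrix
  have hDD' : D * D⁻¹ = 1 := mul_nonsing_inv _ isUnit_det_scaleMatrix
  have hform : Aᵀ * arithMatrix n * A = arithMatrix n := by
    have h1 : (W.adjugateᵀ * Wᵀ) * (Aᵀ * arithMatrix n * A) * (W * W.adjugate) =
        (W.adjugateᵀ * Wᵀ) * arithMatrix n * (W * W.adjugate) := by
      rw [← hAW, transpose_mul] at hgram
      have := congrArg (fun M => W.adjugateᵀ * M * W.adjugate) hgram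
      simpa only [Matrix.mul_assoc] using this
    rw [← transpose_mul, mul_adjugate, transpose_smul, transpose_one] at h1
    simp only [smul_mul_assoc, Matrix.one_mul, Matrix.mul_smul, Matrix.mul_one, smul_smul] at h1
    exact smul_right_injective _ (mul_ne_zero h0 h0) h1
  have hform₁ : (A.map emb₁)ᵀ * (D * lorentzMatrix n * D) * A.map emb₁ =
      D * lorentzMatrix n * D := by
    rw [hD, scaleMatrix_mul_lorentzMatrix_mul, ← transpose_map, ← Matrix.map_mul, ← Matrix.map_mul,
      hform]
  have hDt : D⁻¹ᵀ = D⁻¹ := by rw [transpose_nonsing_inv, hD, scaleMatrix_transpose]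
  refine ⟨SO1.mk (D * A.map emb₁ * D⁻¹) ?_ ?_, ⟨A, ?_⟩, ?_⟩
  · rw [det_mul, det_mul, mul_right_comm, ← det_mul, hDD', det_one, one_mul,
      ← RingHom.mapMatrix_apply, ← RingHom.map_det, hdetA, map_one]
  · calc (D * A.map emb₁ * D⁻¹)ᵀ * lorentzMatrix n * (D * A.map emb₁ * D⁻¹)
        = D⁻¹ * ((A.map emb₁)ᵀ * (D * lorentzMatrix n * D) * A.map emb₁) * D⁻¹ := by
          rw [transpose_mul, transpose_mul, hDt, hD, scaleMatrix_transpose]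
          simp only [Matrix.mul_assoc]
      _ = (D⁻¹ * D) * lorentzMatrix n * (D * D⁻¹) := by
          rw [hform₁]
          simp only [Matrix.mul_assoc]
      _ = lorentzMatrix n := by rw [hDD, hDD', Matrix.one_mul, Matrix.mul_one]
  · change D * A.map emb₁ * D⁻¹ * D = _
    rw [Matrix.mul_assoc, hDD, Matrix.mul_one]
  · change D * A.map emb₁ * D⁻¹ * D * W.map emb₁ = _
    rw [Matrix.mul_assoc (D * A.map emb₁), hDD, Matrix.mul_one, Matrix.mul_assoc,
      ← Matrix.map_mul, hAW]

/-- The Gram matrix, the determinant and the residue class modulo `m` of a frame. -/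
def frameClass (m : ℕ) (W : Matrix (Fin (n + 1)) (Fin (n + 1)) (ℤ√2)) :
    Matrix (Fin (n + 1)) (Fin (n + 1)) (ℤ√2) × ℤ√2 ×
      (Fin (n + 1) → Fin (n + 1) → ZMod m × ZMod m) :=
  (Wᵀ * arithMatrix n * W, W.det, fun i j => ((W i j).re, (W i j).im))

/-- Gram entries and determinants are elements of `ℤ[√2]` with both conjugates bounded independently
of `g`, and the residue ring is finite. -/
lemma finite_frameClass (C : ℝ) (m : ℕ) [NeZero m] :
    (frameClass m '' {W | ∃ g : SO1 n, IsBoundedFrame C g W}).Finite := by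
  set S := {x : ℤ√2 | |emb₁ x| ≤ 2 * (n + 1) * C ^ 2 ∧ |emb₂ x| ≤ 2 * (n + 1) * C ^ 2}
  have hS : {M : Fin (n + 1) → Fin (n + 1) → ℤ√2 | ∀ i, M i ∈ {v | ∀ j, v j ∈ S}}.Finite :=
    Set.Finite.pi' fun _ => Set.Finite.pi' fun _ => finite_emb_le _
  refine (hS.prod ((finite_emb_le ((n + 1).factorial * C ^ (n + 1))).prod
    Set.finite_univ)).subset ?_
  rintro _ ⟨W, ⟨g, hW⟩, rfl⟩
  exact ⟨fun i j => hW.gram_le i j, hW.det_le, Set.mem_univ _⟩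

lemma exists_arithSubgroup_mul_eq_of_frameClass {C : ℝ} {g : SO1 n}
    {W W' : Matrix (Fin (n + 1)) (Fin (n + 1)) (ℤ√2)} (hW : IsBoundedFrame C g W) {B : ℕ}
    (hB : W.det.norm.natAbs ≤ B)
    (h : frameClass B.factorial W' = frameClass B.factorial W) :
    ∃ γ ∈ arithSubgroup n,
      γ.1.1 * scaleMatrix n * W.map emb₁ = scaleMatrix n * W'.map emb₁ := by
  simp only [frameClass, Prod.mk.injEq] at h
  refine exists_arithSubgroup_mul_eq hW.det_ne_zero
    (dvd_factorial_of_natAbs_norm_le hW.det_ne_zero hB) h.1 h.2.1 fun i j => ?_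
  have h1 := congrFun (congrFun h.2.2 i) j
  obtain ⟨hre, him⟩ := Prod.mk.injEq _ _ _ _ ▸ h1
  have h2 := (intCast_dvd (B.factorial : ℤ) (W' i j - W i j)).mpr
    ⟨(ZMod.intCast_eq_intCast_iff_dvd_sub _ _ _).mp hre.symm,
      (ZMod.intCast_eq_intCast_iff_dvd_sub _ _ _).mp him.symm⟩
  exact_mod_cast h2

/-- For a fixed invertible frame, `g` is recovered from the bounded matrix `g * scaleMatrix * W` by
a fixed right multiplication. -/
lemma isCompact_setOf_isBoundedFrame (C : ℝ)
    (W : Matrix (Fin (n + 1)) (Fin (n + 1)) (ℤ√2)) :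
    IsCompact {g : SO1 n | IsBoundedFrame C g W} := by
  by_cases h : (∀ i j, |emb₂ (W i j)| ≤ C) ∧ W.det ≠ 0
  · set G := scaleMatrix n * W.map emb₁ with hG
    have hGu : IsUnit G.det := by
      rw [hG, det_mul, ← RingHom.mapMatrix_apply, ← RingHom.map_det]
      exact isUnit_det_scaleMatrix.mul ((map_ne_zero_iff _ emb₁_injective).mpr h.2).isUnit
    have hK := isClosedEmbedding_SO1.isCompact_preimage
      ((isCompact_matrix_entries_le (m := Fin (n + 1)) C).image
        (show Continuous fun N : Matrix _ _ ℝ => N * G⁻¹ by fun_prop))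
    convert hK using 1
    ext g
    constructor
    · intro hg
      refine ⟨g.1.1 * G, ?_, ?_⟩
      · rw [hG, ← Matrix.mul_assoc]
        exact hg.left
      · change g.1.1 * G * G⁻¹ = g.1.1
        rw [Matrix.mul_assoc, mul_nonsing_inv _ hGu, Matrix.mul_one]
    · rintro ⟨N, hN, hNg⟩
      refine ⟨?_, h.1, h.2⟩
      have : g.1.1 * scaleMatrix n * W.map emb₁ = N := by
        have hNg' : N * G⁻¹ = g.1.1 := hNg
        rw [Matrix.mul_assoc, ← hG, ← hNg', Matrix.mul_assoc, nonsing_inv_mul _ hGu, Matrix.mul_one]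
      rw [this]
      exact hN
  · convert isCompact_empty
    exact Set.eq_empty_of_forall_notMem fun g hg => h ⟨hg.right, hg.det_ne_zero⟩

variable (n) in
theorem isUniformLattice_arithSubgroup : IsUniformLattice (arithSubgroup n) := by
  obtain ⟨C, hC⟩ := exists_isBoundedFrame n
  set B : ℕ := ⌈((n + 1).factorial * C ^ (n + 1)) * ((n + 1).factorial * C ^ (n + 1))⌉₊ with hB
  have : NeZero B.factorial := ⟨B.factorial_ne_zero⟩
  have hfin := finite_frameClass (n := n) C B.factorial
  choose! r hr hrc using fun t (ht : t ∈ frameClass B.factorial ''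
    {W | ∃ g : SO1 n, IsBoundedFrame C g W}) => ht
  refine isUniformLattice_of_isCompact discreteTopology_arithSubgroup
    (hfin.isCompact_biUnion fun t _ => isCompact_setOf_isBoundedFrame C (r t)) fun g => ?_
  obtain ⟨W, hW⟩ := hC g
  have ht := Set.mem_image_of_mem (frameClass B.factorial)
    (show W ∈ {W | ∃ g : SO1 n, IsBoundedFrame C g W} from ⟨g, hW⟩)
  obtain ⟨g₀, hW₀⟩ := hr _ ht
  obtain ⟨γ, hγ, h⟩ := exists_arithSubgroup_mul_eq_of_frameClass hW₀
    (natAbs_norm_le hW₀.det_le.1 hW₀.det_le.2) (hrc _ ht).symm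
  -- As `γ` carries the chosen representative of the class to `W`, the element `g * γ` has that
  -- representative as a bounded frame, so it lies in one of finitely many compact sets.
  refine ⟨g * γ, Set.mem_biUnion ht ⟨?_, hW₀.right, hW₀.det_ne_zero⟩, γ⁻¹,
    (arithSubgroup n).inv_mem hγ, by group⟩
  rw [SO1_coe_mul, Matrix.mul_assoc, Matrix.mul_assoc, ← Matrix.mul_assoc γ.1.1, h,
    ← Matrix.mul_assoc]
  exact hW.left

end Arithmetic

end DirichletSelberg

end

open DirichletSelberg in
theorem mainTheorem6 (n : ℕ) (hn : 2 ≤ n) :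
    (∀ Γ : Subgroup (SO1 n), IsLattice Γ → ∀ o ∈ hyperbolicCopy n,
      (sides (dirichletSelberg (Γ.map (SO1 n).subtype) o ∩ projModel (n + 1))).Infinite) ∧
    (∀ Γ : Subgroup (SO1 n), IsUniformLattice Γ →
      IsProjectiveAnosov (Γ.map (SO1 n).subtype) ∧
        (n = 2 → IsBorelAnosov (Γ.map (SO1 n).subtype))) ∧
    (∃ Γ : Subgroup (SO1 n), IsUniformLattice Γ ∧
      IsProjectiveAnosov (Γ.map (SO1 n).subtype) ∧
      (n = 2 → IsBorelAnosov (Γ.map (SO1 n).subtype)) ∧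
      ∀ o ∈ hyperbolicCopy n,
        (sides (dirichletSelberg (Γ.map (SO1 n).subtype) o ∩ projModel (n + 1))).Infinite) := by
  have h1 : 1 ≤ n := by omega
  refine ⟨fun Γ hΓ o ho => hΓ.infinite_sides hn ho,
    fun Γ hΓ => ⟨hΓ.isProjectiveAnosov h1, fun h => hΓ.isBorelAnosov h⟩, ?_⟩
  have hΓ := isUniformLattice_arithSubgroup n
  exact ⟨arithSubgroup n, hΓ, hΓ.isProjectiveAnosov h1, fun h => hΓ.isBorelAnosov h,
    fun o ho => hΓ.1.infinite_sides hn ho⟩
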